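/- Let $N\ge 2$ and let $M\subset\mathbb C^N$ be a connected (nonempty) real analytic hypersurface: near each of its points $M$ is the zero set of a real valued, real analytic function $\rho$ with $d\rho\neq 0$ (a defining function). Suppose that $M$ is holomorphically nondegenerate, i.e. that for no $p\in M$ there is a nonzero germ at $p$ of a holomorphic vector field $\sum_k a_k(Z)\,\partial/\partial Z_k$ with $\sum_k a_k\,\partial\rho/\partial Z_k=0$ on $M$ near $p$. For $p\in M$ choose a defining function $\rho(Z,\bar Z)$ of $M$ near $p$ and a basis $L_j=\sum_{k=1}^N a_{jk}(Z,\bar Z)\,\partial/\partial\bar Z_k$, $1\le j\le N-1$, of the CR vector fields on $M$ near $p$, with real analytic coefficients. Denote the complexifications, holomorphic near $(p,\bar p)$, by $\rho(Z,\zeta)$ and $a_{jk}(Z,\zeta)$, put $X_j=\sum_k a_{jk}(p,\zeta)\,\partial/\partial\zeta_k$, $X^\alpha=X_1^{\alpha_1}\cdots X_{N-1}^{\alpha_{N-1}}$ for $\alpha\in\mathbb Z_+^{N-1}$, and $$c_\alpha(Z)=X^\alpha\rho(Z+p,\zeta)\big|_{\zeta=\bar p}\in\mathbb C\{Z\},$$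 where $\mathbb C\{Z\}$ is the ring of convergent power series in $N$ variables. $M$ is essentially finite at $p$ if the ideal generated by all the $c_\alpha$ has finite codimension in $\mathbb C\{Z\}$; in that case $\ell(p)$ is the minimum positive integer $k$ such that the ideal generated by the $c_\alpha$ with $|\alpha|\le k$ has finite codimension. Then there is an integer $\ell(M)$, with $1\le\ell(M)\le N-1$, and an open dense subset of $M$ at every point $p$ of which, for every choice of $\rho$ and $L_j$ as above, $M$ is essentially finite and $\ell(p)=\ell(M)$. Moreover, $\ell(M)=1$ if and only if $M$ is generically Levi nondegenerate, i.e. the Levi form of $M$ is nondegenerate at every point of some open dense subset of $M$. -/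

import Mathlib

open Filter Topology

noncomputable section

/-- Complex `N`-space, with coordinates `Z = (Z 0, …, Z (N - 1))`. -/
abbrev CSpace (N : ℕ) : Type := Fin N → ℂ

namespace CSpace

/-- The `k`-th standard basis vector of `ℂ^N`. -/
def e {N : ℕ} (k : Fin N) : CSpace N := Pi.single k 1

/-- Coordinatewise complex conjugation `Z ↦ Z̄`. -/
def bar {N : ℕ} (Z : CSpace N) : CSpace N := fun k => starRingEnd ℂ (Z k)

/-- The Wirtinger derivative `∂f/∂Z_k = (1/2) (∂f/∂x_k - i ∂f/∂y_k)`, where `Z_k = x_k + i y_k`. -/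
def dZ {N : ℕ} (k : Fin N) (f : CSpace N → ℂ) (Z : CSpace N) : ℂ :=
  (1 / 2 : ℂ) * (fderiv ℝ f Z (e k) - Complex.I * fderiv ℝ f Z (Complex.I • e k))

/-- The Wirtinger derivative `∂f/∂Z̄_k = (1/2) (∂f/∂x_k + i ∂f/∂y_k)`. -/
def dZbar {N : ℕ} (k : Fin N) (f : CSpace N → ℂ) (Z : CSpace N) : ℂ :=
  (1 / 2 : ℂ) * (fderiv ℝ f Z (e k) + Complex.I * fderiv ℝ f Z (Complex.I • e k))

/-- A real-valued function, regarded as a complex-valued one. -/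
def toC {N : ℕ} (ρ : CSpace N → ℝ) : CSpace N → ℂ := fun Z => (ρ Z : ℂ)

/-- `ρ` is a real analytic defining function of `M` near `p`: near `p` it is real analytic with
nonvanishing differential, and `M` is its zero set. -/
structure IsDefiningFunction {N : ℕ} (M : Set (CSpace N)) (p : CSpace N)
    (ρ : CSpace N → ℝ) : Prop where
  analytic : AnalyticAt ℝ ρ p
  fderiv_ne_zero : fderiv ℝ ρ p ≠ 0
  mem_iff : ∀ᶠ Z in 𝓝 p, (Z ∈ M ↔ ρ Z = 0)

/-- `M` is an (embedded, not necessarily closed) real analytic hypersurface in `ℂ^N`. -/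
def IsRealAnalyticHypersurface {N : ℕ} (M : Set (CSpace N)) : Prop :=
  ∀ p ∈ M, ∃ ρ : CSpace N → ℝ, IsDefiningFunction M p ρ

/-- A property holds generically on `M` if it holds at all points of an open and dense subset
of `M` (in the relative topology of `M`). -/
def Generically {N : ℕ} (M : Set (CSpace N)) (P : CSpace N → Prop) : Prop :=
  ∃ U : Set M, IsOpen U ∧ Dense U ∧ ∀ p ∈ U, P (p : CSpace N)

/-! ### Holomorphic nondegeneracy -/

/-- `M` is holomorphically degenerate at `p`: there is a nonzero germ at `p` of a holomorphic
vector field `∑ a_k(Z) ∂/∂Z_k` that is tangent to `M` near `p`, that is, annihilates a defining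
function along `M`. -/
def HolomorphicallyDegenerateAt {N : ℕ} (M : Set (CSpace N)) (p : CSpace N) : Prop :=
  ∃ (ρ : CSpace N → ℝ) (a : Fin N → CSpace N → ℂ),
    IsDefiningFunction M p ρ ∧
    (∀ k, AnalyticAt ℂ (a k) p) ∧
    (¬ ∀ᶠ Z in 𝓝 p, ∀ k, a k Z = 0) ∧
    ∀ᶠ Z in 𝓝 p, Z ∈ M → ∑ k, a k Z * dZ k (toC ρ) Z = 0

/-- `M` is holomorphically nondegenerate: it is not holomorphically degenerate at any point. -/
def HolomorphicallyNondegenerate {N : ℕ} (M : Set (CSpace N)) : Prop :=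
  ∀ p ∈ M, ¬ HolomorphicallyDegenerateAt M p

/-! ### Levi nondegeneracy -/

/-- The Levi form of `ρ` at `p`: `∑ ρ_{Z_j Z̄_k}(p) v_j w̄_k`. -/
def leviForm {N : ℕ} (ρ : CSpace N → ℝ) (p v w : CSpace N) : ℂ :=
  ∑ j, ∑ k, dZ j (dZbar k (toC ρ)) p * v j * starRingEnd ℂ (w k)

/-- `v` (that is, `∑ v_k ∂/∂Z_k`) is a `(1,0)` vector at `p` tangent to the level set of `ρ`. -/
def IsTangent10 {N : ℕ} (ρ : CSpace N → ℝ) (p v : CSpace N) : Prop :=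
  ∑ k, v k * dZ k (toC ρ) p = 0

/-- The Levi form of `M` at `p`, a Hermitian form on the `(1,0)` tangent vectors, is
nondegenerate. -/
def LeviNondegenerateAt {N : ℕ} (M : Set (CSpace N)) (p : CSpace N) : Prop :=
  ∃ ρ : CSpace N → ℝ, IsDefiningFunction M p ρ ∧
    ∀ v, IsTangent10 ρ p v → (∀ w, IsTangent10 ρ p w → leviForm ρ p v w = 0) → v = 0

/-! ### CR vector fields and complexification -/

/-- The vector fields `L_j = ∑_k a_{jk} ∂/∂Z̄_k`, `j = 1, …, N - 1`, have real analytic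
coefficients and form a basis of the CR vector fields of `M` near `p`, where `ρ` is a defining
function of `M`. -/
structure IsCRBasis {N : ℕ} (M : Set (CSpace N)) (p : CSpace N) (ρ : CSpace N → ℝ)
    (a : Fin (N - 1) → Fin N → CSpace N → ℂ) : Prop where
  analytic : ∀ j k, AnalyticAt ℝ (a j k) p
  tangent : ∀ j, ∀ᶠ Z in 𝓝 p, Z ∈ M → ∑ k, a j k Z * dZbar k (toC ρ) Z = 0
  linearIndependent : LinearIndependent ℂ (fun j => (fun k => a j k p : CSpace N))

/-- `F(Z, ζ)` is the complexification near `p` of `f`: it is holomorphic near `(p, p̄)` and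
`F(Z, Z̄) = f(Z)`. (It is unique as a germ, and exists if `f` is real analytic near `p`.) -/
def IsComplexification {N : ℕ} (p : CSpace N) (f : CSpace N → ℂ)
    (F : CSpace N × CSpace N → ℂ) : Prop :=
  AnalyticAt ℂ F (p, bar p) ∧ ∀ᶠ Z in 𝓝 p, F (Z, bar Z) = f Z

/-- Local data for `M` at `p`: a defining function and a basis of the CR vector fields near `p`
(existentially), with the complexifications `R(Z, ζ)` of the defining function and `A_{jk}(Z, ζ)`
of the coefficients of the basis. -/
def IsLocalData {N : ℕ} (M : Set (CSpace N)) (p : CSpace N) (R : CSpace N × CSpace N → ℂ)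
    (A : Fin (N - 1) → Fin N → CSpace N × CSpace N → ℂ) : Prop :=
  ∃ (ρ : CSpace N → ℝ) (a : Fin (N - 1) → Fin N → CSpace N → ℂ),
    IsDefiningFunction M p ρ ∧ IsCRBasis M p ρ a ∧
    IsComplexification p (toC ρ) R ∧ ∀ j k, IsComplexification p (a j k) (A j k)

/-! ### The functions `c_α` and the essential finiteness index -/

/-- The vector field `X_j = ∑_k A_{jk}(p, ζ) ∂/∂ζ_k`, acting on functions of `ζ`. -/
def segreField {N : ℕ} (A : Fin (N - 1) → Fin N → CSpace N × CSpace N → ℂ) (p : CSpace N)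
    (j : Fin (N - 1)) (g : CSpace N → ℂ) : CSpace N → ℂ :=
  fun ζ => ∑ k, A j k (p, ζ) * fderiv ℂ g ζ (e k)

/-- `X^α = X_1^{α_1} ⋯ X_n^{α_n}`, with `n = N - 1`. -/
def segreFieldPow {N : ℕ} (A : Fin (N - 1) → Fin N → CSpace N × CSpace N → ℂ) (p : CSpace N)
    (α : Fin (N - 1) → ℕ) (g : CSpace N → ℂ) : CSpace N → ℂ :=
  (List.finRange (N - 1)).foldr (fun j h => (segreField A p j)^[α j] h) g

/-- `c_α(Z, p, p̄)`, the value at `ζ = p̄` of `X^α R(Z + p, ζ)`, as a function of `Z`. -/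
def cFun {N : ℕ} (R : CSpace N × CSpace N → ℂ)
    (A : Fin (N - 1) → Fin N → CSpace N × CSpace N → ℂ) (p : CSpace N)
    (α : Fin (N - 1) → ℕ) (Z : CSpace N) : ℂ :=
  segreFieldPow A p α (fun ζ => R (Z + p, ζ)) (bar p)

/-- Germs at `0` of complex-valued functions form a `ℂ`-algebra, with scalars acting pointwise. -/
instance germAlgebra (N : ℕ) : Algebra ℂ (Germ (𝓝 (0 : CSpace N)) ℂ) :=
  Algebra.ofModule
    (by
      intro r x y
      induction x, y using Germ.inductionOn₂ with
      | _ f g => exact congrArg _ (smul_mul_assoc r f g))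
    (by
      intro r x y
      induction x, y using Germ.inductionOn₂ with
      | _ f g => exact congrArg _ (mul_smul_comm r f g))

/-- The ring `ℂ{Z}` of convergent power series in `N` variables, realized as the ring of germs at
`0 ∈ ℂ^N` of holomorphic functions. -/
def HolGerm (N : ℕ) : Subalgebra ℂ (Germ (𝓝 (0 : CSpace N)) ℂ) where
  carrier := {g | ∃ f : CSpace N → ℂ, AnalyticAt ℂ f 0 ∧ g = (f : Germ (𝓝 (0 : CSpace N)) ℂ)}
  mul_mem' := by
    rintro _ _ ⟨f, hf, rfl⟩ ⟨g, hg, rfl⟩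
    exact ⟨f * g, hf.mul hg, rfl⟩
  add_mem' := by
    rintro _ _ ⟨f, hf, rfl⟩ ⟨g, hg, rfl⟩
    exact ⟨f + g, hf.add hg, rfl⟩
  algebraMap_mem' := by
    intro c
    refine ⟨fun _ => c, analyticAt_const, ?_⟩
    change (((fun _ => c • (1 : ℂ)) : CSpace N → ℂ) : Germ (𝓝 (0 : CSpace N)) ℂ) = _
    simp

/-- The ideal of `ℂ{Z}` generated by the `c_α(Z, p, p̄)` with `|α| ≤ k`; for `k = ⊤` all
multi-indices `α` are used. (For local data all the `c_α` are holomorphic near `0`, so each of them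
does define an element of `ℂ{Z}`.) -/
def cIdeal {N : ℕ} (R : CSpace N × CSpace N → ℂ)
    (A : Fin (N - 1) → Fin N → CSpace N × CSpace N → ℂ) (p : CSpace N) (k : ℕ∞) :
    Ideal (HolGerm N) :=
  Ideal.span {g | ∃ α : Fin (N - 1) → ℕ, ((∑ j, α j : ℕ) : ℕ∞) ≤ k ∧
    (g : Germ (𝓝 (0 : CSpace N)) ℂ) = (cFun R A p α : Germ (𝓝 (0 : CSpace N)) ℂ)}

/-- An ideal of `ℂ{Z}` is of finite codimension. -/
def FiniteCodim {N : ℕ} (I : Ideal (HolGerm N)) : Prop :=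
  Module.Finite ℂ (HolGerm N ⧸ I)

/-- `M` is essentially finite at `p`: local data exist, and whichever are chosen, the ideal
generated by all the `c_α(Z, p, p̄)` is of finite codimension. -/
def EssentiallyFiniteAt {N : ℕ} (M : Set (CSpace N)) (p : CSpace N) : Prop :=
  (∃ R A, IsLocalData M p R A) ∧ ∀ R A, IsLocalData M p R A → FiniteCodim (cIdeal R A p ⊤)

/-- `M` is essentially finite at `p` and `ℓ(p) = l`: whichever local data are chosen, `l` is the
minimum positive integer such that the ideal generated by the `c_α(Z, p, p̄)`, `|α| ≤ l`, is of
finite codimension. -/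
def HasEssentialIndex {N : ℕ} (M : Set (CSpace N)) (p : CSpace N) (l : ℕ) : Prop :=
  EssentiallyFiniteAt M p ∧
    ∀ R A, IsLocalData M p R A →
      IsLeast {k : ℕ | 1 ≤ k ∧ FiniteCodim (cIdeal R A p (k : ℕ∞))} l

end CSpace

end

/-!
Near `(p, p̄)` the complexification of `M` is the graph of a holomorphic function: it is given by a
normalized equation `g(Z, ζ) = 0` with `g(Z, ζ + σ e_m) = g(Z, ζ) - σ` (`IsSegreFunction`,
`exists_isSegreFunction`). The Segre variety of `Z` is `{ζ : g(Z, ζ) = 0}`, and the fields `X_j` are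
a frame of tangent vectors of the Segre variety of `p`. Hence a function of `ζ` is annihilated at
`p̄` by all `X^α` with `|α| ≤ k` exactly if its restriction to that Segre variety vanishes to order
`k + 1`; noncommutativity of the `X_j` does not matter (`vanishesToOrder_of_monomialWord`). This
turns statements on the `c_α` into statements on the jet of order `k` of `g` in the variable `ζ`:

* the common kernel of the differentials `dc_α(0)`, `|α| ≤ k`, is the kernel of the derivative in
  `Z` of this jet (`IsAdapted.fderiv_cFun_eq_zero_iff`, `jetDeriv_eq_zero_iff`), so it does not
  depend on the choice of local data; let `kerDim k g p` be its dimension;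
* if `Z` has the same jet as `p` at `p̄`, then `c_α(Z - p) = 0` for `|α| ≤ k`
  (`IsAdapted.cFun_eq_zero`).

If `kerDim k g p = 0`, the `c_α` with `|α| ≤ k` contain a coordinate system, and generate the
maximal ideal (`finiteCodim_of_fderiv`). Suppose instead that `kerDim k g` has a constant value
`d > 0` on `M` near `p`. The kernel is then spanned over `M` by sections that are restrictions of
holomorphic functions of `(Z, ζ)`, invariant in the direction `ζ_m`. Since `M` is maximally real in
its complexification, holomorphic relations valid on `M` and invariant in the direction `ζ_m` hold
on a full neighborhood of `(p, p̄)` (`IsSegreFunction.eventually_eq_zero`). So for `ζ = p̄` the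
sections are holomorphic vector fields in `Z` along whose integral curves the jet of `g` is
constant. The `c_α` with `|α| ≤ k` vanish along such a curve, and their ideal has infinite
codimension (`IsSegreFunction.exists_curve`, `not_finiteCodim_of_curve`). If in addition
`kerDim (k + 1) g = d` near `p`, the sections do not depend on `ζ`, because differentiating the
relation `∂_v ∂_ζ^I g = 0` in `ζ` and using it one order higher shows that the derivative of `v` in
`ζ` lies in the kernel as well. They are then holomorphic vector fields tangent to `M`
(`IsSegreFunction.holomorphicallyDegenerateAt`).

Let `M` be holomorphically nondegenerate. At a point where all the dimensions `kerDim k g`,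
`k ≤ N - 1`, are locally constant, they decrease strictly from `N - 1` at `k = 0` until they reach
`0`, so `kerDim (N - 1) g` is zero there (`exists_nondegenerate`). Let `ℓ(M)` be the least `k` for
which `kerDim k` vanishes at some point. By analyticity and connectedness it vanishes on an open
dense set (`dense_nondegenerate`). For `k < ℓ(M)` it vanishes nowhere and is locally constant
near generic points, where the ideals of the `c_α` with `|α| ≤ k` thus have infinite codimension
(`dense_not_finiteCodim`). Finally, the Levi form is nondegenerate exactly where `kerDim 1` is zero
(`IsSegreFunction.leviNondegenerate_iff`).
-/

noncomputable section

open Asymptotics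

set_option linter.unusedSectionVars false

namespace CSpace

/-! ### Derivatives along vector fields and order of vanishing -/

section VectorFields

variable {V : Type*} [NormedAddCommGroup V] [NormedSpace ℂ V]

/-- The derivative `Y h` of the function `h` along the vector field `Y`. -/
def vfd (Y : V → V) (h : V → ℂ) : V → ℂ := fun x => fderiv ℂ h x (Y x)

/-- The iterated derivative `Y₁ (Y₂ (⋯ (Yᵣ h)))` along a list `[Y₁, …, Yᵣ]` of vector fields. -/
def vfWord (l : List (V → V)) (h : V → ℂ) : V → ℂ := l.foldr vfd h

/-- `h` vanishes to order `k` at `p`. -/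
def VanishesToOrder (h : V → ℂ) (p : V) (k : ℕ) : Prop := h =O[𝓝 p] fun x => ‖x - p‖ ^ k

@[simp] lemma vfWord_nil (h : V → ℂ) : vfWord [] h = h := rfl

@[simp] lemma vfWord_cons (Y : V → V) (l : List (V → V)) (h : V → ℂ) :
    vfWord (Y :: l) h = vfd Y (vfWord l h) := rfl

lemma vfWord_append (l₁ l₂ : List (V → V)) (h : V → ℂ) :
    vfWord (l₁ ++ l₂) h = vfWord l₁ (vfWord l₂ h) := List.foldr_append

lemma analyticAt_clm_apply {E F : Type*} [NormedAddCommGroup E] [NormedSpace ℂ E]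
    [NormedAddCommGroup F] [NormedSpace ℂ F] {A : V → E →L[ℂ] F} {v : V → E} {p : V}
    (hA : AnalyticAt ℂ A p) (hv : AnalyticAt ℂ v p) : AnalyticAt ℂ (fun x => A x (v x)) p :=
  ((ContinuousLinearMap.id ℂ (E →L[ℂ] F)).analyticAt_bilinear (A p, v p)).comp₂ hA hv

lemma analyticAt_vfd {Y : V → V} {h : V → ℂ} {p : V} (hY : AnalyticAt ℂ Y p)
    (hh : AnalyticAt ℂ h p) : AnalyticAt ℂ (vfd Y h) p :=
  analyticAt_clm_apply hh.fderiv hY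

lemma analyticAt_vfWord {l : List (V → V)} {h : V → ℂ} {p : V}
    (hl : ∀ Y ∈ l, AnalyticAt ℂ Y p) (hh : AnalyticAt ℂ h p) : AnalyticAt ℂ (vfWord l h) p := by
  induction l with
  | nil => exact hh
  | cons Y l ih =>
    exact analyticAt_vfd (hl Y (by simp)) (ih fun Z hZ => hl Z (by simp [hZ]))

lemma vfd_congr {Y : V → V} {h h' : V → ℂ} {p : V} (hh : h =ᶠ[𝓝 p] h') :
    vfd Y h =ᶠ[𝓝 p] vfd Y h' := by
  filter_upwards [hh.fderiv (𝕜 := ℂ)] with x hx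
  simp [vfd, hx]

lemma vfWord_congr (l : List (V → V)) {h h' : V → ℂ} {p : V} (hh : h =ᶠ[𝓝 p] h') :
    vfWord l h =ᶠ[𝓝 p] vfWord l h' := by
  induction l with
  | nil => exact hh
  | cons Y l ih => exact vfd_congr ih

lemma VanishesToOrder.mono {h : V → ℂ} {p : V} {j k : ℕ} (hh : VanishesToOrder h p k)
    (hjk : j ≤ k) : VanishesToOrder h p j := by
  refine hh.trans (IsBigO.of_bound 1 ?_)
  filter_upwards [Metric.ball_mem_nhds p one_pos] with x hx
  have hx' : ‖x - p‖ ≤ 1 := (mem_ball_iff_norm.1 hx).le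
  simpa using pow_le_pow_of_le_one (norm_nonneg _) hx' hjk

lemma VanishesToOrder.congr {h h' : V → ℂ} {p : V} {k : ℕ} (hh : VanishesToOrder h p k)
    (e : h =ᶠ[𝓝 p] h') : VanishesToOrder h' p k :=
  IsBigO.congr' hh e EventuallyEq.rfl

lemma VanishesToOrder.apply_eq_zero {h : V → ℂ} {p : V} {k : ℕ}
    (hh : VanishesToOrder h p (k + 1)) : h p = 0 := by
  obtain ⟨C, hC⟩ := hh.bound
  simpa using hC.self_of_nhds

/-- **Cauchy estimate**: the derivative of a holomorphic function vanishing to order `k + 1`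
vanishes to order `k`. -/
lemma VanishesToOrder.fderiv_isBigO {h : V → ℂ} {p : V} {k : ℕ} (ha : AnalyticAt ℂ h p)
    (hh : VanishesToOrder h p (k + 1)) :
    (fun x => fderiv ℂ h x) =O[𝓝 p] fun x => ‖x - p‖ ^ k := by
  obtain ⟨C, hC0, hC⟩ := IsBigO.exists_pos hh
  obtain ⟨ε, hε, hball⟩ := Metric.eventually_nhds_iff_ball.1
    (hC.bound.and ha.eventually_analyticAt)
  refine IsBigO.of_bound (4 * C * 2 ^ k) ?_
  filter_upwards [Metric.ball_mem_nhds p (half_pos hε)] with x hx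
  rw [mem_ball_iff_norm] at hx
  have key : ∀ R : ℝ, ‖x - p‖ < R → R < ε / 2 → ‖fderiv ℂ h x‖ ≤ 4 * C * (2 * R) ^ k := by
    intro R hR hR'
    have hR0 : 0 < R := (norm_nonneg _).trans_lt hR
    have hsub : ∀ y ∈ Metric.ball x R, ‖y - p‖ < 2 * R := by
      intro y hy
      rw [mem_ball_iff_norm] at hy
      calc ‖y - p‖ = ‖(y - x) + (x - p)‖ := by congr 1; abel
        _ ≤ ‖y - x‖ + ‖x - p‖ := norm_add_le _ _
        _ < 2 * R := by linarith
    have hbd : ∀ y ∈ Metric.ball x R, ‖h y‖ ≤ C * (2 * R) ^ (k + 1) := by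
      intro y hy
      have hy' := hsub y hy
      have := (hball y (mem_ball_iff_norm.2 (by linarith))).1
      rw [norm_pow, norm_norm] at this
      exact this.trans (by gcongr)
    have := Complex.norm_fderiv_le_div_of_mapsTo_ball (f := h) (c := x) (R₁ := R)
      (R₂ := 2 * (C * (2 * R) ^ (k + 1)))
      (fun y hy => (hball y (mem_ball_iff_norm.2
        (by linarith [hsub y hy]))).2.differentiableAt.differentiableWithinAt)
      (by
        intro y hy
        rw [mem_closedBall_iff_norm]
        linarith [norm_sub_le (h y) (h x), hbd y hy, hbd x (Metric.mem_ball_self hR0)]) hR0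
    refine this.trans (le_of_eq ?_)
    field_simp
    ring
  have hlim : Tendsto (fun R : ℝ => 4 * C * (2 * R) ^ k) (𝓝[>] ‖x - p‖)
      (𝓝 (4 * C * (2 * ‖x - p‖) ^ k)) :=
    ((by fun_prop : Continuous fun R : ℝ => 4 * C * (2 * R) ^ k).tendsto _).mono_left
      nhdsWithin_le_nhds
  have := ge_of_tendsto hlim (b := ‖fderiv ℂ h x‖) (by
    filter_upwards [self_mem_nhdsWithin,
      nhdsWithin_le_nhds (Iio_mem_nhds hx)] with R h1 h2 using key R h1 h2)
  refine this.trans (le_of_eq ?_)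
  rw [norm_pow, norm_norm, mul_pow]
  ring

lemma vanishesToOrder_succ_of_fderiv {h : V → ℂ} {p : V} {k : ℕ} (ha : AnalyticAt ℂ h p)
    (h0 : h p = 0) (hh : (fun x => fderiv ℂ h x) =O[𝓝 p] fun x => ‖x - p‖ ^ k) :
    VanishesToOrder h p (k + 1) := by
  obtain ⟨C, hC0, hC⟩ := IsBigO.exists_pos hh
  obtain ⟨ε, hε, hball⟩ := Metric.eventually_nhds_iff_ball.1
    (hC.bound.and ha.eventually_analyticAt)
  refine IsBigO.of_bound C ?_
  filter_upwards [Metric.ball_mem_nhds p hε] with x hx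
  rw [mem_ball_iff_norm] at hx
  have hin : ∀ y ∈ Metric.closedBall p ‖x - p‖, y ∈ Metric.ball p ε := fun y hy =>
    mem_ball_iff_norm.2 ((mem_closedBall_iff_norm.1 hy).trans_lt hx)
  have := (convex_closedBall p ‖x - p‖).norm_image_sub_le_of_norm_fderiv_le (𝕜 := ℂ) (f := h)
    (C := C * ‖x - p‖ ^ k) (x := p) (y := x)
    (fun y hy => (hball y (hin y hy)).2.differentiableAt)
    (fun y hy => by
      have := (hball y (hin y hy)).1
      rw [norm_pow, norm_norm] at this
      refine this.trans ?_
      have := mem_closedBall_iff_norm.1 hy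
      gcongr)
    (by simp) (by simp [dist_eq_norm])
  rw [h0, sub_zero] at this
  refine this.trans (le_of_eq ?_)
  rw [norm_pow, norm_norm]
  ring

lemma VanishesToOrder.vfd {Y : V → V} {h : V → ℂ} {p : V} {k : ℕ} (hY : AnalyticAt ℂ Y p)
    (ha : AnalyticAt ℂ h p) (hh : VanishesToOrder h p (k + 1)) :
    VanishesToOrder (vfd Y h) p k := by
  have h1 := hh.fderiv_isBigO ha
  have h2 : Y =O[𝓝 p] fun _ => (1 : ℝ) := hY.continuousAt.isBigO_one ℝ
  refine (IsBigO.of_bound 1 (Eventually.of_forall fun x => ?_)).trans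
    ((h1.norm_left.mul h2.norm_left).congr_right fun x => mul_one _)
  simpa [CSpace.vfd] using (fderiv ℂ h x).le_opNorm (Y x)

lemma VanishesToOrder.vfWord {l : List (V → V)} {h : V → ℂ} {p : V} {k : ℕ}
    (hl : ∀ Y ∈ l, AnalyticAt ℂ Y p) (ha : AnalyticAt ℂ h p)
    (hh : VanishesToOrder h p (l.length + k)) : VanishesToOrder (vfWord l h) p k := by
  induction l generalizing k with
  | nil => simpa using hh
  | cons Y l ih =>
    have hl' : ∀ Z ∈ l, AnalyticAt ℂ Z p := fun Z hZ => hl Z (by simp [hZ])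
    refine VanishesToOrder.vfd (hl Y (by simp)) (analyticAt_vfWord hl' ha)
      (ih hl' (hh.mono ?_))
    simp only [List.length_cons]; omega

lemma VanishesToOrder.vfWord_apply_eq_zero {l : List (V → V)} {h : V → ℂ} {p : V} {k : ℕ}
    (hl : ∀ Y ∈ l, AnalyticAt ℂ Y p) (ha : AnalyticAt ℂ h p)
    (hh : VanishesToOrder h p (k + 1)) (hlk : l.length ≤ k) : CSpace.vfWord l h p = 0 :=
  (VanishesToOrder.vfWord (k := 0 + 1) hl ha (hh.mono (by omega))).apply_eq_zero

/-- A holomorphic function all of whose derivatives of order at most `k` in the directions of a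
finite spanning family vanish at `p` vanishes to order `k + 1` at `p`. -/
lemma vanishesToOrder_of_const_words [FiniteDimensional ℂ V] {ι : Type*} [Finite ι] {b : ι → V}
    (hb : Submodule.span ℂ (Set.range b) = ⊤) {p : V} {k : ℕ} {h : V → ℂ}
    (ha : AnalyticAt ℂ h p)
    (hw : ∀ l : List ι, l.length ≤ k → vfWord (l.map fun i _ => b i) h p = 0) :
    VanishesToOrder h p (k + 1) := by
  cases nonempty_fintype ι
  induction k generalizing h with
  | zero =>
    have h0 : h p = 0 := hw [] (by simp)
    refine vanishesToOrder_succ_of_fderiv ha h0 ?_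
    simpa using ha.fderiv.continuousAt.isBigO_one ℝ
  | succ k ih =>
    have h0 : h p = 0 := hw [] (by simp)
    refine vanishesToOrder_succ_of_fderiv ha h0 ?_
    have hi : ∀ i, VanishesToOrder (vfd (fun _ => b i) h) p (k + 1) := by
      intro i
      refine ih (analyticAt_vfd analyticAt_const ha) fun l hl => ?_
      have := hw (l ++ [i]) (by simpa using hl)
      rwa [List.map_append, vfWord_append] at this
    -- a functional is controlled linearly by its values on the spanning family
    let φ : (V →L[ℂ] ℂ) →ₗ[ℂ] (ι → ℂ) :=
      { toFun := fun L i => L (b i)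
        map_add' := fun _ _ => rfl
        map_smul' := fun _ _ => rfl }
    have hφ : LinearMap.ker φ = ⊥ := by
      rw [LinearMap.ker_eq_bot']
      intro L hL
      ext v
      have hv : v ∈ Submodule.span ℂ (Set.range b) := by rw [hb]; trivial
      have : Submodule.span ℂ (Set.range b) ≤ LinearMap.ker (L : V →ₗ[ℂ] ℂ) := by
        rw [Submodule.span_le]
        rintro _ ⟨i, rfl⟩
        exact congrFun hL i
      simpa using this hv
    obtain ⟨ψ, hψ⟩ := φ.exists_leftInverse_of_injective hφ
    have e : (fun x => fderiv ℂ h x) = fun x =>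
        ψ.toContinuousLinearMap (fun i => vfd (fun _ => b i) h x) := by
      ext1 x
      exact (LinearMap.congr_fun hψ (fderiv ℂ h x)).symm
    rw [e]
    exact (ψ.toContinuousLinearMap.isBigO_comp _ _).trans (isBigO_pi.2 hi)

/-- Derivatives in constant directions commute. -/
lemma vfWord_const_perm {l₁ l₂ : List V} (hl : l₁.Perm l₂) {h : V → ℂ} {p : V}
    (ha : AnalyticAt ℂ h p) :
    vfWord (l₁.map fun v _ => v) h =ᶠ[𝓝 p] vfWord (l₂.map fun v _ => v) h := by
  induction hl with
  | nil => rfl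
  | cons v _ ih => exact vfd_congr ih
  | swap v w l =>
    have hA : AnalyticAt ℂ (vfWord (l.map fun v _ => v) h) p :=
      analyticAt_vfWord (by simp [analyticAt_const]) ha
    filter_upwards [hA.eventually_analyticAt] with x hx
    have hd := hx.fderiv.differentiableAt
    simp only [List.map_cons, vfWord_cons]
    have key : ∀ u u' : V, vfd (fun _ => u) (vfd (fun _ => u') (vfWord (l.map fun v _ => v) h)) x
        = fderiv ℂ (fderiv ℂ (vfWord (l.map fun v _ => v) h)) x u u' := by
      intro u u'
      change fderiv ℂ (fun y => fderiv ℂ (vfWord (l.map fun v _ => v) h) y u') x u = _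
      rw [fderiv_clm_apply hd (by fun_prop)]
      simp
    rw [key, key]
    simpa using (hx.contDiffAt (n := 2)).isSymmSndFDerivAt (by simp) w v
  | trans _ _ ih₁ ih₂ => exact ih₁.trans ih₂

/-- Freezing the coefficients of the vector fields changes an iterated derivative only by a term
of higher order. -/
lemma vanishesToOrder_vfWord_sub_const {ι : Type*} {Y : ι → V → V} {p : V}
    (hY : ∀ i, AnalyticAt ℂ (Y i) p) {h : V → ℂ} (ha : AnalyticAt ℂ h p) (l : List ι) {m : ℕ}
    (hh : VanishesToOrder h p (l.length + m)) :
    VanishesToOrder (vfWord (l.map Y) h - vfWord (l.map fun i _ => Y i p) h) p (m + 1) := by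
  induction l generalizing m with
  | nil =>
    simp only [List.map_nil, vfWord_nil, sub_self]
    exact isBigO_zero _ _
  | cons i l ih =>
    have hlen : VanishesToOrder h p (l.length + (m + 1)) :=
      hh.mono (by simp only [List.length_cons]; omega)
    have hYl : ∀ Z ∈ l.map Y, AnalyticAt ℂ Z p := by simp [hY]
    have hVl : ∀ Z ∈ l.map (fun i (_ : V) => Y i p), AnalyticAt ℂ Z p := by
      simp [analyticAt_const]
    have aY := analyticAt_vfWord hYl ha
    have aV := analyticAt_vfWord hVl ha
    have h1 := VanishesToOrder.vfd (hY i) (aY.sub aV) (ih hlen)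
    have h2 := (VanishesToOrder.vfWord (k := m + 1) hVl ha
      (by simpa using hlen)).fderiv_isBigO aV
    have h3 : (fun x => Y i x - Y i p) =O[𝓝 p] fun x => ‖x - p‖ :=
      (hY i).differentiableAt.isBigO_sub.norm_right
    have h4 : (fun x => fderiv ℂ (vfWord (l.map fun i _ => Y i p) h) x (Y i x - Y i p))
        =O[𝓝 p] fun x => ‖x - p‖ ^ (m + 1) := by
      refine (IsBigO.of_bound 1 (Eventually.of_forall fun x => ?_)).trans
        ((h2.norm_left.mul h3.norm_left).congr_right fun x => (pow_succ _ _).symm)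
      rw [norm_mul, norm_norm, norm_norm, one_mul]
      exact ContinuousLinearMap.le_opNorm _ _
    refine VanishesToOrder.congr (IsBigO.add h1 h4) ?_
    filter_upwards [aY.eventually_analyticAt, aV.eventually_analyticAt] with x hx hx'
    simp only [List.map_cons, vfWord_cons, Pi.sub_apply]
    simp only [vfd]
    rw [fderiv_sub hx.differentiableAt hx'.differentiableAt]
    simp

/-- The list of letters of the monomial `X₁^α₁ ⋯ Xₙ^αₙ`. -/
def monomialWord {n : ℕ} (α : Fin n → ℕ) : List (Fin n) :=
  (List.finRange n).flatMap fun j => List.replicate (α j) j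

lemma length_monomialWord {n : ℕ} (α : Fin n → ℕ) : (monomialWord α).length = ∑ j, α j := by
  simp [monomialWord, List.length_flatMap, ← List.ofFn_eq_map, List.sum_ofFn]

lemma count_monomialWord {n : ℕ} (α : Fin n → ℕ) (j : Fin n) :
    (monomialWord α).count j = α j := by
  simp only [monomialWord, List.count_flatMap, ← List.ofFn_eq_map, List.sum_ofFn,
    Function.comp_apply, List.count_replicate]
  simp

lemma monomialWord_count_perm {n : ℕ} (l : List (Fin n)) :
    (monomialWord fun j => l.count j).Perm l :=
  List.perm_iff_count.2 fun j => count_monomialWord _ j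

/-- Let `Y₁, …, Yₙ` together with a direction `e`, along which `h` is constant, span the tangent
space at `p`. If `Y^α h` vanishes at `p` for all ordered monomials with `|α| ≤ k`, then `h` vanishes
to order `k + 1`. The fields `Yⱼ` need not commute: at the lowest order only their values at `p`
matter. -/
lemma vanishesToOrder_of_monomialWord [FiniteDimensional ℂ V] {n : ℕ} {Y : Fin n → V → V} {p e : V}
    (hY : ∀ i, AnalyticAt ℂ (Y i) p)
    (hspan : Submodule.span ℂ (Set.range (fun i => Y i p) ∪ {e}) = ⊤)
    {h : V → ℂ} (ha : AnalyticAt ℂ h p) (he : ∀ᶠ x in 𝓝 p, fderiv ℂ h x e = 0) {k : ℕ}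
    (hw : ∀ α : Fin n → ℕ, ∑ j, α j ≤ k → vfWord ((monomialWord α).map Y) h p = 0) :
    VanishesToOrder h p (k + 1) := by
  let b : Option (Fin n) → V := fun o => o.elim e fun i => Y i p
  have hb : Submodule.span ℂ (Set.range b) = ⊤ := by
    rw [← hspan]
    congr 1
    ext v
    simp [b, Option.exists, eq_comm]
  suffices H : ∀ j ≤ k + 1, VanishesToOrder h p j from H _ le_rfl
  intro j
  induction j with
  | zero => intro _; simpa [VanishesToOrder] using ha.continuousAt.isBigO_one ℝ
  | succ j ih =>
    intro hj
    have hv := ih (by omega)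
    refine vanishesToOrder_of_const_words hb ha fun l hl => ?_
    rcases Nat.lt_or_ge l.length j with hlt | hge
    · obtain ⟨i, rfl⟩ : ∃ i, j = i + 1 := ⟨j - 1, by omega⟩
      exact hv.vfWord_apply_eq_zero (by simp [analyticAt_const]) ha (by simpa using by omega)
    have hlj : l.length = j := le_antisymm hl hge
    by_cases hnone : none ∈ l
    · obtain ⟨l', hl'⟩ : ∃ l', l.Perm (l' ++ [none]) :=
        ⟨l.erase none, (List.perm_cons_erase hnone).trans (List.perm_append_singleton _ _).symm⟩
      have h1 := (vfWord_const_perm (hl'.map b) ha).self_of_nhds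
      simp only [List.map_map, Function.comp_def] at h1
      rw [h1, List.map_append, vfWord_append]
      have h2 : vfWord ([none].map fun (i : Option (Fin n)) (_ : V) => b i) h =ᶠ[𝓝 p]
          fun _ => 0 := by
        filter_upwards [he] with x hx using hx
      rw [(vfWord_congr _ h2).self_of_nhds]
      have : VanishesToOrder (fun _ : V => (0 : ℂ)) p ((l'.length) + 1) := isBigO_zero _ _
      exact this.vfWord_apply_eq_zero (by simp [analyticAt_const]) analyticAt_const (by simp)
    · obtain ⟨w, rfl⟩ : ∃ w : List (Fin n), l = w.map some := by
        refine ⟨l.reduceOption, ?_⟩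
        clear hl hge hlj
        induction l with
        | nil => rfl
        | cons o l ih =>
          cases o with
          | none => simp at hnone
          | some i => simp only [List.reduceOption_cons_of_some, List.map_cons]
                      rw [← ih (by simpa using hnone)]
      have hwj : w.length = j := by simpa using hlj
      have hperm := monomialWord_count_perm w
      have h1 := (vfWord_const_perm (hperm.map fun i => Y i p) ha).self_of_nhds
      have h2 := (vanishesToOrder_vfWord_sub_const hY ha (m := 0)
        (monomialWord fun j => w.count j)
        (by rw [hperm.length_eq, hwj]; exact hv)).apply_eq_zero
      have h3 := hw (fun j => w.count j) (by
        rw [← length_monomialWord, hperm.length_eq]; omega)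
      simp only [List.map_map, Function.comp_def] at h1 ⊢
      change vfWord (w.map fun i _ => Y i p) h p = 0
      rw [← h1]
      rw [Pi.sub_apply, h3, zero_sub, neg_eq_zero] at h2
      exact h2

end VectorFields

/-! ### Complex conjugation and the totally real diagonal -/

section

variable {N : ℕ}

@[simp] lemma bar_bar (Z : CSpace N) : bar (bar Z) = Z := by ext k; simp [bar]

/-- Complex conjugation as a real linear map. -/
def barL (N : ℕ) : CSpace N →L[ℝ] CSpace N :=
  ContinuousLinearMap.pi fun k =>
    (Complex.conjCLE : ℂ →L[ℝ] ℂ).comp (ContinuousLinearMap.proj (R := ℝ) (φ := fun _ => ℂ) k)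

lemma barL_apply (Z : CSpace N) : barL N Z = bar Z := rfl

@[simp] lemma bar_add (Z Z' : CSpace N) : bar (Z + Z') = bar Z + bar Z' :=
  map_add (barL N) Z Z'

@[simp] lemma bar_sub (Z Z' : CSpace N) : bar (Z - Z') = bar Z - bar Z' :=
  map_sub (barL N) Z Z'

@[simp] lemma bar_smul (c : ℂ) (Z : CSpace N) : bar (c • Z) = starRingEnd ℂ c • bar Z := by
  ext k; simp [bar]

@[simp] lemma norm_bar (Z : CSpace N) : ‖bar Z‖ = ‖Z‖ := by
  simp [Pi.norm_def, bar]

@[simp] lemma bar_e (k : Fin N) : bar (e k) = e k := by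
  ext j
  by_cases h : j = k <;> simp [bar, e, h]

/-- The embedding `Z ↦ (Z, Z̄)` of `ℂ^N` as a totally real subspace of `ℂ^N × ℂ^N`. -/
def diag (N : ℕ) : CSpace N →L[ℝ] CSpace N × CSpace N :=
  (ContinuousLinearMap.id ℝ _).prod (barL N)

@[simp] lemma diag_apply (Z : CSpace N) : diag N Z = (Z, bar Z) := rfl

lemma tendsto_diag (p : CSpace N) :
    Tendsto (fun Z : CSpace N => (Z, bar Z)) (𝓝 p) (𝓝 (p, bar p)) :=
  (diag N).continuous.tendsto p

/-! ### Existence of complexifications -/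

/-- The standard real basis `e₁, …, e_N, i e₁, …, i e_N` of `ℂ^N`. -/
def realBasis : Fin N ⊕ Fin N → CSpace N := Sum.elim e fun k => Complex.I • e k

/-- The real coordinates of `ℂ^N` with respect to `realBasis`. -/
def realCoord : Fin N ⊕ Fin N → CSpace N → ℝ :=
  Sum.elim (fun k Z => (Z k).re) fun k Z => (Z k).im

/-- The complexified real coordinates `(Z_k + ζ_k) / 2` and `(Z_k - ζ_k) / 2i`. -/
def complexCoord : Fin N ⊕ Fin N → CSpace N × CSpace N →L[ℂ] ℂ :=
  Sum.elim
    (fun k => (1 / 2 : ℂ) • ((ContinuousLinearMap.proj k).comp (ContinuousLinearMap.fst ℂ _ _) +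
      (ContinuousLinearMap.proj k).comp (ContinuousLinearMap.snd ℂ _ _)))
    fun k => (1 / (2 * Complex.I) : ℂ) •
      ((ContinuousLinearMap.proj k).comp (ContinuousLinearMap.fst ℂ _ _) -
      (ContinuousLinearMap.proj k).comp (ContinuousLinearMap.snd ℂ _ _))

lemma complexCoord_diag (s : Fin N ⊕ Fin N) (Z : CSpace N) :
    complexCoord s (Z, bar Z) = realCoord s Z := by
  rcases s with k | k
  · simp only [complexCoord, realCoord, bar, Sum.elim_inl, _root_.smul_apply, _root_.add_apply,
      ContinuousLinearMap.comp_apply, ContinuousLinearMap.coe_fst', ContinuousLinearMap.coe_snd',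
      ContinuousLinearMap.proj_apply, Complex.add_conj, smul_eq_mul]
    push_cast
    ring
  · simp only [complexCoord, realCoord, bar, Sum.elim_inr, _root_.smul_apply,
      _root_.sub_apply, ContinuousLinearMap.comp_apply,
      ContinuousLinearMap.coe_fst', ContinuousLinearMap.coe_snd', ContinuousLinearMap.proj_apply,
      Complex.sub_conj, smul_eq_mul]
    push_cast
    field_simp

lemma sum_realCoord_smul (Z : CSpace N) : ∑ s, realCoord s Z • realBasis s = Z := by
  ext j
  simp only [Fintype.sum_sum_type, realCoord, realBasis, Sum.elim_inl, Sum.elim_inr, e,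
    Finset.sum_apply, Pi.smul_apply, Pi.single_apply, smul_eq_mul,
    Complex.real_smul]
  simp [Complex.re_add_im]

lemma norm_realBasis_le (s : Fin N ⊕ Fin N) : ‖realBasis s‖ ≤ 1 := by
  have h : ∀ k : Fin N, ‖(e k : CSpace N)‖ ≤ 1 := fun k =>
    (pi_norm_le_iff_of_nonneg zero_le_one).2 fun j => by
      by_cases hj : j = k <;> simp [e, hj]
  rcases s with k | k
  · exact h k
  · simpa [realBasis, norm_smul] using h k

lemma norm_complexCoord_le (s : Fin N ⊕ Fin N) : ‖complexCoord s‖ ≤ 1 := by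
  refine ContinuousLinearMap.opNorm_le_bound _ zero_le_one fun x => ?_
  have h1 : ∀ k, ‖x.1 k‖ ≤ ‖x‖ := fun k => (norm_le_pi_norm x.1 k).trans (norm_fst_le x)
  have h2 : ∀ k, ‖x.2 k‖ ≤ ‖x‖ := fun k => (norm_le_pi_norm x.2 k).trans (norm_snd_le x)
  rcases s with k | k
  · have := norm_add_le (x.1 k) (x.2 k)
    simp [complexCoord, ← mul_add]
    linarith [h1 k, h2 k]
  · have := norm_sub_le (x.1 k) (x.2 k)
    simp [complexCoord]
    linarith [h1 k, h2 k]

/-- The complexification of a homogeneous term of a real power series. -/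
def complexifyTerm {n : ℕ} (q : ContinuousMultilinearMap ℝ (fun _ : Fin n => CSpace N) ℂ) :
    ContinuousMultilinearMap ℂ (fun _ : Fin n => CSpace N × CSpace N) ℂ :=
  ∑ s : Fin n → Fin N ⊕ Fin N, q (fun i => realBasis (s i)) •
    (ContinuousMultilinearMap.mkPiAlgebra ℂ (Fin n) ℂ).compContinuousLinearMap
      fun i => complexCoord (s i)

lemma complexifyTerm_diag {n : ℕ}
    (q : ContinuousMultilinearMap ℝ (fun _ : Fin n => CSpace N) ℂ) (Z : CSpace N) :
    complexifyTerm q (fun _ => (Z, bar Z)) = q fun _ => Z := by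
  have : q (fun _ => Z) = q fun _ => ∑ s, realCoord s Z • realBasis s := by
    rw [sum_realCoord_smul]
  rw [this, ContinuousMultilinearMap.map_sum]
  simp only [complexifyTerm, _root_.sum_apply,
    _root_.smul_apply, ContinuousMultilinearMap.compContinuousLinearMap_apply,
    ContinuousMultilinearMap.mkPiAlgebra_apply, complexCoord_diag]
  refine Finset.sum_congr rfl fun s _ => ?_
  rw [ContinuousMultilinearMap.map_smul_univ, Complex.real_smul, smul_eq_mul, mul_comm]
  push_cast
  rfl

lemma norm_complexifyTerm_le {n : ℕ}
    (q : ContinuousMultilinearMap ℝ (fun _ : Fin n => CSpace N) ℂ) :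
    ‖complexifyTerm q‖ ≤ (2 * N : ℕ) ^ n * ‖q‖ := by
  refine (norm_sum_le _ _).trans ?_
  have : ∀ s ∈ (Finset.univ : Finset (Fin n → Fin N ⊕ Fin N)),
      ‖q (fun i => realBasis (s i)) •
        (ContinuousMultilinearMap.mkPiAlgebra ℂ (Fin n) ℂ).compContinuousLinearMap
          fun i => complexCoord (s i)‖ ≤ ‖q‖ := by
    intro s _
    rw [norm_smul]
    have h1 : ‖q fun i => realBasis (s i)‖ ≤ ‖q‖ := by
      refine (q.le_opNorm _).trans (mul_le_of_le_one_right (norm_nonneg _) ?_)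
      exact Finset.prod_le_one (fun _ _ => norm_nonneg _) fun i _ => norm_realBasis_le _
    have h2 := (ContinuousMultilinearMap.mkPiAlgebra ℂ (Fin n) ℂ).norm_compContinuousLinearMap_le
      fun i => complexCoord (s i)
    rw [ContinuousMultilinearMap.norm_mkPiAlgebra, one_mul] at h2
    have h3 := h2.trans
      (Finset.prod_le_one (fun _ _ => norm_nonneg _) fun i _ => norm_complexCoord_le _)
    calc _ ≤ ‖q‖ * 1 := by gcongr
      _ = ‖q‖ := mul_one _
  refine (Finset.sum_le_card_nsmul _ _ _ this).trans (le_of_eq ?_)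
  simp [two_mul]

/-- Every real analytic function has a complexification. -/
lemma exists_isComplexification {f : CSpace N → ℂ} {p : CSpace N} (hf : AnalyticAt ℝ f p) :
    ∃ F, IsComplexification p f F := by
  obtain ⟨q, r, hq⟩ := hf
  let Q : FormalMultilinearSeries ℂ (CSpace N × CSpace N) ℂ := fun n => complexifyTerm (q n)
  obtain ⟨ρ, hρ0, hρ⟩ := ENNReal.lt_iff_exists_nnreal_btwn.1 (hq.r_pos.trans_le hq.r_le)
  obtain ⟨C, hC0, hC⟩ := q.norm_mul_pow_le_of_lt_radius hρ
  have hρ0' : 0 < ρ := by simpa using hρ0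
  have hrad : 0 < Q.radius := by
    let τ : NNReal := ρ / (2 * N + 1)
    have hτ : 0 < τ := by positivity
    refine lt_of_lt_of_le (by simpa using hτ) (Q.le_radius_of_bound C (r := τ) fun n => ?_)
    have e1 : (τ : ℝ) ^ n * (2 * N : ℕ) ^ n ≤ (ρ : ℝ) ^ n := by
      rw [← mul_pow]
      refine pow_le_pow_left₀ (by positivity) ?_ n
      simp only [τ]
      push_cast
      rw [div_mul_eq_mul_div, div_le_iff₀ (by positivity)]
      exact mul_le_mul_of_nonneg_left (by linarith) ρ.2
    calc ‖Q n‖ * (τ : ℝ) ^ n ≤ ((2 * N : ℕ) ^ n * ‖q n‖) * (τ : ℝ) ^ n := by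
          gcongr; exact norm_complexifyTerm_le _
      _ = ‖q n‖ * ((τ : ℝ) ^ n * (2 * N : ℕ) ^ n) := by ring
      _ ≤ ‖q n‖ * (ρ : ℝ) ^ n := by gcongr
      _ ≤ C := hC n
  refine ⟨fun x => Q.sum (x - (p, bar p)), ?_, ?_⟩
  · have := (Q.hasFPowerSeriesOnBall hrad).comp_sub (p, bar p)
    rw [zero_add] at this
    exact this.analyticAt
  · filter_upwards [Metric.eball_mem_nhds p hq.r_pos] with Z hZ
    have h1 := hq.hasSum_sub hZ
    rw [← h1.tsum_eq]
    simp only [FormalMultilinearSeries.sum]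
    refine tsum_congr fun n => ?_
    have : ((Z, bar Z) - (p, bar p) : CSpace N × CSpace N) = (Z - p, bar (Z - p)) := by simp
    rw [this]
    exact complexifyTerm_diag _ _

/-! ### Uniqueness and derivatives of complexifications -/

/-- A holomorphic function vanishing on the totally real subspace `{ζ = Z̄}` vanishes. -/
lemma eventually_eq_zero_of_diag {F : CSpace N × CSpace N → ℂ} {p : CSpace N}
    (hF : AnalyticAt ℂ F (p, bar p)) (h0 : ∀ᶠ Z in 𝓝 p, F (Z, bar Z) = 0) :
    ∀ᶠ x in 𝓝 (p, bar p), F x = 0 := by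
  obtain ⟨ε₁, hε₁, h1⟩ := Metric.eventually_nhds_iff_ball.1 hF.eventually_analyticAt
  obtain ⟨ε₂, hε₂, h2⟩ := Metric.eventually_nhds_iff_ball.1 h0
  obtain ⟨ε, hε, hεl⟩ : ∃ ε > 0, ε ≤ ε₁ ∧ ε ≤ ε₂ := ⟨min ε₁ ε₂, lt_min hε₁ hε₂, by simp⟩
  refine Metric.eventually_nhds_iff_ball.2 ⟨ε / 4, by positivity, fun x hx => ?_⟩
  -- join `x` to the totally real subspace by a complex line that meets it in a real line
  set a := x.1 - p with ha
  set b := x.2 - bar p with hb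
  have hna : ‖a‖ < ε / 4 := by
    rw [mem_ball_iff_norm] at hx; exact (norm_fst_le (x - (p, bar p))).trans_lt hx
  have hnb : ‖b‖ < ε / 4 := by
    rw [mem_ball_iff_norm] at hx; exact (norm_snd_le (x - (p, bar p))).trans_lt hx
  set u : CSpace N := (1 / 2 : ℂ) • (a + bar b) with hu
  set v : CSpace N := (1 / (2 * Complex.I) : ℂ) • (a - bar b) with hv
  have hnu : ‖u‖ < ε / 4 := by
    have := norm_add_le a (bar b)
    rw [norm_bar] at this
    rw [hu, norm_smul]; norm_num; linarith
  have hnv : ‖v‖ < ε / 4 := by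
    have := norm_sub_le a (bar b)
    rw [norm_bar] at this
    rw [hv, norm_smul]; norm_num; linarith
  have hlin : ∀ s : ℂ, ‖s‖ < 2 → ∀ w z : CSpace N, ‖w‖ < ε / 4 → ‖z‖ < ε / 4 →
      ‖w + s • z‖ < ε := by
    intro s hs w z hw hz
    have h3 := norm_add_le w (s • z)
    rw [norm_smul] at h3
    have h4 : ‖s‖ * ‖z‖ ≤ 2 * ‖z‖ := by gcongr
    linarith
  let γ : ℂ → CSpace N × CSpace N := fun s => (p + (u + s • v), bar p + (bar u + s • bar v))
  have hγa : ∀ s, AnalyticAt ℂ γ s := fun s => by fun_prop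
  have hφ : AnalyticOnNhd ℂ (F ∘ γ) (Metric.ball 0 2) := by
    intro s hs
    refine AnalyticAt.comp (h1 _ ?_) (hγa s)
    have hs' : ‖s‖ < 2 := by simpa using hs
    rw [mem_ball_iff_norm]
    simp only [γ, Prod.mk_sub_mk, add_sub_cancel_left, Prod.norm_def]
    exact max_lt ((hlin s hs' u v hnu hnv).trans_le hεl.1)
      ((hlin s hs' (bar u) (bar v) (by simpa) (by simpa)).trans_le hεl.1)
  have hfreq : ∃ᶠ s in 𝓝[≠] (0 : ℂ), (F ∘ γ) s = 0 := by
    have ht : Tendsto (fun t : ℝ => (t : ℂ)) (𝓝[≠] 0) (𝓝[≠] 0) := by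
      refine tendsto_nhdsWithin_of_tendsto_nhds_of_eventually_within _
        (tendsto_nhdsWithin_of_tendsto_nhds (Complex.continuous_ofReal.tendsto' _ _ rfl)) ?_
      filter_upwards [self_mem_nhdsWithin] with t ht
      simpa using ht
    refine ht.frequently (Eventually.frequently ?_)
    filter_upwards [nhdsWithin_le_nhds (Metric.ball_mem_nhds (0 : ℝ) two_pos)] with t ht
    have ht' : ‖(t : ℂ)‖ < 2 := by simpa using ht
    have := h2 (p + (u + (t : ℂ) • v)) (by
      rw [mem_ball_iff_norm, add_sub_cancel_left]
      exact (hlin _ ht' u v hnu hnv).trans_le hεl.2)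
    simp only [bar_add, bar_smul, Complex.conj_ofReal] at this
    exact this
  have hI := hφ.eqOn_zero_of_preconnected_of_frequently_eq_zero
    (convex_ball (0 : ℂ) 2).isPreconnected (Metric.mem_ball_self two_pos) hfreq
    (show Complex.I ∈ Metric.ball (0 : ℂ) 2 by simp)
  have hx1 : γ Complex.I = x := by
    refine Prod.ext ?_ ?_
    · simp only [γ, hu, hv, smul_smul]
      rw [show Complex.I * (1 / (2 * Complex.I)) = 1 / 2 by field_simp, ← smul_add,
        add_add_sub_cancel, ← two_smul ℂ a, smul_smul]
      simp [ha]
    · simp only [γ, hu, hv, bar_smul, smul_smul, bar_add, bar_sub, bar_bar, map_div₀, map_mul,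
        map_one, Complex.conj_I, map_ofNat]
      rw [show Complex.I * (1 / (2 * -Complex.I)) = -(1 / 2) by field_simp, neg_smul,
        ← sub_eq_add_neg, ← smul_sub, add_sub_sub_cancel, ← two_smul ℂ b, smul_smul]
      simp [hb]
  simpa [hx1] using hI

/-- The real differential of `f` is the restriction of the differential of its complexification to
the diagonal `{(w, w̄)}`; hence the Wirtinger derivatives of `f` are the partial derivatives of the
complexification. -/
lemma IsComplexification.eventually_hasFDerivAt {f : CSpace N → ℂ} {F : CSpace N × CSpace N → ℂ}
    {p : CSpace N} (hF : IsComplexification p f F) :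
    ∀ᶠ Z in 𝓝 p, HasFDerivAt f
      (((fderiv ℂ F (Z, bar Z)).restrictScalars ℝ).comp (diag N)) Z := by
  filter_upwards [hF.2.eventually_nhds, (tendsto_diag p).eventually hF.1.eventually_analyticAt]
    with Z h1 h2
  have h3 : HasFDerivAt F ((fderiv ℂ F (Z, bar Z)).restrictScalars ℝ) (diag N Z) :=
    h2.differentiableAt.hasFDerivAt.restrictScalars ℝ
  exact (h3.comp Z (diag N).hasFDerivAt).congr_of_eventuallyEq (by
    filter_upwards [h1] with Z' h' using h'.symm)

lemma IsComplexification.dZ_eq {f : CSpace N → ℂ} {F : CSpace N × CSpace N → ℂ}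
    {p : CSpace N} (hF : IsComplexification p f F) :
    ∀ᶠ Z in 𝓝 p, ∀ k, dZ k f Z = fderiv ℂ F (Z, bar Z) (e k, 0) := by
  filter_upwards [hF.eventually_hasFDerivAt] with Z hZ k
  have h1 : ((e k, 0) : CSpace N × CSpace N) = (1 / 2 : ℂ) • ((e k, bar (e k)) -
      Complex.I • (Complex.I • e k, bar (Complex.I • e k))) := by
    ext <;> (simp [smul_smul]; try ring)
  rw [h1, map_smul, map_sub, map_smul, dZ, hZ.fderiv]
  simp

lemma IsComplexification.dZbar_eq {f : CSpace N → ℂ} {F : CSpace N × CSpace N → ℂ}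
    {p : CSpace N} (hF : IsComplexification p f F) :
    ∀ᶠ Z in 𝓝 p, ∀ k, dZbar k f Z = fderiv ℂ F (Z, bar Z) (0, e k) := by
  filter_upwards [hF.eventually_hasFDerivAt] with Z hZ k
  have h1 : ((0, e k) : CSpace N × CSpace N) = (1 / 2 : ℂ) • ((e k, bar (e k)) +
      Complex.I • (Complex.I • e k, bar (Complex.I • e k))) := by
    ext <;> (simp [smul_smul]; try ring)
  rw [h1, map_smul, map_add, map_smul, dZbar, hZ.fderiv]
  simp

lemma IsComplexification.eventually {f : CSpace N → ℂ} {F : CSpace N × CSpace N → ℂ}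
    {q : CSpace N} (hF : IsComplexification q f F) :
    ∀ᶠ p in 𝓝 q, IsComplexification p f F := by
  filter_upwards [hF.2.eventually_nhds, (tendsto_diag q).eventually hF.1.eventually_analyticAt]
    with p h1 h2 using ⟨h2, h1⟩

end

/-! ### Solving an analytic equation along a direction -/

section

/-- If `∂f/∂t ≠ 0` at a zero `P` of the analytic function `f`, the equation `f (x + σ t) = 0` has,
near `(P, 0)`, exactly one solution `σ = s x`, which depends analytically on `x`. -/
lemma exists_implicit {𝕜 V : Type*} [RCLike 𝕜] [NormedAddCommGroup V] [NormedSpace 𝕜 V]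
    [CompleteSpace V] {f : V → 𝕜} {P t : V} (hf : AnalyticAt 𝕜 f P) (h0 : f P = 0)
    (ht : fderiv 𝕜 f P t ≠ 0) :
    ∃ s : V → 𝕜, AnalyticAt 𝕜 s P ∧ s P = 0 ∧ (∀ᶠ x in 𝓝 P, f (x + s x • t) = 0) ∧
      ∀ᶠ y in 𝓝 (P, (0 : 𝕜)), f (y.1 + y.2 • t) = 0 → s y.1 = y.2 := by
  let L : V × 𝕜 →L[𝕜] V := ContinuousLinearMap.fst 𝕜 V 𝕜 +
    (ContinuousLinearMap.snd 𝕜 V 𝕜).smulRight t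
  have hL : ∀ y, L y = y.1 + y.2 • t := fun y => rfl
  have hL0 : L (P, 0) = P := by simp [hL]
  have ha : AnalyticAt 𝕜 (f ∘ L) (P, 0) :=
    AnalyticAt.comp (by rwa [hL0]) (L.analyticAt _)
  have hd : fderiv 𝕜 (f ∘ L) (P, 0) = (fderiv 𝕜 f P).comp L := by
    have := HasFDerivAt.comp (P, (0 : 𝕜)) (g := f) (g' := fderiv 𝕜 f P) (f := L)
      (by rw [hL0]; exact hf.differentiableAt.hasFDerivAt) L.hasFDerivAt
    exact this.fderiv
  have hinv : (fderiv 𝕜 (f ∘ L) (P, 0) ∘L .inr 𝕜 V 𝕜).IsInvertible := by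
    refine ⟨ContinuousLinearEquiv.unitsEquivAut 𝕜 (Units.mk0 _ ht), ?_⟩
    ext
    rw [hd]
    simp [hL]
  have hc : ContDiffAt 𝕜 ⊤ (f ∘ L) (P, 0) := ha.contDiffAt
  refine ⟨hc.implicitFunction (by simp) hinv,
    ContDiffAt.analyticAt (hc.contDiffAt_implicitFunction (by simp) hinv),
    hc.implicitFunction_apply_self (by simp) hinv, ?_, ?_⟩
  · filter_upwards [hc.eventually_apply_implicitFunction (by simp) hinv] with x hx
    rw [Function.comp_apply, Function.comp_apply, hL0, h0] at hx
    exact hx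
  · filter_upwards [hc.eventually_apply_eq_iff_implicitFunction (by simp) hinv] with y hy h
    rw [Function.comp_apply, Function.comp_apply, hL0, h0] at hy
    exact hy.1 h

variable {N : ℕ} {M : Set (CSpace N)}

lemma IsDefiningFunction.apply_eq_zero {p : CSpace N} {ρ : CSpace N → ℝ}
    (h : IsDefiningFunction M p ρ) (hp : p ∈ M) : ρ p = 0 := h.mem_iff.self_of_nhds.1 hp

lemma IsDefiningFunction.eventually {q : CSpace N} {ρ : CSpace N → ℝ}
    (h : IsDefiningFunction M q ρ) : ∀ᶠ p in 𝓝 q, IsDefiningFunction M p ρ := by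
  filter_upwards [h.analytic.eventually_analyticAt, h.mem_iff.eventually_nhds,
    h.analytic.fderiv.continuousAt.eventually_ne h.fderiv_ne_zero] with p h1 h2 h3
  exact ⟨h1, h3, h2⟩

lemma IsComplexification.fderiv_diag {p : CSpace N} {ρ : CSpace N → ℝ}
    {R : CSpace N × CSpace N → ℂ} (hρ : AnalyticAt ℝ ρ p)
    (hR : IsComplexification p (toC ρ) R) (w : CSpace N) :
    fderiv ℂ R (p, bar p) (w, bar w) = fderiv ℝ ρ p w := by
  have h1 := hR.eventually_hasFDerivAt.self_of_nhds
  have h2 : HasFDerivAt (toC ρ) (Complex.ofRealCLM.comp (fderiv ℝ ρ p)) p :=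
    Complex.ofRealCLM.hasFDerivAt.comp p hρ.differentiableAt.hasFDerivAt
  simpa using DFunLike.congr_fun (h1.unique h2) w

/-- A holomorphic function of `(Z, ζ)` that vanishes for `Z ∈ M`, `ζ = Z̄` vanishes on the
complexification `{R = 0}` of `M`. -/
lemma IsDefiningFunction.eventually_eq_zero {p : CSpace N} {ρ : CSpace N → ℝ}
    {R G : CSpace N × CSpace N → ℂ} (hρ : IsDefiningFunction M p ρ) (hp : p ∈ M)
    (hR : IsComplexification p (toC ρ) R) (hG : AnalyticAt ℂ G (p, bar p))
    (h0 : ∀ᶠ Z in 𝓝 p, Z ∈ M → G (Z, bar Z) = 0) :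
    ∀ᶠ x in 𝓝 (p, bar p), R x = 0 → G x = 0 := by
  obtain ⟨w, hw⟩ : ∃ w, fderiv ℝ ρ p w ≠ 0 := by
    by_contra! h
    exact hρ.fderiv_ne_zero (by ext w; simpa using h w)
  have hRp : R (p, bar p) = 0 := by
    rw [hR.2.self_of_nhds, toC, hρ.apply_eq_zero hp, Complex.ofReal_zero]
  set t : CSpace N × CSpace N := (w, bar w) with ht
  obtain ⟨s, hs, hs0, -, hsu⟩ := exists_implicit (t := t) hR.1 hRp
    (by rw [ht, hR.fderiv_diag hρ.analytic]; exact_mod_cast hw)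
  obtain ⟨r, hr, hr0, hrz, -⟩ := exists_implicit hρ.analytic (hρ.apply_eq_zero hp) hw
  -- on the totally real subspace the holomorphic solution `s` agrees with the real solution `r`
  have hrt : Tendsto (fun Z => Z + r Z • w) (𝓝 p) (𝓝 p) := by
    have : ContinuousAt (fun Z => Z + r Z • w) p :=
      continuousAt_id.add (hr.continuousAt.smul continuousAt_const)
    simpa [ContinuousAt, hr0] using this
  have hbar : ∀ Z, ((Z, bar Z) + (r Z : ℂ) • t : CSpace N × CSpace N)
      = (Z + r Z • w, bar (Z + r Z • w)) := by
    intro Z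
    have : r Z • w = (r Z : ℂ) • w := (Complex.coe_smul _ _).symm
    rw [this, bar_add, bar_smul, Complex.conj_ofReal]
    rfl
  have hsr : ∀ᶠ Z in 𝓝 p, s (Z, bar Z) = r Z := by
    have hT : Tendsto (fun Z : CSpace N => ((Z, bar Z), (r Z : ℂ))) (𝓝 p)
        (𝓝 ((p, bar p), (0 : ℂ))) := by
      refine (tendsto_diag p).prodMk_nhds ?_
      have := (Complex.continuous_ofReal.tendsto _).comp hr.continuousAt
      simpa [hr0, Function.comp_def] using this
    filter_upwards [hT.eventually hsu, hrz, hrt.eventually hR.2] with Z h1 h2 h3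
    refine h1 ?_
    rw [hbar, h3, toC, h2, Complex.ofReal_zero]
  have hsa : AnalyticAt ℂ (fun x => x + s x • t) (p, bar p) :=
    analyticAt_id.add (hs.smul analyticAt_const)
  have hF : AnalyticAt ℂ (fun x => G (x + s x • t)) (p, bar p) := by
    refine AnalyticAt.fun_comp ?_ hsa
    simpa [hs0] using hG
  have hF0 : ∀ᶠ Z in 𝓝 p, G ((Z, bar Z) + s (Z, bar Z) • t) = 0 := by
    filter_upwards [hsr, hrz, hrt.eventually h0, hrt.eventually hρ.mem_iff] with Z h1 h2 h3 h4
    rw [h1, hbar]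
    exact h3 (h4.2 h2)
  have hT0 : Tendsto (fun x : CSpace N × CSpace N => (x, (0 : ℂ))) (𝓝 (p, bar p))
      (𝓝 ((p, bar p), (0 : ℂ))) := tendsto_id.prodMk_nhds tendsto_const_nhds
  filter_upwards [eventually_eq_zero_of_diag hF hF0, hT0.eventually hsu] with x h1 h2 h3
  have h4 : s x = 0 := h2 (by simpa using h3)
  simpa [h4] using h1

/-! ### Normalized complex defining functions -/

/-- The direction `∂/∂ζ_m` in the space of the variables `(Z, ζ)`. -/
def zetaDir (m : Fin N) : CSpace N × CSpace N := (0, e m)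

/-- `g` is a holomorphic equation of the complexification of `M` near `(p, p̄)`, normalized by
`g(Z, ζ + σ e_m) = g(Z, ζ) - σ`. Thus `g(Z, ζ) = Q(Z, ζ') - ζ_m`, where `ζ_m = Q(Z, ζ')` is the
equation of the complexification solved for `ζ_m`, and `ζ + g(Z, ζ) e_m` is the projection of `ζ`
to the Segre variety of `Z` along `e_m`. The field `eq_zero` expresses that `M`, embedded by
`Z ↦ (Z, Z̄)`, is a maximally real subset of `{g = 0}`: holomorphic functions vanishing on `M` vanish
on `{g = 0}`. -/
structure IsSegreFunction (M : Set (CSpace N)) (p : CSpace N) (m : Fin N)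
    (g : CSpace N × CSpace N → ℂ) : Prop where
  analytic : AnalyticAt ℂ g (p, bar p)
  apply_eq_zero : g (p, bar p) = 0
  shift : ∀ᶠ y in 𝓝 ((p, bar p), (0 : ℂ)), g (y.1 + y.2 • zetaDir m) = g y.1 - y.2
  mem : ∀ᶠ Z in 𝓝 p, Z ∈ M → g (Z, bar Z) = 0
  eq_zero : ∀ G : CSpace N × CSpace N → ℂ, AnalyticAt ℂ G (p, bar p) →
    (∀ᶠ Z in 𝓝 p, Z ∈ M → G (Z, bar Z) = 0) → ∀ᶠ x in 𝓝 (p, bar p), g x = 0 → G x = 0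

lemma tendsto_prod_zero (P : CSpace N × CSpace N) :
    Tendsto (fun x : CSpace N × CSpace N => (x, (0 : ℂ))) (𝓝 P) (𝓝 (P, (0 : ℂ))) :=
  tendsto_id.prodMk_nhds tendsto_const_nhds

lemma exists_zetaDir_ne_zero {p : CSpace N} {ρ : CSpace N → ℝ}
    {R : CSpace N × CSpace N → ℂ} (hρ : IsDefiningFunction M p ρ)
    (hR : IsComplexification p (toC ρ) R) :
    ∃ m, fderiv ℂ R (p, bar p) (zetaDir m) ≠ 0 := by
  by_contra! h
  have h1 : ∀ w : CSpace N, fderiv ℂ R (p, bar p) (0, w) = 0 := by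
    intro w
    have : ((0, w) : CSpace N × CSpace N) = ∑ k, w k • zetaDir k := by
      refine Prod.ext ?_ ?_
      · simp [zetaDir, Prod.fst_sum]
      · ext j
        simp [zetaDir, Prod.snd_sum, e, Finset.sum_apply, Pi.single_apply]
    rw [this, map_sum]
    exact Finset.sum_eq_zero fun k _ => by rw [map_smul, h k, smul_zero]
  have h2 : ∀ w, fderiv ℂ R (p, bar p) (w, 0) = fderiv ℝ ρ p w := by
    intro w
    rw [← hR.fderiv_diag hρ.analytic, show ((w, bar w) : CSpace N × CSpace N) = (w, 0) + (0, bar w)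
      by simp, map_add, h1, add_zero]
  -- a complex linear functional with real values is zero
  refine hρ.fderiv_ne_zero ?_
  ext w
  have h3 := h2 (Complex.I • w)
  rw [show ((Complex.I • w, 0) : CSpace N × CSpace N) = Complex.I • (w, 0) by simp, map_smul,
    h2 w, smul_eq_mul] at h3
  simpa using congrArg Complex.im h3

/-- Near every point of `M` there is a normalized equation of the complexification. -/
lemma exists_isSegreFunction (hM : IsRealAnalyticHypersurface M) {q : CSpace N} (hq : q ∈ M) :
    ∃ m g, ∀ᶠ p in 𝓝 q, p ∈ M → IsSegreFunction M p m g := by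
  obtain ⟨ρ, hρ⟩ := hM q hq
  obtain ⟨R, hR⟩ := exists_isComplexification
    (f := toC ρ) (p := q) (Complex.ofRealCLM.analyticAt _ |>.comp hρ.analytic)
  obtain ⟨m, hm⟩ := exists_zetaDir_ne_zero hρ hR
  have hRq : R (q, bar q) = 0 := by
    rw [hR.2.self_of_nhds, toC, hρ.apply_eq_zero hq, Complex.ofReal_zero]
  obtain ⟨g, hg, hg0, hgz, hgu⟩ := exists_implicit hR.1 hRq hm
  have hshift : ∀ᶠ y in 𝓝 ((q, bar q), (0 : ℂ)), g (y.1 + y.2 • zetaDir m) = g y.1 - y.2 := by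
    -- both sides solve the equation defining `g`
    have c1 : Tendsto (fun y : (CSpace N × CSpace N) × ℂ => y.1 + y.2 • zetaDir m)
        (𝓝 ((q, bar q), (0 : ℂ))) (𝓝 (q, bar q)) :=
      (by fun_prop : Continuous fun y : (CSpace N × CSpace N) × ℂ =>
        y.1 + y.2 • zetaDir m).tendsto' _ _ (by simp)
    have c2 : Tendsto (fun y : (CSpace N × CSpace N) × ℂ => y.1)
        (𝓝 ((q, bar q), (0 : ℂ))) (𝓝 (q, bar q)) := continuous_fst.tendsto _
    have c3 : Tendsto (fun y : (CSpace N × CSpace N) × ℂ => y.2)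
        (𝓝 ((q, bar q), (0 : ℂ))) (𝓝 0) := continuous_snd.tendsto _
    have c4 : Tendsto (fun y : (CSpace N × CSpace N) × ℂ =>
        (y.1 + y.2 • zetaDir m, g y.1 - y.2))
        (𝓝 ((q, bar q), (0 : ℂ))) (𝓝 ((q, bar q), (0 : ℂ))) := by
      refine c1.prodMk_nhds ?_
      simpa [hg0, Function.comp_def] using (hg.continuousAt.tendsto.comp c2).sub c3
    filter_upwards [c4.eventually hgu, c2.eventually hgz] with y h1 h2
    refine h1 ?_
    rw [← h2]
    congr 1
    rw [add_assoc, ← add_smul]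
    congr 2
    ring
  refine ⟨m, g, ?_⟩
  filter_upwards [hρ.eventually, hR.eventually,
    (tendsto_diag q).eventually hg.eventually_analyticAt,
    (tendsto_diag q).eventually hgz.eventually_nhds,
    ((tendsto_prod_zero _).comp (tendsto_diag q)).eventually hgu.eventually_nhds,
    ((tendsto_prod_zero _).comp (tendsto_diag q)).eventually hshift.eventually_nhds]
    with p h1 h2 h3 h4 h5 h6 hp
  have hmem : ∀ᶠ Z in 𝓝 p, Z ∈ M → g (Z, bar Z) = 0 := by
    filter_upwards [((tendsto_prod_zero _).comp (tendsto_diag p)).eventually h5, h2.2,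
      h1.mem_iff] with Z k1 k2 k3 hZ
    refine k1 ?_
    simp only [Function.comp_apply, zero_smul, add_zero]
    rw [k2, toC, k3.1 hZ, Complex.ofReal_zero]
  refine ⟨h3, hmem.self_of_nhds hp, h6, hmem, fun G hG hG0 => ?_⟩
  filter_upwards [h1.eventually_eq_zero hp h2 hG hG0, h4] with x k1 k2 k3
  exact k1 (by simpa [k3] using k2)

end

section

variable {N : ℕ} {M : Set (CSpace N)}

/-! ### Slices of functions of `(Z, ζ)` -/

/-- The vector field `Y` in the variable `ζ`, as a vector field in `(Z, ζ)`. -/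
def liftField (Y : CSpace N → CSpace N) : CSpace N × CSpace N → CSpace N × CSpace N :=
  fun x => (0, Y x.2)

lemma analyticAt_liftField {Y : CSpace N → CSpace N} {P : CSpace N × CSpace N}
    (hY : AnalyticAt ℂ Y P.2) : AnalyticAt ℂ (liftField Y) P :=
  analyticAt_const.prod (AnalyticAt.comp hY analyticAt_snd)

lemma analyticAt_slice {F : CSpace N × CSpace N → ℂ} {Z ζ : CSpace N}
    (hF : AnalyticAt ℂ F (Z, ζ)) : AnalyticAt ℂ (fun ζ' => F (Z, ζ')) ζ :=
  AnalyticAt.comp (g := F) (f := fun ζ' => (Z, ζ')) hF (analyticAt_const.prod analyticAt_id)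

lemma fderiv_slice {F : CSpace N × CSpace N → ℂ} {Z ζ : CSpace N}
    (hF : AnalyticAt ℂ F (Z, ζ)) (η : CSpace N) :
    fderiv ℂ (fun ζ' => F (Z, ζ')) ζ η = fderiv ℂ F (Z, ζ) (0, η) := by
  have h : HasFDerivAt (fun ζ' : CSpace N => (Z, ζ')) (ContinuousLinearMap.inr ℂ _ _) ζ :=
    hasFDerivAt_prodMk_right _ _
  have h2 := DFunLike.congr_fun
    (HasFDerivAt.comp ζ hF.differentiableAt.hasFDerivAt h).fderiv η
  simpa [Function.comp_def] using h2

lemma analyticAt_vfWord_lift {l : List (CSpace N → CSpace N)} {F : CSpace N × CSpace N → ℂ}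
    {P : CSpace N × CSpace N} (hl : ∀ Y ∈ l, AnalyticAt ℂ Y P.2) (hF : AnalyticAt ℂ F P) :
    AnalyticAt ℂ (vfWord (l.map liftField) F) P := by
  refine analyticAt_vfWord (fun Y hY => ?_) hF
  obtain ⟨Y', hY', rfl⟩ := List.mem_map.1 hY
  exact analyticAt_liftField (hl Y' hY')

lemma vfWord_slice {l : List (CSpace N → CSpace N)} {F : CSpace N × CSpace N → ℂ}
    {P : CSpace N × CSpace N} (hl : ∀ Y ∈ l, AnalyticAt ℂ Y P.2) (hF : AnalyticAt ℂ F P) :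
    ∀ᶠ x in 𝓝 P, vfWord l (fun ζ => F (x.1, ζ)) x.2 = vfWord (l.map liftField) F x := by
  induction l with
  | nil => exact Eventually.of_forall fun _ => rfl
  | cons Y l ih =>
    have hl' : ∀ Z ∈ l, AnalyticAt ℂ Z P.2 := fun Z hZ => hl Z (by simp [hZ])
    filter_upwards [(ih hl').eventually_nhds,
      (analyticAt_vfWord_lift hl' hF).eventually_analyticAt] with x h1 h2
    have h3 : Tendsto (fun ζ : CSpace N => (x.1, ζ)) (𝓝 x.2) (𝓝 x) :=
      (Continuous.prodMk_right x.1).tendsto' _ _ rfl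
    have h4 : vfWord l (fun ζ => F (x.1, ζ)) =ᶠ[𝓝 x.2]
        fun ζ => vfWord (l.map liftField) F (x.1, ζ) := h3.eventually h1
    simp only [List.map_cons, vfWord_cons]
    simp only [vfd]
    rw [h4.fderiv_eq, fderiv_slice (Z := x.1) (ζ := x.2) h2]
    rfl

lemma vfd_liftField_comm {Y : CSpace N → CSpace N} {F : CSpace N × CSpace N → ℂ}
    {P : CSpace N × CSpace N} (hY : AnalyticAt ℂ Y P.2) (hF : AnalyticAt ℂ F P) (v : CSpace N) :
    vfd (fun _ => (v, 0)) (vfd (liftField Y) F) =ᶠ[𝓝 P]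
      vfd (liftField Y) (vfd (fun _ => (v, 0)) F) := by
  have h2 : Tendsto (fun x : CSpace N × CSpace N => x.2) (𝓝 P) (𝓝 P.2) :=
    continuous_snd.tendsto _
  filter_upwards [hF.eventually_analyticAt, h2.eventually hY.eventually_analyticAt] with x hx hYx
  have hd := hx.fderiv.differentiableAt
  have hY' : HasFDerivAt (liftField Y)
      ((0 : CSpace N × CSpace N →L[ℂ] CSpace N).prod
        ((fderiv ℂ Y x.2).comp (ContinuousLinearMap.snd ℂ _ _))) x :=
    (hasFDerivAt_const _ _).prodMk (hYx.differentiableAt.hasFDerivAt.comp x hasFDerivAt_snd)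
  change fderiv ℂ (fun y => fderiv ℂ F y (liftField Y y)) x (v, 0) =
    fderiv ℂ (fun y => fderiv ℂ F y (v, 0)) x (liftField Y x)
  rw [fderiv_clm_apply hd hY'.differentiableAt, fderiv_clm_apply hd (by fun_prop), hY'.fderiv]
  have hs := (hx.contDiffAt (n := 2)).isSymmSndFDerivAt (by simp) (v, 0) (liftField Y x)
  simpa [← Prod.zero_eq_mk] using hs

/-- Differentiation with respect to `Z` commutes with vector fields in `ζ`. -/
lemma vfWord_liftField_comm {l : List (CSpace N → CSpace N)} {F : CSpace N × CSpace N → ℂ}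
    {P : CSpace N × CSpace N} (hl : ∀ Y ∈ l, AnalyticAt ℂ Y P.2) (hF : AnalyticAt ℂ F P)
    (v : CSpace N) :
    vfd (fun _ => (v, 0)) (vfWord (l.map liftField) F) =ᶠ[𝓝 P]
      vfWord (l.map liftField) (vfd (fun _ => (v, 0)) F) := by
  induction l with
  | nil => rfl
  | cons Y l ih =>
    have hl' : ∀ Z ∈ l, AnalyticAt ℂ Z P.2 := fun Z hZ => hl Z (by simp [hZ])
    exact (vfd_liftField_comm (hl Y (by simp)) (analyticAt_vfWord_lift hl' hF) v).trans
      (vfd_congr (ih hl'))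

/-! ### Functions invariant in the direction `ζ_m` -/

/-- The projection of `(Z, ζ)` to `{g = 0}` in the direction `ζ_m`. -/
def segreProj (m : Fin N) (g : CSpace N × CSpace N → ℂ) (x : CSpace N × CSpace N) :
    CSpace N × CSpace N := x + g x • zetaDir m

/-- `F` is invariant near `P` under translations in the direction `ζ_m`. -/
def ZetaInvariant {β : Type*} (m : Fin N) (P : CSpace N × CSpace N)
    (F : CSpace N × CSpace N → β) : Prop :=
  ∀ᶠ y in 𝓝 (P, (0 : ℂ)), F (y.1 + y.2 • zetaDir m) = F y.1

lemma ZetaInvariant.fderiv {m : Fin N} {P : CSpace N × CSpace N} {F : CSpace N × CSpace N → ℂ}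
    (hF : ZetaInvariant m P F) : ZetaInvariant m P (fderiv ℂ F) := by
  filter_upwards [hF.eventually_nhds] with y hy
  have h1 : Tendsto (fun x : CSpace N × CSpace N => (x, y.2)) (𝓝 y.1) (𝓝 y) :=
    (Continuous.prodMk_left y.2).tendsto' _ _ rfl
  have h2 : (fun x => F (x + y.2 • zetaDir m)) =ᶠ[𝓝 y.1] F := h1.eventually hy
  rw [← h2.fderiv_eq, fderiv_comp_add_right]

namespace IsSegreFunction

variable {p : CSpace N} {m : Fin N} {g : CSpace N × CSpace N → ℂ}

lemma tendsto_pair (hg : IsSegreFunction M p m g) :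
    Tendsto (fun x => (x, g x)) (𝓝 (p, bar p)) (𝓝 ((p, bar p), (0 : ℂ))) := by
  refine tendsto_id.prodMk_nhds ?_
  simpa [hg.apply_eq_zero] using hg.analytic.continuousAt.tendsto

lemma analyticAt_segreProj (hg : IsSegreFunction M p m g) :
    AnalyticAt ℂ (segreProj m g) (p, bar p) :=
  analyticAt_id.add (hg.analytic.smul analyticAt_const)

lemma segreProj_self (hg : IsSegreFunction M p m g) :
    segreProj m g (p, bar p) = (p, bar p) := by simp [segreProj, hg.apply_eq_zero]

lemma tendsto_segreProj (hg : IsSegreFunction M p m g) :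
    Tendsto (segreProj m g) (𝓝 (p, bar p)) (𝓝 (p, bar p)) := by
  simpa [ContinuousAt, hg.segreProj_self] using hg.analyticAt_segreProj.continuousAt

lemma apply_segreProj (hg : IsSegreFunction M p m g) :
    ∀ᶠ x in 𝓝 (p, bar p), g (segreProj m g x) = 0 := by
  filter_upwards [hg.tendsto_pair.eventually hg.shift] with x hx
  simpa [segreProj] using hx

lemma eventually_segreProj (hg : IsSegreFunction M p m g) {β : Type*}
    {F : CSpace N × CSpace N → β} (hF : ZetaInvariant m (p, bar p) F) :
    ∀ᶠ x in 𝓝 (p, bar p), F (segreProj m g x) = F x :=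
  hg.tendsto_pair.eventually hF

/-- A `ζ_m`-invariant holomorphic function vanishing on `M` is zero. -/
lemma eventually_eq_zero (hg : IsSegreFunction M p m g) {F : CSpace N × CSpace N → ℂ}
    (hF : AnalyticAt ℂ F (p, bar p)) (hi : ZetaInvariant m (p, bar p) F)
    (h0 : ∀ᶠ Z in 𝓝 p, Z ∈ M → F (Z, bar Z) = 0) : ∀ᶠ x in 𝓝 (p, bar p), F x = 0 := by
  filter_upwards [hg.tendsto_segreProj.eventually (hg.eq_zero F hF h0), hg.apply_segreProj,
    hg.eventually_segreProj hi] with x h1 h2 h3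
  rw [← h3, h1 h2]

lemma zetaInvariant_fderiv (hg : IsSegreFunction M p m g) :
    ZetaInvariant m (p, bar p) (fderiv ℂ g) := by
  filter_upwards [hg.shift.eventually_nhds] with y hy
  have h1 : Tendsto (fun x : CSpace N × CSpace N => (x, y.2)) (𝓝 y.1) (𝓝 y) :=
    (Continuous.prodMk_left y.2).tendsto' _ _ rfl
  have h2 : (fun x => g (x + y.2 • zetaDir m)) =ᶠ[𝓝 y.1] fun x => g x - y.2 :=
    h1.eventually hy
  rw [← fderiv_comp_add_right, h2.fderiv_eq, fderiv_sub_const]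

lemma fderiv_zetaDir (hg : IsSegreFunction M p m g) :
    ∀ᶠ x in 𝓝 (p, bar p), fderiv ℂ g x (zetaDir m) = -1 := by
  filter_upwards [(tendsto_prod_zero _).eventually hg.shift.eventually_nhds,
    hg.analytic.eventually_analyticAt] with x hx ha
  have h1 : Tendsto (fun σ : ℂ => (x, σ)) (𝓝 0) (𝓝 (x, (0 : ℂ))) :=
    (Continuous.prodMk_right x).tendsto' _ _ rfl
  have h2 : (fun σ : ℂ => g (x + σ • zetaDir m)) =ᶠ[𝓝 0] fun σ => g x - σ := h1.eventually hx
  have h3 : HasDerivAt (fun σ : ℂ => x + σ • zetaDir m) (zetaDir m) 0 := by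
    simpa using ((hasDerivAt_id (0 : ℂ)).smul_const (zetaDir m)).const_add x
  have h4 : HasDerivAt (fun σ : ℂ => g (x + σ • zetaDir m)) (fderiv ℂ g x (zetaDir m)) 0 :=
    HasFDerivAt.comp_hasDerivAt (l := g) 0
      (by simpa using ha.differentiableAt.hasFDerivAt) h3
  have h5 : HasDerivAt (fun σ : ℂ => g x - σ) (-1) 0 := by
    simpa using (hasDerivAt_id (0 : ℂ)).const_sub (g x)
  exact h4.unique (h5.congr_of_eventuallyEq h2)

/-- The differential of a function `F` vanishing on the complexification of `M`. -/
lemma fderiv_segreProj (hg : IsSegreFunction M p m g) {F : CSpace N × CSpace N → ℂ}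
    (hF : AnalyticAt ℂ F (p, bar p)) (h0 : ∀ᶠ Z in 𝓝 p, Z ∈ M → F (Z, bar Z) = 0) :
    ∀ᶠ x in 𝓝 (p, bar p), ∀ u, fderiv ℂ F (segreProj m g x) u =
      -(fderiv ℂ F (segreProj m g x) (zetaDir m) * fderiv ℂ g x u) := by
  have hz : (F ∘ segreProj m g) =ᶠ[𝓝 (p, bar p)] fun _ => 0 := by
    filter_upwards [hg.tendsto_segreProj.eventually (hg.eq_zero F hF h0), hg.apply_segreProj]
      with x h1 h2 using h1 h2
  filter_upwards [hz.eventually_nhds, hg.tendsto_segreProj.eventually hF.eventually_analyticAt,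
    hg.analytic.eventually_analyticAt] with x h1 h2 h3 u
  have h4 : HasFDerivAt (segreProj m g)
      (ContinuousLinearMap.id ℂ _ + (fderiv ℂ g x).smulRight (zetaDir m)) x :=
    (hasFDerivAt_id x).add (h3.differentiableAt.hasFDerivAt.smul_const (zetaDir m))
  have h5 := (h2.differentiableAt.hasFDerivAt.comp x h4).fderiv
  have h6 : fderiv ℂ (F ∘ segreProj m g) x = 0 := by
    rw [EventuallyEq.fderiv_eq h1]; simp
  have h7 := DFunLike.congr_fun (h5.symm.trans h6) u
  simp only [ContinuousLinearMap.comp_apply, _root_.add_apply, ContinuousLinearMap.id_apply,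
    ContinuousLinearMap.smulRight_apply, map_add, map_smul, smul_eq_mul,
    _root_.zero_apply] at h7
  linear_combination h7

end IsSegreFunction

/-! ### Projection to a Segre variety -/

/-- The projection of `ℂ^N` to the Segre variety of `p` along `e_m`. -/
def segreProjAt (m : Fin N) (g : CSpace N × CSpace N → ℂ) (p ζ : CSpace N) :
    CSpace N := ζ + g (p, ζ) • e m

lemma segreProj_eq (m : Fin N) (g : CSpace N × CSpace N → ℂ) (p ζ : CSpace N) :
    segreProj m g (p, ζ) = (p, segreProjAt m g p ζ) := by
  simp [segreProj, segreProjAt, zetaDir]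

lemma tendsto_slice (p : CSpace N) :
    Tendsto (fun ζ => (p, ζ)) (𝓝 (bar p)) (𝓝 (p, bar p)) :=
  (Continuous.prodMk_right p).tendsto _

namespace IsSegreFunction

variable {p : CSpace N} {m : Fin N} {g : CSpace N × CSpace N → ℂ}

lemma analyticAt_segreProjAt (hg : IsSegreFunction M p m g) :
    AnalyticAt ℂ (segreProjAt m g p) (bar p) :=
  analyticAt_id.add ((analyticAt_slice hg.analytic).smul analyticAt_const)

lemma segreProjAt_self (hg : IsSegreFunction M p m g) :
    segreProjAt m g p (bar p) = bar p := by simp [segreProjAt, hg.apply_eq_zero]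

lemma tendsto_segreProjAt (hg : IsSegreFunction M p m g) :
    Tendsto (segreProjAt m g p) (𝓝 (bar p)) (𝓝 (bar p)) := by
  simpa [ContinuousAt, hg.segreProjAt_self] using hg.analyticAt_segreProjAt.continuousAt

lemma analyticAt_comp_segreProjAt (hg : IsSegreFunction M p m g)
    {h : CSpace N → ℂ} (hh : AnalyticAt ℂ h (bar p)) :
    AnalyticAt ℂ (h ∘ segreProjAt m g p) (bar p) :=
  AnalyticAt.comp (by rwa [hg.segreProjAt_self]) hg.analyticAt_segreProjAt

lemma fderiv_comp_segreProjAt (hg : IsSegreFunction M p m g)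
    {h : CSpace N → ℂ} (hh : AnalyticAt ℂ h (bar p)) :
    ∀ᶠ ζ in 𝓝 (bar p), ∀ η, fderiv ℂ (h ∘ segreProjAt m g p) ζ η =
      fderiv ℂ h (segreProjAt m g p ζ) (η + fderiv ℂ g (p, ζ) (0, η) • e m) := by
  filter_upwards [hg.tendsto_segreProjAt.eventually hh.eventually_analyticAt,
    (tendsto_slice p).eventually hg.analytic.eventually_analyticAt] with ζ h1 h2 η
  have h3 : HasFDerivAt (segreProjAt m g p)
      (ContinuousLinearMap.id ℂ _ + (fderiv ℂ (fun ζ => g (p, ζ)) ζ).smulRight (e m)) ζ :=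
    (hasFDerivAt_id ζ).add
      ((analyticAt_slice h2).differentiableAt.hasFDerivAt.smul_const (e m))
  rw [(h1.differentiableAt.hasFDerivAt.comp ζ h3).fderiv]
  simp [fderiv_slice h2]

end IsSegreFunction

/-- The functions `∂_v R(p, ·)` on the Segre variety of `p` and `∂_v g(p, ·)` vanish to the same
order at `p̄`. -/
lemma IsSegreFunction.vanishesToOrder_fderiv_iff {p : CSpace N} {m : Fin N}
    {g R : CSpace N × CSpace N → ℂ} (hg : IsSegreFunction M p m g)
    (hR : AnalyticAt ℂ R (p, bar p)) (hmem : ∀ᶠ Z in 𝓝 p, Z ∈ M → R (Z, bar Z) = 0)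
    (hm : fderiv ℂ R (p, bar p) (zetaDir m) ≠ 0) (k : ℕ) (v : CSpace N) :
    VanishesToOrder ((fun ζ => fderiv ℂ R (p, ζ) (v, 0)) ∘ segreProjAt m g p) (bar p) k ↔
      VanishesToOrder (fun ζ => fderiv ℂ g (p, ζ) (v, 0)) (bar p) k := by
  have hRm : AnalyticAt ℂ (fun x => fderiv ℂ R x (zetaDir m)) (p, bar p) :=
    analyticAt_vfd (analyticAt_const (v := zetaDir m)) hR
  have e1 : ((fun ζ => fderiv ℂ R (p, ζ) (v, 0)) ∘ segreProjAt m g p) =ᶠ[𝓝 (bar p)]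
      fun ζ => -(fderiv ℂ R (p, segreProjAt m g p ζ) (zetaDir m) *
        fderiv ℂ g (p, ζ) (v, 0)) := by
    filter_upwards [(tendsto_slice p).eventually (hg.fderiv_segreProj hR hmem)] with ζ h1
    have := h1 (v, 0)
    rw [segreProj_eq] at this
    exact this
  -- the factor `∂R/∂ζ_m` is a unit
  have hcont : Tendsto (fun ζ => fderiv ℂ R (p, segreProjAt m g p ζ) (zetaDir m)) (𝓝 (bar p))
      (𝓝 (fderiv ℂ R (p, bar p) (zetaDir m))) :=
    hRm.continuousAt.tendsto.comp ((tendsto_slice p).comp hg.tendsto_segreProjAt)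
  have hne := hcont.eventually_ne hm
  constructor
  · intro H
    have h2 : (fun ζ => (fderiv ℂ R (p, segreProjAt m g p ζ) (zetaDir m))⁻¹) =O[𝓝 (bar p)]
        fun _ => (1 : ℝ) := (hcont.inv₀ hm).isBigO_one ℝ
    have h3 := (h2.mul (H.congr e1)).neg_left
    refine IsBigO.congr' h3 ?_ (by simp)
    filter_upwards [hne] with ζ hζ
    field_simp
  · intro H
    refine VanishesToOrder.congr ?_ e1.symm
    have h3 := ((hcont.isBigO_one ℝ).mul H).neg_left
    exact h3.congr_right fun _ => one_mul _

/-! ### Local data -/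

/-- The field `X_j` as a vector-valued function. -/
def segreVec (A : Fin (N - 1) → Fin N → CSpace N × CSpace N → ℂ) (p : CSpace N)
    (j : Fin (N - 1)) : CSpace N → CSpace N := fun ζ k => A j k (p, ζ)

lemma eq_sum_smul_e (v : CSpace N) : v = ∑ k, v k • (e k : CSpace N) := by
  ext j
  simp [e, Finset.sum_apply, Pi.single_apply]

lemma segreField_eq_vfd (A : Fin (N - 1) → Fin N → CSpace N × CSpace N → ℂ) (p : CSpace N)
    (j : Fin (N - 1)) : segreField A p j = vfd (segreVec A p j) := by
  ext h ζ
  rw [vfd, eq_sum_smul_e (segreVec A p j ζ), map_sum]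
  simp [segreField, segreVec]

lemma segreFieldPow_eq_vfWord (A : Fin (N - 1) → Fin N → CSpace N × CSpace N → ℂ)
    (p : CSpace N) (α : Fin (N - 1) → ℕ) (h : CSpace N → ℂ) :
    segreFieldPow A p α h = vfWord ((monomialWord α).map (segreVec A p)) h := by
  have hrep : ∀ (j : Fin (N - 1)) (n : ℕ) (f : CSpace N → ℂ),
      vfWord ((List.replicate n j).map (segreVec A p)) f = (segreField A p j)^[n] f := by
    intro j n f
    induction n with
    | zero => rfl
    | succ n ih =>
      rw [List.replicate_succ, List.map_cons, vfWord_cons, ih, Function.iterate_succ_apply',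
        segreField_eq_vfd]
  unfold segreFieldPow monomialWord
  generalize List.finRange (N - 1) = l
  induction l with
  | nil => rfl
  | cons j l ih =>
    rw [List.flatMap_cons, List.map_append, vfWord_append, ← ih, hrep]
    rfl

/-- The properties of local data `(R, A)` at `p` relative to a normalized equation of the
complexification of `M`. -/
structure IsAdapted (M : Set (CSpace N)) (p : CSpace N) (m : Fin N)
    (g R : CSpace N × CSpace N → ℂ) (A : Fin (N - 1) → Fin N → CSpace N × CSpace N → ℂ) :
    Prop where
  segre : IsSegreFunction M p m g
  analytic : AnalyticAt ℂ R (p, bar p)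
  analytic_coeff : ∀ j k, AnalyticAt ℂ (A j k) (p, bar p)
  mem : ∀ᶠ Z in 𝓝 p, Z ∈ M → R (Z, bar Z) = 0
  fderiv_ne_zero : fderiv ℂ R (p, bar p) (zetaDir m) ≠ 0
  tangent : ∀ j, ∀ᶠ x in 𝓝 (p, bar p), g x = 0 → fderiv ℂ R x (0, fun k => A j k x) = 0
  linearIndependent : LinearIndependent ℂ fun j => (fun k => A j k (p, bar p) : CSpace N)

lemma IsSegreFunction.fderiv_zetaDir_ne_zero {p : CSpace N} {m : Fin N}
    {g R : CSpace N × CSpace N → ℂ} {ρ : CSpace N → ℝ} (hg : IsSegreFunction M p m g)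
    (hρ : IsDefiningFunction M p ρ) (hR : IsComplexification p (toC ρ) R) :
    fderiv ℂ R (p, bar p) (zetaDir m) ≠ 0 := by
  intro h
  have hmem : ∀ᶠ Z in 𝓝 p, Z ∈ M → R (Z, bar Z) = 0 := by
    filter_upwards [hR.2, hρ.mem_iff] with Z h1 h2 h3
    rw [h1, toC, h2.1 h3, Complex.ofReal_zero]
  have h1 := (hg.fderiv_segreProj hR.1 hmem).self_of_nhds
  rw [hg.segreProj_self] at h1
  refine hρ.fderiv_ne_zero ?_
  ext w
  have h2 := h1 (w, bar w)
  rw [h, zero_mul, neg_zero, hR.fderiv_diag hρ.analytic] at h2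
  exact_mod_cast h2

lemma IsLocalData.isAdapted {p : CSpace N} {m : Fin N} {g R : CSpace N × CSpace N → ℂ}
    {A : Fin (N - 1) → Fin N → CSpace N × CSpace N → ℂ} (hd : IsLocalData M p R A)
    (hg : IsSegreFunction M p m g) : IsAdapted M p m g R A := by
  obtain ⟨ρ, a, hρ, ha, hR, hA⟩ := hd
  have hmem : ∀ᶠ Z in 𝓝 p, Z ∈ M → R (Z, bar Z) = 0 := by
    filter_upwards [hR.2, hρ.mem_iff] with Z h1 h2 h3
    rw [h1, toC, h2.1 h3, Complex.ofReal_zero]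
  refine ⟨hg, hR.1, fun j k => (hA j k).1, hmem, hg.fderiv_zetaDir_ne_zero hρ hR, fun j => ?_, ?_⟩
  · refine hg.eq_zero _ ?_ ?_
    · have h1 : AnalyticAt ℂ (fun x => fun k => A j k x) (p, bar p) :=
        AnalyticAt.pi fun k => (hA j k).1
      exact analyticAt_vfd (Y := fun x => (0, fun k => A j k x)) (analyticAt_const.prod h1) hR.1
    · filter_upwards [ha.tangent j, hR.dZbar_eq,
        eventually_all.2 fun k => (hA j k).2] with Z h1 h2 h3 hZ
      rw [← h1 hZ]
      have : ((0, fun k => A j k (Z, bar Z)) : CSpace N × CSpace N) =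
          ContinuousLinearMap.inr ℂ (CSpace N) (CSpace N) (fun k => A j k (Z, bar Z)) := rfl
      rw [this, eq_sum_smul_e (fun k => A j k (Z, bar Z)), map_sum, map_sum]
      refine Finset.sum_congr rfl fun k _ => ?_
      rw [map_smul, map_smul, h2 k, smul_eq_mul, h3 k]
      rfl
  · convert ha.linearIndependent using 3 with j k
    exact (hA j _).2.self_of_nhds

namespace IsAdapted

variable {p : CSpace N} {m : Fin N} {g R : CSpace N × CSpace N → ℂ}
  {A : Fin (N - 1) → Fin N → CSpace N × CSpace N → ℂ}

lemma analyticAt_segreVec (hA : IsAdapted M p m g R A) (j : Fin (N - 1)) :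
    AnalyticAt ℂ (segreVec A p j) (bar p) :=
  AnalyticAt.pi fun k => analyticAt_slice (hA.analytic_coeff j k)

/-- `X_j` is tangent to the Segre variety. -/
lemma fderiv_segreVec (hA : IsAdapted M p m g R A) (j : Fin (N - 1)) :
    ∀ᶠ ζ in 𝓝 (bar p), fderiv ℂ g (p, ζ) (0, segreVec A p j (segreProjAt m g p ζ)) = 0 := by
  have hg := hA.segre
  have hne : ∀ᶠ x in 𝓝 (p, bar p), fderiv ℂ R x (zetaDir m) ≠ 0 :=
    (analyticAt_vfd (analyticAt_const (v := zetaDir m))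
      hA.analytic).continuousAt.eventually_ne hA.fderiv_ne_zero
  have hP : ∀ᶠ x in 𝓝 (p, bar p),
      fderiv ℂ g x (0, fun k => A j k (segreProj m g x)) = 0 := by
    filter_upwards [hg.fderiv_segreProj hA.analytic hA.mem,
      hg.tendsto_segreProj.eventually hne, hg.tendsto_segreProj.eventually (hA.tangent j),
      hg.apply_segreProj] with x h1 h2 h3 h4
    have h5 := h1 (0, fun k => A j k (segreProj m g x))
    rw [h3 h4] at h5
    simpa [h2] using h5.symm
  filter_upwards [(tendsto_slice p).eventually hP] with ζ h1
  rw [segreProj_eq] at h1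
  exact h1

lemma vfWord_comp_segreProjAt (hA : IsAdapted M p m g R A) {h : CSpace N → ℂ}
    (hh : AnalyticAt ℂ h (bar p)) (l : List (Fin (N - 1))) :
    vfWord (l.map (segreVec A p)) h ∘ segreProjAt m g p =ᶠ[𝓝 (bar p)]
      vfWord (l.map fun j => segreVec A p j ∘ segreProjAt m g p) (h ∘ segreProjAt m g p) := by
  induction l with
  | nil => rfl
  | cons j l ih =>
    have ha : AnalyticAt ℂ (vfWord (l.map (segreVec A p)) h) (bar p) :=
      analyticAt_vfWord (by simp [hA.analyticAt_segreVec]) hh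
    simp only [List.map_cons, vfWord_cons]
    refine EventuallyEq.trans ?_ (vfd_congr ih)
    filter_upwards [hA.segre.fderiv_comp_segreProjAt ha, hA.fderiv_segreVec j] with ζ h1 h2
    rw [vfd, h1]
    simp only [Function.comp_apply]
    rw [h2, zero_smul, add_zero]
    rfl

/-- All the derivatives `X^α h`, `|α| ≤ k`, vanish at `p̄` if and only if `h` vanishes to order
`k + 1` on the Segre variety of `p`. -/
lemma segreFieldPow_eq_zero_iff (hA : IsAdapted M p m g R A) {h : CSpace N → ℂ}
    (hh : AnalyticAt ℂ h (bar p)) (k : ℕ) :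
    (∀ α : Fin (N - 1) → ℕ, ∑ j, α j ≤ k → segreFieldPow A p α h (bar p) = 0) ↔
      VanishesToOrder (h ∘ segreProjAt m g p) (bar p) (k + 1) := by
  have hg := hA.segre
  have key : ∀ α, segreFieldPow A p α h (bar p) =
      vfWord ((monomialWord α).map fun j => segreVec A p j ∘ segreProjAt m g p)
        (h ∘ segreProjAt m g p) (bar p) := by
    intro α
    rw [segreFieldPow_eq_vfWord, ← (hA.vfWord_comp_segreProjAt hh _).self_of_nhds,
      Function.comp_apply, hg.segreProjAt_self]
  have hY : ∀ j, AnalyticAt ℂ (segreVec A p j ∘ segreProjAt m g p) (bar p) := fun j =>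
    AnalyticAt.comp (by rw [hg.segreProjAt_self]; exact hA.analyticAt_segreVec j)
      hg.analyticAt_segreProjAt
  have ha := hg.analyticAt_comp_segreProjAt hh
  constructor
  · intro H
    refine vanishesToOrder_of_monomialWord (e := e m) hY ?_ ha ?_
      fun α hα => by rw [← key]; exact H α hα
    · have hli : LinearIndependent ℂ
          (fun o : Option (Fin (N - 1)) => o.elim (e m : CSpace N)
            fun j => segreVec A p j (bar p)) := by
        refine linearIndependent_option.2 ⟨hA.linearIndependent, ?_⟩
        intro hmem
        have hle : Submodule.span ℂ (Set.range fun j => segreVec A p j (bar p)) ≤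
            LinearMap.ker ((fderiv ℂ g (p, bar p)).comp
              (ContinuousLinearMap.inr ℂ (CSpace N) (CSpace N)) : CSpace N →ₗ[ℂ] ℂ) := by
          rw [Submodule.span_le]
          rintro _ ⟨j, rfl⟩
          have := (hA.fderiv_segreVec j).self_of_nhds
          rw [hg.segreProjAt_self] at this
          simpa using this
        have h1 := hle hmem
        have h2 := hg.fderiv_zetaDir.self_of_nhds
        simp only [LinearMap.mem_ker] at h1
        change fderiv ℂ g (p, bar p) (zetaDir m) = 0 at h1
        rw [h1] at h2
        norm_num at h2
      have hN : 0 < N := Fin.pos m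
      have := hli.span_eq_top_of_card_eq_finrank' (by simp; omega)
      rw [← this]
      congr 1
      ext v
      simp [Option.exists, eq_comm, hg.segreProjAt_self]
    · filter_upwards [hg.fderiv_comp_segreProjAt hh,
        (tendsto_slice p).eventually hg.fderiv_zetaDir] with ζ h1 h2
      rw [h1, show ((0, e m) : CSpace N × CSpace N) = zetaDir m from rfl, h2]
      simp
  · intro H α hα
    rw [key]
    refine H.vfWord_apply_eq_zero ?_ ha (by simpa [length_monomialWord] using hα)
    simp only [List.mem_map, forall_exists_index, and_imp]
    rintro _ j _ rfl
    exact hY j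

lemma cFun_eventuallyEq (hA : IsAdapted M p m g R A) (α : Fin (N - 1) → ℕ) :
    cFun R A p α =ᶠ[𝓝 0] fun Z =>
      vfWord (((monomialWord α).map (segreVec A p)).map liftField) R (Z + p, bar p) := by
  have ht : Tendsto (fun Z : CSpace N => (Z + p, bar p)) (𝓝 0) (𝓝 (p, bar p)) :=
    (by fun_prop : Continuous fun Z : CSpace N => (Z + p, bar p)).tendsto' _ _ (by simp)
  have hs := vfWord_slice (l := (monomialWord α).map (segreVec A p)) (F := R)
    (P := (p, bar p)) (by simp [hA.analyticAt_segreVec]) hA.analytic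
  filter_upwards [ht.eventually hs] with Z hZ
  rw [cFun, segreFieldPow_eq_vfWord]
  exact hZ

lemma analyticAt_cFun (hA : IsAdapted M p m g R A) (α : Fin (N - 1) → ℕ) :
    AnalyticAt ℂ (cFun R A p α) 0 := by
  refine AnalyticAt.congr ?_ (hA.cFun_eventuallyEq α).symm
  have h1 : AnalyticAt ℂ
      (vfWord (((monomialWord α).map (segreVec A p)).map liftField) R) (p, bar p) :=
    analyticAt_vfWord_lift (by simp [hA.analyticAt_segreVec]) hA.analytic
  exact AnalyticAt.fun_comp (g := vfWord _ R) (f := fun Z : CSpace N => (Z + p, bar p))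
    (by simpa using h1) ((analyticAt_id.add analyticAt_const).prod analyticAt_const)

lemma fderiv_cFun (hA : IsAdapted M p m g R A) (α : Fin (N - 1) → ℕ) (v : CSpace N) :
    fderiv ℂ (cFun R A p α) 0 v =
      segreFieldPow A p α (fun ζ => fderiv ℂ R (p, ζ) (v, 0)) (bar p) := by
  have hX : ∀ Y ∈ (monomialWord α).map (segreVec A p), AnalyticAt ℂ Y (p, bar p).2 := by
    simp [hA.analyticAt_segreVec]
  have h1 : AnalyticAt ℂ
      (vfWord (((monomialWord α).map (segreVec A p)).map liftField) R) (p, bar p) :=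
    analyticAt_vfWord_lift hX hA.analytic
  have h2 : HasFDerivAt (fun Z : CSpace N => (Z + p, bar p))
      (ContinuousLinearMap.inl ℂ (CSpace N) (CSpace N)) 0 :=
    ((hasFDerivAt_id (0 : CSpace N)).add_const p).prodMk (hasFDerivAt_const (bar p) _)
  have h3 := HasFDerivAt.comp (0 : CSpace N) (f := fun Z : CSpace N => (Z + p, bar p))
    (g := vfWord (((monomialWord α).map (segreVec A p)).map liftField) R)
    (by simpa using h1.differentiableAt.hasFDerivAt) h2
  rw [(hA.cFun_eventuallyEq α).fderiv_eq]
  have h4 := DFunLike.congr_fun h3.fderiv v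
  rw [Function.comp_def] at h4
  rw [h4, segreFieldPow_eq_vfWord]
  have h5 := (vfWord_liftField_comm hX hA.analytic v).self_of_nhds
  have h6 := (vfWord_slice hX (analyticAt_vfd (analyticAt_const (v := (v, (0 : CSpace N))))
    hA.analytic)).self_of_nhds
  simp only [List.map_map] at h5 h6
  exact h5.trans h6.symm

/-- The common kernel of the differentials of the `c_α`, `|α| ≤ k`, in terms of the normalized
equation `g`. In particular this kernel does not depend on the local data. -/
lemma fderiv_cFun_eq_zero_iff (hA : IsAdapted M p m g R A) (k : ℕ) (v : CSpace N) :
    (∀ α : Fin (N - 1) → ℕ, ∑ j, α j ≤ k → fderiv ℂ (cFun R A p α) 0 v = 0) ↔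
      VanishesToOrder (fun ζ => fderiv ℂ g (p, ζ) (v, 0)) (bar p) (k + 1) := by
  have hRv : AnalyticAt ℂ (fun x => fderiv ℂ R x (v, 0)) (p, bar p) :=
    analyticAt_vfd (analyticAt_const (v := (v, (0 : CSpace N)))) hA.analytic
  simp only [hA.fderiv_cFun]
  rw [hA.segreFieldPow_eq_zero_iff (analyticAt_slice hRv)]
  exact hA.segre.vanishesToOrder_fderiv_iff hA.analytic hA.mem hA.fderiv_ne_zero _ v

/-- If `g(Z, ·) - g(p, ·)` vanishes to order `k + 1` at `p̄`, then `Z - p` is a common zero of the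
`c_α` with `|α| ≤ k`. -/
lemma cFun_eq_zero (hA : IsAdapted M p m g R A) (k : ℕ) :
    ∀ᶠ Z in 𝓝 p, VanishesToOrder (fun ζ => g (Z, ζ) - g (p, ζ)) (bar p) (k + 1) →
      ∀ α : Fin (N - 1) → ℕ, ∑ j, α j ≤ k → cFun R A p α (Z - p) = 0 := by
  have hg := hA.segre
  obtain ⟨K, s, hs, hK⟩ := hA.analytic.hasStrictFDerivAt.exists_lipschitzOnWith
  have ht : Tendsto (fun x : CSpace N × CSpace N => (x.1, segreProjAt m g p x.2))
      (𝓝 (p, bar p)) (𝓝 (p, bar p)) :=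
    (continuous_fst.tendsto _).prodMk_nhds
      (hg.tendsto_segreProjAt.comp (continuous_snd.tendsto (p, bar p)))
  have hz : ∀ᶠ x in 𝓝 (p, bar p), R (segreProj m g x) = 0 := by
    filter_upwards [hg.tendsto_segreProj.eventually (hg.eq_zero R hA.analytic hA.mem),
      hg.apply_segreProj] with x h1 h2 using h1 h2
  have hbd : ∀ᶠ x in 𝓝 (p, bar p),
      ‖R (x.1, segreProjAt m g p x.2)‖ ≤ K * ‖(e m : CSpace N)‖ * ‖g x - g (p, x.2)‖ := by
    filter_upwards [hz, ht.eventually hs, hg.tendsto_segreProj.eventually hs] with x h1 h2 h3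
    have h4 := hK.norm_sub_le h2 h3
    rw [h1, sub_zero] at h4
    refine h4.trans (le_of_eq ?_)
    have : ((x.1, segreProjAt m g p x.2) - segreProj m g x : CSpace N × CSpace N) =
        (0, (g (p, x.2) - g x) • e m) := by
      refine Prod.ext ?_ ?_
      · simp [segreProj, zetaDir]
      · simp [segreProj, zetaDir, segreProjAt, sub_smul]
    rw [this, Prod.norm_mk, norm_zero, max_eq_right (norm_nonneg _), norm_smul, norm_sub_rev]
    ring
  have ht2 : Tendsto (fun Z : CSpace N => (Z, bar p)) (𝓝 p) (𝓝 (p, bar p)) :=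
    (Continuous.prodMk_left (bar p)).tendsto _
  filter_upwards [ht2.eventually hbd.eventually_nhds,
    ht2.eventually hA.analytic.eventually_analyticAt] with Z h1 h2 H α hα
  rw [cFun, sub_add_cancel]
  refine (hA.segreFieldPow_eq_zero_iff (analyticAt_slice h2) k).2 ?_ α hα
  have h3 : Tendsto (fun ζ : CSpace N => (Z, ζ)) (𝓝 (bar p)) (𝓝 (Z, bar p)) :=
    (Continuous.prodMk_right Z).tendsto _
  exact (IsBigO.of_bound _ (h3.eventually h1)).trans H

lemma cFun_zero (hA : IsAdapted M p m g R A) (α : Fin (N - 1) → ℕ) : cFun R A p α 0 = 0 := by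
  have := (hA.cFun_eq_zero (∑ j, α j)).self_of_nhds (by
    simp only [sub_self]; exact isBigO_zero _ _) α le_rfl
  simpa using this

end IsAdapted

/-- Local data exist at every point of `M`. -/
lemma exists_isLocalData (hM : IsRealAnalyticHypersurface M) {p : CSpace N} (hp : p ∈ M) :
    ∃ R A, IsLocalData M p R A := by
  obtain ⟨ρ, hρ⟩ := hM p hp
  obtain ⟨R, hR⟩ := exists_isComplexification
    (f := toC ρ) (p := p) (Complex.ofRealCLM.analyticAt _ |>.comp hρ.analytic)
  obtain ⟨m, hm⟩ := exists_zetaDir_ne_zero hρ hR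
  -- complex tangent vectors at `p`, corrected along `e_m` to remain tangent nearby
  let dR : CSpace N →ₗ[ℂ] ℂ := (fderiv ℂ R (p, bar p)).comp
    (ContinuousLinearMap.inr ℂ (CSpace N) (CSpace N))
  have hrk : Module.finrank ℂ (LinearMap.ker dR) = N - 1 := by
    have h1 : LinearMap.range dR = ⊤ := by
      rw [LinearMap.range_eq_top]
      exact LinearMap.surjective (by
        intro h0
        exact hm (LinearMap.congr_fun h0 (e m)))
    have h2 := dR.finrank_range_add_finrank_ker
    rw [h1] at h2
    simp at h2
    omega
  let b := Module.finBasisOfFinrankEq ℂ (LinearMap.ker dR) hrk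
  let c : Fin (N - 1) → CSpace N × CSpace N → ℂ := fun j x =>
    fderiv ℂ R x (0, (b j : CSpace N)) / fderiv ℂ R x (zetaDir m)
  let A : Fin (N - 1) → Fin N → CSpace N × CSpace N → ℂ := fun j k x =>
    (b j : CSpace N) k - c j x * (e m : CSpace N) k
  have hc : ∀ j, AnalyticAt ℂ (c j) (p, bar p) := fun j =>
    AnalyticAt.div (analyticAt_vfd (analyticAt_const (v := (0, (b j : CSpace N)))) hR.1)
      (analyticAt_vfd (analyticAt_const (v := zetaDir m)) hR.1) hm
  have hAa : ∀ j k, AnalyticAt ℂ (A j k) (p, bar p) := fun j k =>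
    analyticAt_const.sub ((hc j).mul analyticAt_const)
  have hcP : ∀ j, c j (p, bar p) = 0 := by
    intro j
    have : fderiv ℂ R (p, bar p) (0, (b j : CSpace N)) = 0 := (b j).2
    simp [c, this]
  refine ⟨R, A, ρ, fun j k Z => A j k (Z, bar Z), hρ, ⟨fun j k => ?_, fun j => ?_, ?_⟩, hR,
    fun j k => ⟨hAa j k, Eventually.of_forall fun _ => rfl⟩⟩
  · exact AnalyticAt.comp (g := A j k) (f := diag N) (hAa j k).restrictScalars
      ((diag N).analyticAt p)
  · have hne : ∀ᶠ x in 𝓝 (p, bar p), fderiv ℂ R x (zetaDir m) ≠ 0 :=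
      (analyticAt_vfd (analyticAt_const (v := zetaDir m)) hR.1).continuousAt.eventually_ne hm
    filter_upwards [hR.dZbar_eq, (tendsto_diag p).eventually hne] with Z h1 h2 _
    simp only [h1]
    set L : CSpace N →L[ℂ] ℂ := (fderiv ℂ R (Z, bar Z)).comp
      (ContinuousLinearMap.inr ℂ (CSpace N) (CSpace N)) with hL
    have h3 : ∑ k, A j k (Z, bar Z) * L (e k) =
        L ((b j : CSpace N) - c j (Z, bar Z) • e m) := by
      rw [eq_sum_smul_e ((b j : CSpace N) - c j (Z, bar Z) • e m), map_sum]
      simp [A]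
    have h4 : c j (Z, bar Z) * L (e m) = L (b j) := div_mul_cancel₀ _ h2
    change ∑ k, A j k (Z, bar Z) * L (e k) = 0
    rw [h3, map_sub, map_smul, smul_eq_mul, h4, sub_self]
  · have : (fun j => (fun k => A j k (p, bar p) : CSpace N)) = fun j => (b j : CSpace N) := by
      ext j k
      simp [A, hcP]
    rw [this]
    exact b.linearIndependent.map' (LinearMap.ker dR).subtype (Submodule.ker_subtype _)

end

/-! ### Kernels of holomorphic families of linear maps -/

section KernelFamilies

variable {E F X : Type*} [NormedAddCommGroup E] [NormedSpace ℂ E] [FiniteDimensional ℂ E]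
  [NormedAddCommGroup F] [NormedSpace ℂ F] [FiniteDimensional ℂ F]
  [NormedAddCommGroup X] [NormedSpace ℂ X]

/-- `T` and `π` normalize the linear map `L`: `π` is a projection to the kernel of `L`, and `T` is
a partial inverse of `L`, with values in the kernel of `π`. -/
structure IsNormalization (L : E →L[ℂ] F) (T : F →L[ℂ] E) (π : E →L[ℂ] E) : Prop where
  add_eq : T.comp L + π = 1
  map_proj : ∀ v, L (π v) = 0
  proj_of_mem : ∀ v, L v = 0 → π v = v
  proj_map : ∀ y, π (T y) = 0

lemma IsNormalization.proj_proj {L : E →L[ℂ] F} {T : F →L[ℂ] E} {π : E →L[ℂ] E}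
    (h : IsNormalization L T π) (v : E) : π (π v) = π v := h.proj_of_mem _ (h.map_proj v)

lemma exists_isNormalization (L : E →L[ℂ] F) :
    ∃ T π, IsNormalization L T π := by
  set C := LinearMap.ker (L : E →ₗ[ℂ] F) with hC
  obtain ⟨r, hr⟩ := C.subtype.exists_leftInverse_of_injective C.ker_subtype
  let π : E →ₗ[ℂ] E := C.subtype ∘ₗ r
  have hπC : ∀ v, L (π v) = 0 := fun v => (r v).2
  have hπ : ∀ v, L v = 0 → π v = v := by
    intro v hv
    have := LinearMap.congr_fun hr ⟨v, hv⟩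
    exact congrArg Subtype.val this
  obtain ⟨s, hs⟩ := (L : E →ₗ[ℂ] F).rangeRestrict.exists_rightInverse_of_surjective
    (LinearMap.range_rangeRestrict _)
  obtain ⟨T₀, hT₀⟩ := LinearMap.exists_extend s
  let T : F →ₗ[ℂ] E := (LinearMap.id - π) ∘ₗ T₀
  refine ⟨T.toContinuousLinearMap, π.toContinuousLinearMap, ?_, hπC, hπ, ?_⟩
  · ext v
    set y : LinearMap.range (L : E →ₗ[ℂ] F) := ⟨L v, v, rfl⟩ with hy
    have h1 : T₀ (L v) = s y := LinearMap.congr_fun hT₀ y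
    have h2 : L (s y) = L v := congrArg Subtype.val (LinearMap.congr_fun hs y)
    have h3 : π (s y - v) = s y - v := hπ _ (by rw [map_sub, h2, sub_self])
    rw [map_sub] at h3
    change (T₀ (L v) - π (T₀ (L v))) + π v = v
    rw [h1, show π (s y) = s y - v + π v by rw [← h3]; abel]
    abel
  · intro y
    change π (T₀ y - π (T₀ y)) = 0
    rw [map_sub, hπ (π (T₀ y)) (hπC _), sub_self]

variable {A : X → E →L[ℂ] F} {x₀ : X} {T : F →L[ℂ] E} {π : E →L[ℂ] E}

/-- The normalized family, which is the identity at the base point. -/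
def normalForm (A : X → E →L[ℂ] F) (T : F →L[ℂ] E) (π : E →L[ℂ] E) (x : X) : E →L[ℂ] E :=
  T.comp (A x) + π

/-- The vector `v(x)` whose projection to the kernel at the base point is `c` and which is
annihilated by `T ∘ A x`. -/
def kernelSection (A : X → E →L[ℂ] F) (T : F →L[ℂ] E) (π : E →L[ℂ] E) (c : E) (x : X) : E :=
  Ring.inverse (normalForm A T π x) c

lemma analyticAt_normalForm (hA : AnalyticAt ℂ A x₀) :
    AnalyticAt ℂ (normalForm A T π) x₀ :=
  (((ContinuousLinearMap.compL ℂ E F E T).analyticAt _).comp hA).add analyticAt_const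

lemma analyticAt_kernelSection (hn : IsNormalization (A x₀) T π) (hA : AnalyticAt ℂ A x₀)
    (c : E) : AnalyticAt ℂ (kernelSection A T π c) x₀ := by
  have : CompleteSpace E := FiniteDimensional.complete ℂ E
  have h1 : AnalyticAt ℂ (fun x => Ring.inverse (normalForm A T π x)) x₀ := by
    refine AnalyticAt.fun_comp (g := Ring.inverse) ?_ (analyticAt_normalForm hA)
    have : normalForm A T π x₀ = ((1 : (E →L[ℂ] E)ˣ) : E →L[ℂ] E) := hn.add_eq
    rw [this]
    exact analyticAt_inverse _
  exact ((ContinuousLinearMap.apply ℂ E c).analyticAt _).comp h1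

lemma kernelSection_self (hn : IsNormalization (A x₀) T π) (c : E) :
    kernelSection A T π c x₀ = c := by
  have : normalForm A T π x₀ = 1 := hn.add_eq
  simp [kernelSection, this]

lemma eventually_isUnit_normalForm (hn : IsNormalization (A x₀) T π) (hA : AnalyticAt ℂ A x₀) :
    ∀ᶠ x in 𝓝 x₀, IsUnit (normalForm A T π x) := by
  have : CompleteSpace E := FiniteDimensional.complete ℂ E
  refine (analyticAt_normalForm hA).continuousAt.eventually (Units.isOpen.mem_nhds ?_)
  exact ⟨1, hn.add_eq.symm⟩

lemma normalForm_kernelSection {x : X} (hu : IsUnit (normalForm A T π x)) (c : E) :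
    normalForm A T π x (kernelSection A T π c x) = c := by
  have := DFunLike.congr_fun (Ring.mul_inverse_cancel _ hu) c
  exact this

lemma kernelSection_eq {x : X} (hu : IsUnit (normalForm A T π x)) {v c : E}
    (h : normalForm A T π x v = c) : kernelSection A T π c x = v := by
  have := DFunLike.congr_fun (Ring.inverse_mul_cancel _ hu) v
  rw [← h]
  exact this

lemma normalForm_of_mem_ker {x : X} {v : E} (hv : A x v = 0) : normalForm A T π x v = π v := by
  simp [normalForm, hv]

lemma eq_zero_of_mem_ker {x : X} (hu : IsUnit (normalForm A T π x)) {v : E} (hv : A x v = 0)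
    (hπ : π v = 0) : v = 0 := by
  rw [← kernelSection_eq hu (normalForm_of_mem_ker hv), hπ, kernelSection, map_zero]

lemma proj_kernelSection (hn : IsNormalization (A x₀) T π) {x : X}
    (hu : IsUnit (normalForm A T π x)) {c : E} (hc : A x₀ c = 0) :
    π (kernelSection A T π c x) = c := by
  have h := congrArg π (normalForm_kernelSection hu c)
  rw [normalForm, _root_.add_apply, map_add, ContinuousLinearMap.comp_apply, hn.proj_map,
    zero_add, hn.proj_proj, hn.proj_of_mem c hc] at h
  exact h

/-- The projection of the kernel at `x` to the kernel at the base point. -/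
def kerProj (hn : IsNormalization (A x₀) T π) (x : X) :
    LinearMap.ker (A x : E →ₗ[ℂ] F) →ₗ[ℂ] LinearMap.ker (A x₀ : E →ₗ[ℂ] F) :=
  ((π : E →ₗ[ℂ] E).codRestrict _ fun v => hn.map_proj v).comp (Submodule.subtype _)

lemma kerProj_injective (hn : IsNormalization (A x₀) T π) {x : X}
    (hu : IsUnit (normalForm A T π x)) : Function.Injective (kerProj hn x) := by
  rw [← LinearMap.ker_eq_bot, LinearMap.ker_eq_bot']
  rintro ⟨v, hv⟩ h
  exact Subtype.ext (eq_zero_of_mem_ker hu hv (congrArg Subtype.val h))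

/-- The dimension of the kernel is upper semicontinuous. -/
lemma eventually_finrank_ker_le (hA : AnalyticAt ℂ A x₀) :
    ∀ᶠ x in 𝓝 x₀, Module.finrank ℂ (LinearMap.ker (A x : E →ₗ[ℂ] F)) ≤
      Module.finrank ℂ (LinearMap.ker (A x₀ : E →ₗ[ℂ] F)) := by
  obtain ⟨T, π, hn⟩ := exists_isNormalization (A x₀)
  filter_upwards [eventually_isUnit_normalForm hn hA] with x hx
  exact LinearMap.finrank_le_finrank_of_injective (kerProj_injective hn hx)

/-- Where the kernel has the same dimension as at the base point, the section `v(x)` lies in it. -/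
lemma map_kernelSection (hn : IsNormalization (A x₀) T π) {x : X}
    (hu : IsUnit (normalForm A T π x))
    (hd : Module.finrank ℂ (LinearMap.ker (A x : E →ₗ[ℂ] F)) =
      Module.finrank ℂ (LinearMap.ker (A x₀ : E →ₗ[ℂ] F))) {c : E} (hc : A x₀ c = 0) :
    A x (kernelSection A T π c x) = 0 := by
  obtain ⟨⟨v, hv⟩, hvc⟩ := (LinearMap.injective_iff_surjective_of_finrank_eq_finrank hd).1
    (kerProj_injective hn hu) ⟨c, hc⟩
  have h1 : π v = c := congrArg Subtype.val hvc
  rw [kernelSection_eq hu ((normalForm_of_mem_ker hv).trans h1)]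
  exact hv

end KernelFamilies

/-! ### Jets of the normalized equation in the variable `ζ` -/

section

lemma vfWord_sub {V : Type*} [NormedAddCommGroup V] [NormedSpace ℂ V] {l : List (V → V)}
    {h h' : V → ℂ} {p : V} (hl : ∀ Y ∈ l, AnalyticAt ℂ Y p) (ha : AnalyticAt ℂ h p)
    (ha' : AnalyticAt ℂ h' p) :
    vfWord l (fun x => h x - h' x) =ᶠ[𝓝 p] fun x => vfWord l h x - vfWord l h' x := by
  induction l with
  | nil => rfl
  | cons Y l ih =>
    have hl' : ∀ Z ∈ l, AnalyticAt ℂ Z p := fun Z hZ => hl Z (by simp [hZ])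
    refine (vfd_congr (ih hl')).trans ?_
    filter_upwards [(analyticAt_vfWord hl' ha).eventually_analyticAt,
      (analyticAt_vfWord hl' ha').eventually_analyticAt] with x h1 h2
    simp only [vfWord_cons]
    simp only [vfd]
    rw [fderiv_fun_sub h1.differentiableAt h2.differentiableAt]
    rfl

variable {N : ℕ} {M : Set (CSpace N)} {m : Fin N} {g : CSpace N × CSpace N → ℂ}

/-- The words in the derivations `∂/∂ζ_1, …, ∂/∂ζ_N` of length at most `k`. -/
abbrev JetIndex (N k : ℕ) : Type := {l : List (Fin N) // l.length ≤ k}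

instance (N k : ℕ) : Finite (JetIndex N k) := (List.finite_length_le (Fin N) k).to_subtype

instance (N k : ℕ) : Fintype (JetIndex N k) := Fintype.ofFinite _

/-- The iterated derivative of `g` with respect to the variables `ζ_i`, `i ∈ l`. -/
def zetaWord (l : List (Fin N)) (g : CSpace N × CSpace N → ℂ) : CSpace N × CSpace N → ℂ :=
  vfWord (l.map fun i _ => zetaDir i) g

/-- The jet of order `k` of `g` with respect to `ζ`. -/
def jet (k : ℕ) (g : CSpace N × CSpace N → ℂ) (x : CSpace N × CSpace N) : JetIndex N k → ℂ :=
  fun l => zetaWord l.1 g x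

/-- The derivative with respect to `Z` of the jet of order `k` of `g` with respect to `ζ`. -/
def jetDeriv (k : ℕ) (g : CSpace N × CSpace N → ℂ) (x : CSpace N × CSpace N) :
    CSpace N →L[ℂ] (JetIndex N k → ℂ) :=
  ContinuousLinearMap.pi fun l =>
    (fderiv ℂ (zetaWord l.1 g) x).comp (ContinuousLinearMap.inl ℂ (CSpace N) (CSpace N))

lemma jetDeriv_apply (k : ℕ) (x : CSpace N × CSpace N) (v : CSpace N) (l : JetIndex N k) :
    jetDeriv k g x v l = fderiv ℂ (zetaWord l.1 g) x (v, 0) := rfl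

lemma analyticAt_zetaWord {x : CSpace N × CSpace N} (hg : AnalyticAt ℂ g x)
    (l : List (Fin N)) : AnalyticAt ℂ (zetaWord l g) x :=
  analyticAt_vfWord (by simp [analyticAt_const]) hg

lemma analyticAt_jet {x : CSpace N × CSpace N} (hg : AnalyticAt ℂ g x) (k : ℕ) :
    AnalyticAt ℂ (jet k g) x := AnalyticAt.pi fun l => analyticAt_zetaWord hg l.1

lemma fderiv_jet {x : CSpace N × CSpace N} (hg : AnalyticAt ℂ g x) (k : ℕ) :
    (fderiv ℂ (jet k g) x).comp (ContinuousLinearMap.inl ℂ (CSpace N) (CSpace N)) =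
      jetDeriv k g x := by
  have h : HasFDerivAt (jet k g)
      (ContinuousLinearMap.pi fun l : JetIndex N k => fderiv ℂ (zetaWord l.1 g) x) x :=
    hasFDerivAt_pi.2 fun l => (analyticAt_zetaWord hg l.1).differentiableAt.hasFDerivAt
  rw [h.fderiv]
  rfl

lemma analyticAt_jetDeriv {x : CSpace N × CSpace N} (hg : AnalyticAt ℂ g x) (k : ℕ) :
    AnalyticAt ℂ (jetDeriv k g) x := by
  have h1 : AnalyticAt ℂ (fun y => (fderiv ℂ (jet k g) y).comp
      (ContinuousLinearMap.inl ℂ (CSpace N) (CSpace N))) x :=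
    (((ContinuousLinearMap.compL ℂ (CSpace N) (CSpace N × CSpace N) (JetIndex N k → ℂ)).flip
      (ContinuousLinearMap.inl ℂ (CSpace N) (CSpace N))).analyticAt _).comp
      (analyticAt_jet hg k).fderiv
  exact h1.congr (hg.eventually_analyticAt.mono fun y hy => fderiv_jet hy k)

lemma IsSegreFunction.zetaInvariant_zetaWord {p : CSpace N} (hg : IsSegreFunction M p m g)
    (l : List (Fin N)) : ZetaInvariant m (p, bar p) (fderiv ℂ (zetaWord l g)) := by
  induction l with
  | nil => exact hg.zetaInvariant_fderiv
  | cons i l ih =>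
    refine ZetaInvariant.fderiv ?_
    filter_upwards [ih] with y hy
    change fderiv ℂ (zetaWord l g) _ (zetaDir i) = fderiv ℂ (zetaWord l g) _ (zetaDir i)
    rw [hy]

lemma IsSegreFunction.zetaInvariant_jetDeriv {p : CSpace N} (hg : IsSegreFunction M p m g)
    (k : ℕ) : ZetaInvariant m (p, bar p) (jetDeriv k g) := by
  filter_upwards [eventually_all.2 fun l : JetIndex N k => hg.zetaInvariant_zetaWord l.1]
    with y hy
  unfold jetDeriv
  simp only [hy]

lemma span_range_e (N : ℕ) : Submodule.span ℂ (Set.range (e : Fin N → CSpace N)) = ⊤ := by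
  rw [eq_top_iff]
  intro v _
  rw [eq_sum_smul_e v]
  exact Submodule.sum_mem _ fun k _ =>
    Submodule.smul_mem _ _ (Submodule.subset_span ⟨k, rfl⟩)

lemma zetaWord_slice {Z ζ : CSpace N} (hg : AnalyticAt ℂ g (Z, ζ)) (l : List (Fin N)) :
    vfWord (l.map fun i _ => (e i : CSpace N)) (fun ζ => g (Z, ζ)) ζ = zetaWord l g (Z, ζ) := by
  have := (vfWord_slice (l := l.map fun i _ => (e i : CSpace N)) (F := g) (P := (Z, ζ))
    (by simp [analyticAt_const]) hg).self_of_nhds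
  rw [List.map_map] at this
  exact this

/-- The kernel of the derivative of the jet consists of the vectors `v` for which `∂_v g(Z, ·)`
vanishes to order `k + 1`. -/
lemma jetDeriv_eq_zero_iff {Z ζ : CSpace N} (hg : AnalyticAt ℂ g (Z, ζ)) (k : ℕ)
    (v : CSpace N) :
    jetDeriv k g (Z, ζ) v = 0 ↔
      VanishesToOrder (fun ζ' => fderiv ℂ g (Z, ζ') (v, 0)) ζ (k + 1) := by
  have hv : AnalyticAt ℂ (vfd (fun _ => (v, (0 : CSpace N))) g) (Z, ζ) :=
    analyticAt_vfd analyticAt_const hg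
  have key : ∀ l : List (Fin N), vfWord (l.map fun i _ => (e i : CSpace N))
      (fun ζ' => fderiv ℂ g (Z, ζ') (v, 0)) ζ = fderiv ℂ (zetaWord l g) (Z, ζ) (v, 0) := by
    intro l
    refine (zetaWord_slice hv l).trans ?_
    have := (vfWord_liftField_comm (l := l.map fun i _ => (e i : CSpace N)) (F := g)
      (P := (Z, ζ)) (by simp [analyticAt_const]) hg v).self_of_nhds
    rw [List.map_map] at this
    exact this.symm
  constructor
  · intro h
    refine vanishesToOrder_of_const_words (span_range_e N) (analyticAt_slice hv) fun l hl => ?_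
    rw [key]
    exact congrFun h ⟨l, hl⟩
  · intro h
    ext l
    rw [jetDeriv_apply, ← key]
    exact h.vfWord_apply_eq_zero (by simp [analyticAt_const]) (analyticAt_slice hv)
      (by simpa using l.2)

lemma vanishesToOrder_sub_of_jet_eq {Z Z' ζ : CSpace N} (hg : AnalyticAt ℂ g (Z, ζ))
    (hg' : AnalyticAt ℂ g (Z', ζ)) {k : ℕ} (h : jet k g (Z, ζ) = jet k g (Z', ζ)) :
    VanishesToOrder (fun ζ' => g (Z, ζ') - g (Z', ζ')) ζ (k + 1) := by
  refine vanishesToOrder_of_const_words (span_range_e N)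
    ((analyticAt_slice hg).sub (analyticAt_slice hg')) fun l hl => ?_
  refine (vfWord_sub (by simp [analyticAt_const]) (analyticAt_slice hg)
    (analyticAt_slice hg')).self_of_nhds.trans ?_
  simp only [zetaWord_slice hg, zetaWord_slice hg']
  exact sub_eq_zero.2 (congrFun h ⟨l, hl⟩)

/-- The dimension of the kernel of the derivative of the jet of order `k`. It is zero where `M` is
`k`-nondegenerate. -/
def kerDim (k : ℕ) (g : CSpace N × CSpace N → ℂ) (p : CSpace N) : ℕ :=
  Module.finrank ℂ (LinearMap.ker (jetDeriv k g (p, bar p) : CSpace N →ₗ[ℂ] JetIndex N k → ℂ))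

lemma eventually_kerDim_le {p : CSpace N} (hg : AnalyticAt ℂ g (p, bar p)) (k : ℕ) :
    ∀ᶠ q in 𝓝 p, kerDim k g q ≤ kerDim k g p :=
  (tendsto_diag p).eventually (eventually_finrank_ker_le (analyticAt_jetDeriv hg k))

lemma ker_jetDeriv_succ_le (k : ℕ) (x : CSpace N × CSpace N) :
    LinearMap.ker (jetDeriv (k + 1) g x : CSpace N →ₗ[ℂ] JetIndex N (k + 1) → ℂ) ≤
      LinearMap.ker (jetDeriv k g x : CSpace N →ₗ[ℂ] JetIndex N k → ℂ) := by
  intro v hv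
  rw [LinearMap.mem_ker] at hv ⊢
  ext l
  exact congrFun hv ⟨l.1, l.2.trans (Nat.le_succ k)⟩

lemma kerDim_succ_le (k : ℕ) (p : CSpace N) : kerDim (k + 1) g p ≤ kerDim k g p :=
  Submodule.finrank_mono (ker_jetDeriv_succ_le k _)

lemma kerDim_eq_zero_iff (k : ℕ) (p : CSpace N) :
    kerDim k g p = 0 ↔ ∀ v, jetDeriv k g (p, bar p) v = 0 → v = 0 := by
  rw [kerDim, Submodule.finrank_eq_zero, LinearMap.ker_eq_bot']
  rfl

/-! ### Consequences of constant rank -/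

/-- If the kernel has constant dimension along `M`, then the sections `v(x)` of the kernel over `M`
are annihilated by the derivative of the jet on a full neighborhood of `(p, p̄)`. The order `k'` of
the jet may be larger than the order `k` used to define `v`, if the kernels for `k` and `k'`
agree. -/
lemma IsSegreFunction.eventually_jetDeriv_kernelSection {p : CSpace N}
    (hg : IsSegreFunction M p m g) {k k' : ℕ} {T : (JetIndex N k → ℂ) →L[ℂ] CSpace N}
    {π : CSpace N →L[ℂ] CSpace N} (hn : IsNormalization (jetDeriv k g (p, bar p)) T π)
    (hk : ∀ᶠ q in 𝓝 p, q ∈ M → kerDim k g q = kerDim k g p)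
    (hk' : ∀ᶠ q in 𝓝 p, q ∈ M → ∀ v, jetDeriv k g (q, bar q) v = 0 →
      jetDeriv k' g (q, bar q) v = 0)
    {c : CSpace N} (hc : jetDeriv k g (p, bar p) c = 0) :
    ∀ᶠ x in 𝓝 (p, bar p), jetDeriv k' g x (kernelSection (jetDeriv k g) T π c x) = 0 := by
  have hA := analyticAt_jetDeriv hg.analytic k
  have hv := analyticAt_kernelSection hn hA c
  have ha : AnalyticAt ℂ
      (fun x => jetDeriv k' g x (kernelSection (jetDeriv k g) T π c x)) (p, bar p) :=
    analyticAt_clm_apply (analyticAt_jetDeriv hg.analytic k') hv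
  have hcomp : ∀ l, ∀ᶠ x in 𝓝 (p, bar p),
      jetDeriv k' g x (kernelSection (jetDeriv k g) T π c x) l = 0 := by
    intro l
    refine hg.eventually_eq_zero (analyticAt_pi_iff.1 ha l) ?_ ?_
    · filter_upwards [hg.zetaInvariant_jetDeriv k, hg.zetaInvariant_jetDeriv k'] with y h1 h2
      simp only [kernelSection, normalForm, h1, h2]
    · filter_upwards [hk, hk', (tendsto_diag p).eventually (eventually_isUnit_normalForm hn hA)]
        with q h1 h2 h3 hq
      rw [h2 hq _ (map_kernelSection hn h3 (h1 hq) hc)]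
      rfl
  filter_upwards [eventually_all.2 hcomp] with x hx
  ext l
  exact hx l

/-- Where the kernel of the derivative of the jet has constant dimension along `M`, there is a
holomorphic curve in every direction `c` of the kernel along which the jet is constant. It is
obtained by completing part of the jet to a coordinate system. -/
lemma IsSegreFunction.exists_curve {p : CSpace N} (hg : IsSegreFunction M p m g) {k : ℕ}
    (hk : ∀ᶠ q in 𝓝 p, q ∈ M → kerDim k g q = kerDim k g p)
    {c : CSpace N} (hc : jetDeriv k g (p, bar p) c = 0) :
    ∃ z : ℂ → CSpace N, z 0 = p ∧ HasDerivAt z c 0 ∧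
      ∀ᶠ s in 𝓝 0, jet k g (z s, bar p) = jet k g (p, bar p) := by
  obtain ⟨T, π, hn⟩ := exists_isNormalization (jetDeriv k g (p, bar p))
  have hA := analyticAt_jetDeriv hg.analytic k
  have hsec := hg.eventually_jetDeriv_kernelSection hn hk
    (Eventually.of_forall fun _ _ _ h => h) hc
  have hin : Tendsto (fun Z : CSpace N => (Z, bar p)) (𝓝 p) (𝓝 (p, bar p)) :=
    (Continuous.prodMk_left (bar p)).tendsto _
  have hjet : ∀ Z, AnalyticAt ℂ g (Z, bar p) → HasFDerivAt (fun Z' => jet k g (Z', bar p))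
      (jetDeriv k g (Z, bar p)) Z := by
    intro Z hZ
    rw [← fderiv_jet hZ]
    exact HasFDerivAt.comp (f := fun Z' => (Z', bar p)) Z
      (analyticAt_jet hZ k).differentiableAt.hasFDerivAt (hasFDerivAt_prodMk_left Z (bar p))
  let Ψ : CSpace N → CSpace N := fun Z => T (jet k g (Z, bar p)) + π Z
  have hΨ : ∀ Z, AnalyticAt ℂ g (Z, bar p) → HasFDerivAt Ψ
      (normalForm (jetDeriv k g) T π (Z, bar p)) Z := fun Z hZ =>
    (T.hasFDerivAt.comp Z (hjet Z hZ)).add π.hasFDerivAt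
  have hΨa : AnalyticAt ℂ Ψ p := by
    have h1 : AnalyticAt ℂ (fun Z => jet k g (Z, bar p)) p :=
      AnalyticAt.comp (g := jet k g) (f := fun Z => (Z, bar p)) (analyticAt_jet hg.analytic k)
        (analyticAt_id.prod analyticAt_const)
    exact ((T.analyticAt _).comp h1).add (π.analyticAt _)
  have hΨd : fderiv ℂ Ψ p = (ContinuousLinearEquiv.refl ℂ (CSpace N) : _ →L[ℂ] _) := by
    rw [(hΨ p hg.analytic).fderiv]
    exact hn.add_eq
  have hstrict : HasStrictFDerivAt Ψ
      (ContinuousLinearEquiv.refl ℂ (CSpace N) : CSpace N →L[ℂ] CSpace N) p := by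
    rw [← hΨd]
    exact hΨa.hasStrictFDerivAt
  let ψ := hstrict.localInverse Ψ _ p
  have hψa : AnalyticAt ℂ ψ (Ψ p) :=
    (hstrict.toOpenPartialHomeomorph Ψ).analyticAt_symm'
      hstrict.mem_toOpenPartialHomeomorph_source hΨa hΨd
  have hψp : ψ (Ψ p) = p := hstrict.localInverse_apply_image
  let z : ℂ → CSpace N := fun s => ψ (Ψ p + s • c)
  have hz0 : z 0 = p := by simp [z, hψp]
  have hza : AnalyticAt ℂ z 0 := by
    refine AnalyticAt.fun_comp (g := ψ) (f := fun s : ℂ => Ψ p + s • c) (by simpa using hψa) ?_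
    exact analyticAt_const.add (analyticAt_id.smul analyticAt_const)
  have hzt : Tendsto z (𝓝 0) (𝓝 p) := by
    have := hza.continuousAt.tendsto
    rwa [hz0] at this
  have hinv : ∀ᶠ s in 𝓝 (0 : ℂ), Ψ (z s) = Ψ p + s • c := by
    have h1 : Tendsto (fun s : ℂ => Ψ p + s • c) (𝓝 0) (𝓝 (Ψ p)) :=
      (by fun_prop : Continuous fun s : ℂ => Ψ p + s • c).tendsto' _ _ (by simp)
    exact h1.eventually hstrict.eventually_right_inverse
  have hderiv : ∀ᶠ s in 𝓝 (0 : ℂ),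
      HasDerivAt z (kernelSection (jetDeriv k g) T π c (z s, bar p)) s := by
    filter_upwards [hza.eventually_analyticAt, hinv.eventually_nhds,
      (hin.comp hzt).eventually hg.analytic.eventually_analyticAt,
      (hin.comp hzt).eventually (eventually_isUnit_normalForm hn hA)] with s h1 h2 h3 h4
    have h5 : HasDerivAt z (deriv z s) s := h1.differentiableAt.hasDerivAt
    have h6 := (hΨ (z s) h3).comp_hasDerivAt s h5
    have h7 : HasDerivAt (fun s : ℂ => Ψ p + s • c) c s := by
      simpa using ((hasDerivAt_id s).smul_const c).const_add (Ψ p)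
    have h8 := h6.unique (h7.congr_of_eventuallyEq h2)
    rw [kernelSection_eq (x := (z s, bar p)) h4 h8]
    exact h5
  refine ⟨z, hz0, ?_, ?_⟩
  · have := hderiv.self_of_nhds
    rwa [hz0, kernelSection_self hn] at this
  · have hconst : ∀ᶠ s in 𝓝 (0 : ℂ), HasDerivAt (fun s => jet k g (z s, bar p)) 0 s := by
      filter_upwards [hderiv, (hin.comp hzt).eventually hg.analytic.eventually_analyticAt,
        (hin.comp hzt).eventually hsec] with s h1 h2 h3
      have := (hjet (z s) h2).comp_hasDerivAt s h1
      rwa [show jetDeriv k g (z s, bar p) (kernelSection (jetDeriv k g) T π c (z s, bar p)) = 0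
        from h3] at this
    obtain ⟨ε, hε, hball⟩ := Metric.eventually_nhds_iff_ball.1 hconst
    filter_upwards [Metric.ball_mem_nhds (0 : ℂ) hε] with s hs
    have := Metric.isOpen_ball.is_const_of_deriv_eq_zero
      (convex_ball (0 : ℂ) ε).isPreconnected
      (fun s hs => (hball s hs).differentiableAt.differentiableWithinAt)
      (fun s hs => (hball s hs).deriv) hs (Metric.mem_ball_self hε)
    simpa [hz0] using this

/-- If the kernels for `k` and `k + 1` agree and have constant positive dimension along `M` near
`p`, then the sections of the kernel are independent of `ζ`, hence are holomorphic vector fields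
tangent to `M`. -/
lemma IsSegreFunction.holomorphicallyDegenerateAt {p : CSpace N} (hp : p ∈ M)
    (hM : IsRealAnalyticHypersurface M) (hg : IsSegreFunction M p m g) {k : ℕ}
    (hk : ∀ᶠ q in 𝓝 p, q ∈ M → kerDim k g q = kerDim k g p)
    (hk' : ∀ᶠ q in 𝓝 p, q ∈ M → kerDim (k + 1) g q = kerDim k g q)
    (hpos : kerDim k g p ≠ 0) : HolomorphicallyDegenerateAt M p := by
  obtain ⟨T, π, hn⟩ := exists_isNormalization (jetDeriv k g (p, bar p))
  have hA := analyticAt_jetDeriv hg.analytic k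
  obtain ⟨c, hc, hc0⟩ : ∃ c, jetDeriv k g (p, bar p) c = 0 ∧ c ≠ 0 := by
    by_contra! h
    exact hpos ((kerDim_eq_zero_iff k p).2 h)
  set v := kernelSection (jetDeriv k g) T π c with hv
  have hva : AnalyticAt ℂ v (p, bar p) := analyticAt_kernelSection hn hA c
  have hsec : ∀ᶠ x in 𝓝 (p, bar p), jetDeriv (k + 1) g x (v x) = 0 := by
    refine hg.eventually_jetDeriv_kernelSection hn hk ?_ hc
    filter_upwards [hk'] with q hq hqM w hw
    have := Submodule.eq_of_le_of_finrank_eq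
      (ker_jetDeriv_succ_le (g := g) k (q, bar q)) (hq hqM)
    have hw' : w ∈ LinearMap.ker
        (jetDeriv k g (q, bar q) : CSpace N →ₗ[ℂ] JetIndex N k → ℂ) := hw
    rw [← this] at hw'
    exact hw'
  have hunit := eventually_isUnit_normalForm hn hA
  -- `v` does not depend on `ζ`
  have hvd : ∀ᶠ x in 𝓝 (p, bar p), ∀ i, fderiv ℂ v x (zetaDir i) = 0 := by
    filter_upwards [hsec.eventually_nhds, hva.eventually_analyticAt,
      hg.analytic.eventually_analyticAt, hunit.eventually_nhds] with x h1 h2 h3 h4 i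
    have hvx := h2.differentiableAt.hasFDerivAt
    refine eq_zero_of_mem_ker (A := jetDeriv k g) h4.self_of_nhds ?_ ?_
    · ext l
      have hz := analyticAt_zetaWord h3 l.1
      have hzero : (fun y => fderiv ℂ (zetaWord l.1 g) y (v y, 0)) =ᶠ[𝓝 x] fun _ => 0 := by
        filter_upwards [h1] with y hy
        exact congrFun hy ⟨l.1, l.2.trans (Nat.le_succ k)⟩
      have hd : HasFDerivAt (fun y => fderiv ℂ (zetaWord l.1 g) y (v y, 0)) _ x :=
        hz.fderiv.differentiableAt.hasFDerivAt.clm_apply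
          (hvx.prodMk (hasFDerivAt_const (0 : CSpace N) x))
      have h5 := DFunLike.congr_fun (hd.fderiv.symm.trans hzero.fderiv_eq) (zetaDir i)
      have h6 : fderiv ℂ (fderiv ℂ (zetaWord l.1 g)) x (zetaDir i) (v x, 0) = 0 := by
        rw [(hz.contDiffAt (n := 2)).isSymmSndFDerivAt (by simp) (zetaDir i) (v x, 0)]
        have h7 := congrFun h1.self_of_nhds ⟨i :: l.1, by simpa using l.2⟩
        rw [jetDeriv_apply] at h7
        change fderiv ℂ (fun y => fderiv ℂ (zetaWord l.1 g) y (zetaDir i)) x (v x, 0) = 0 at h7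
        rw [fderiv_clm_apply hz.fderiv.differentiableAt (by fun_prop)] at h7
        simpa using h7
      simp only [_root_.add_apply, ContinuousLinearMap.comp_apply, ContinuousLinearMap.flip_apply,
        ContinuousLinearMap.prod_apply, h6, add_zero, _root_.zero_apply, fderiv_fun_const,
        Pi.zero_apply] at h5
      exact h5
    · have h8 : (fun y => π (v y)) =ᶠ[𝓝 x] fun _ => c := by
        filter_upwards [h4] with y hy using proj_kernelSection hn hy hc
      have h9 := DFunLike.congr_fun ((π.hasFDerivAt.comp x hvx).fderiv.symm.trans
        h8.fderiv_eq) (zetaDir i)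
      simpa using h9
  have hvZ : ∀ᶠ x in 𝓝 (p, bar p), v x = v (x.1, bar p) := by
    obtain ⟨ε, hε, hball⟩ := Metric.eventually_nhds_iff_ball.1
      (hvd.and hva.eventually_analyticAt)
    filter_upwards [Metric.ball_mem_nhds _ hε] with x hx
    rw [← ball_prod_same, Set.mem_prod] at hx
    have hmem : ∀ ζ ∈ Metric.ball (bar p) ε, (x.1, ζ) ∈ Metric.ball (p, bar p) ε := by
      intro ζ hζ
      rw [← ball_prod_same]
      exact ⟨hx.1, hζ⟩
    have hd : ∀ ζ ∈ Metric.ball (bar p) ε, HasFDerivAt (fun ζ => v (x.1, ζ))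
        (0 : CSpace N →L[ℂ] CSpace N) ζ := by
      intro ζ hζ
      obtain ⟨k1, k2⟩ := hball _ (hmem ζ hζ)
      have k3 := HasFDerivAt.comp ζ k2.differentiableAt.hasFDerivAt
        (hasFDerivAt_prodMk_right x.1 ζ)
      refine k3.congr_fderiv ?_
      ext η : 1
      rw [eq_sum_smul_e η, map_sum, map_sum]
      refine Finset.sum_congr rfl fun i _ => ?_
      rw [map_smul, map_smul]
      have := k1 i
      simp only [zetaDir] at this
      simp [this]
    exact Metric.isOpen_ball.is_const_of_fderiv_eq_zero (𝕜 := ℂ)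
      (convex_ball (bar p) ε).isPreconnected
      (fun ζ hζ => (hd ζ hζ).differentiableAt.differentiableWithinAt)
      (fun ζ hζ => (hd ζ hζ).fderiv) hx.2 (Metric.mem_ball_self hε)
  obtain ⟨ρ, hρ⟩ := hM p hp
  obtain ⟨R, hR⟩ := exists_isComplexification
    (f := toC ρ) (p := p) (Complex.ofRealCLM.analyticAt _ |>.comp hρ.analytic)
  have hmem : ∀ᶠ Z in 𝓝 p, Z ∈ M → R (Z, bar Z) = 0 := by
    filter_upwards [hR.2, hρ.mem_iff] with Z h1 h2 h3
    rw [h1, toC, h2.1 h3, Complex.ofReal_zero]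
  have hva' : AnalyticAt ℂ (fun Z => v (Z, bar p)) p :=
    AnalyticAt.comp (g := v) (f := fun Z => (Z, bar p)) hva
      (analyticAt_id.prod analyticAt_const)
  refine ⟨ρ, fun k Z => v (Z, bar p) k, hρ, fun k => analyticAt_pi_iff.1 hva' k, ?_, ?_⟩
  · intro h
    refine hc0 (funext fun k => ?_)
    have h0 : v (p, bar p) k = 0 := h.self_of_nhds k
    rwa [hv, kernelSection_self hn] at h0
  · filter_upwards [hR.dZ_eq, (tendsto_diag p).eventually hvZ, (tendsto_diag p).eventually hsec,
      (tendsto_diag p).eventually (hg.fderiv_segreProj hR.1 hmem), hg.mem]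
      with Z h1 h2 h3 h4 h5 hZ
    have h6 : segreProj m g (Z, bar Z) = (Z, bar Z) := by simp [segreProj, h5 hZ]
    have h7 : fderiv ℂ g (Z, bar Z) (v (Z, bar Z), 0) = 0 := congrFun h3 ⟨[], by simp⟩
    have h8 := h4 (v (Z, bar Z), 0)
    rw [h6, h7, mul_zero, neg_zero, h2] at h8
    rw [← h8]
    have h9 : ((v (Z, bar p), 0) : CSpace N × CSpace N) =
        ContinuousLinearMap.inl ℂ (CSpace N) (CSpace N) (v (Z, bar p)) := rfl
    rw [h9]
    conv_rhs => rw [eq_sum_smul_e (v (Z, bar p)), map_sum, map_sum]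
    refine Finset.sum_congr rfl fun k _ => ?_
    rw [map_smul, map_smul, h1 k, smul_eq_mul]
    rfl

/-! ### The nondegenerate locus -/

/-- The set where the kernel is trivial is dense in `M` near a point, as soon as it is nonempty:
a minor of maximal order that vanishes on an open subset of `M` vanishes on a neighborhood in
`ℂ^N × ℂ^N`, hence identically. -/
lemma frequently_kerDim_eq_zero {q p₁ p₂ : CSpace N} {ε : ℝ}
    (hg : ∀ x ∈ Metric.ball (q, bar q) ε, AnalyticAt ℂ g x)
    (hp₁ : p₁ ∈ Metric.ball q ε) {k : ℕ} (hd₁ : kerDim k g p₁ = 0)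
    (hp₂ : p₂ ∈ Metric.ball q ε) (hs : IsSegreFunction M p₂ m g) :
    ∃ᶠ p in 𝓝 p₂, p ∈ M ∧ kerDim k g p = 0 := by
  intro hcon
  have hmem : ∀ p ∈ Metric.ball q ε, (p, bar p) ∈ Metric.ball (q, bar q) ε := by
    intro p hp
    rw [← ball_prod_same]
    refine ⟨hp, ?_⟩
    rw [mem_ball_iff_norm] at hp ⊢
    rwa [← bar_sub, norm_bar]
  have hker : LinearMap.ker (jetDeriv k g (p₁, bar p₁) : CSpace N →ₗ[ℂ] JetIndex N k → ℂ) = ⊥ :=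
    Submodule.finrank_eq_zero.1 hd₁
  obtain ⟨T₀, hT₀⟩ := LinearMap.exists_leftInverse_of_injective _ hker
  let T := T₀.toContinuousLinearMap
  have hT : ∀ v, T (jetDeriv k g (p₁, bar p₁) v) = v := fun v => LinearMap.congr_fun hT₀ v
  let B : CSpace N × CSpace N → Matrix (Fin N) (Fin N) ℂ := fun x i j =>
    T (jetDeriv k g x (e j)) i
  have hBv : ∀ x v, (B x).mulVec v = T (jetDeriv k g x v) := by
    intro x v
    conv_rhs => rw [eq_sum_smul_e v, map_sum, map_sum]
    ext i
    simp [B, Matrix.mulVec, dotProduct, Finset.sum_apply, mul_comm]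
  have hBa : ∀ x ∈ Metric.ball (q, bar q) ε, AnalyticAt ℂ (fun y => (B y).det) x := by
    intro x hx
    have hent : ∀ i j, AnalyticAt ℂ (fun y => B y i j) x := by
      intro i j
      have h1 : AnalyticAt ℂ (fun y => T (jetDeriv k g y (e j))) x :=
        (T.analyticAt _).comp (analyticAt_clm_apply
          (analyticAt_jetDeriv (hg x hx) k) analyticAt_const)
      exact analyticAt_pi_iff.1 h1 i
    simp only [Matrix.det_apply]
    refine Finset.analyticAt_fun_sum _ fun σ _ => ?_
    exact (Finset.analyticAt_fun_prod _ fun i _ => hent _ _).const_smul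
  have hzero : ∀ᶠ x in 𝓝 (p₂, bar p₂), (B x).det = 0 := by
    refine hs.eventually_eq_zero (hBa _ (hmem _ hp₂)) ?_ ?_
    · filter_upwards [hs.zetaInvariant_jetDeriv k] with y hy
      simp only [B, hy]
    · filter_upwards [hcon] with p h1 h2
      have h3 : kerDim k g p ≠ 0 := fun h => h1 ⟨h2, h⟩
      rw [Ne, kerDim_eq_zero_iff] at h3
      push Not at h3
      obtain ⟨v, hv, hv0⟩ := h3
      exact Matrix.exists_mulVec_eq_zero_iff.1 ⟨v, hv0, by rw [hBv, hv, map_zero]⟩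
  have hI := AnalyticOnNhd.eqOn_zero_of_preconnected_of_eventuallyEq_zero (𝕜 := ℂ) hBa
    (convex_ball (q, bar q) ε).isPreconnected (hmem _ hp₂) hzero (hmem _ hp₁)
  obtain ⟨v, hv0, hv⟩ := Matrix.exists_mulVec_eq_zero_iff.2 hI
  rw [hBv, hT] at hv
  exact hv0 hv

end

/-! ### Ideals of germs -/

section

/-- **Hadamard's lemma**: `F(y) = F(0) + G(y) y` with `G` analytic. -/
lemma exists_eq_add_apply {E : Type*} [NormedAddCommGroup E] [NormedSpace ℂ E] {F : E → ℂ}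
    (hF : AnalyticAt ℂ F 0) :
    ∃ G : E → E →L[ℂ] ℂ, AnalyticAt ℂ G 0 ∧ ∀ᶠ y in 𝓝 0, F y = F 0 + G y y := by
  obtain ⟨q, r, hq⟩ := hF
  have hrad : 0 < q.shift.radius := by
    rw [FormalMultilinearSeries.radius_shift]
    exact hq.r_pos.trans_le hq.r_le
  have hG := q.shift.hasFPowerSeriesOnBall hrad
  refine ⟨q.shift.sum, hG.analyticAt, ?_⟩
  have h1 : HasFPowerSeriesOnBall (fun y => F 0 + q.shift.sum y (y - 0))
      (q.shift.unshift (F 0)) 0 q.shift.radius := hG.unshift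
  have h2 : q.shift.unshift (F 0) = q := by
    ext n v
    cases n with
    | zero => exact (hq.coeff_zero v).symm
    | succ n =>
      simp only [FormalMultilinearSeries.unshift, FormalMultilinearSeries.shift]
      simp
  rw [h2] at h1
  filter_upwards [Metric.eball_mem_nhds (0 : E) h1.r_pos,
    Metric.eball_mem_nhds (0 : E) hq.r_pos] with y hy hy'
  have h3 := h1.hasSum_sub hy
  have h4 := hq.hasSum_sub hy'
  simpa using h4.unique h3

variable {N : ℕ}

/-- The germ at `0` of a holomorphic function. -/
def germOf (f : CSpace N → ℂ) (hf : AnalyticAt ℂ f 0) : HolGerm N := ⟨f, f, hf, rfl⟩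

lemma exists_eq_germOf (x : HolGerm N) : ∃ f hf, x = germOf f hf := by
  obtain ⟨_, f, hf, rfl⟩ := x
  exact ⟨f, hf, rfl⟩

lemma algebraMap_eq_germOf (c : ℂ) :
    algebraMap ℂ (HolGerm N) c = germOf (fun _ => c) analyticAt_const := by
  apply Subtype.ext
  change c • (1 : Germ (𝓝 (0 : CSpace N)) ℂ) = _
  change (((fun _ => c • (1 : ℂ)) : CSpace N → ℂ) : Germ (𝓝 (0 : CSpace N)) ℂ) = _
  simp [germOf]

/-- An ideal that contains germs vanishing at the origin whose differentials there have no common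
kernel is of finite codimension: it contains the maximal ideal. -/
lemma finiteCodim_of_fderiv {I : Ideal (HolGerm N)} {ι : Type*} [Finite ι]
    {c : ι → CSpace N → ℂ} (hc : ∀ i, AnalyticAt ℂ (c i) 0) (hc0 : ∀ i, c i 0 = 0)
    (hI : ∀ i, germOf (c i) (hc i) ∈ I)
    (hker : ∀ v, (∀ i, fderiv ℂ (c i) 0 v = 0) → v = 0) : FiniteCodim I := by
  cases nonempty_fintype ι
  classical
  let cc : CSpace N → ι → ℂ := fun Z i => c i Z
  have hcc : AnalyticAt ℂ cc 0 := AnalyticAt.pi hc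
  have hccd : HasFDerivAt cc (ContinuousLinearMap.pi fun i => fderiv ℂ (c i) 0) 0 :=
    hasFDerivAt_pi.2 fun i => (hc i).differentiableAt.hasFDerivAt
  obtain ⟨T₀, hT₀⟩ := LinearMap.exists_leftInverse_of_injective
    (ContinuousLinearMap.pi fun i => fderiv ℂ (c i) 0 : CSpace N →ₗ[ℂ] ι → ℂ)
    (LinearMap.ker_eq_bot'.2 fun v hv => hker v fun i => congrFun hv i)
  let T := T₀.toContinuousLinearMap
  -- suitable linear combinations of the given germs form a coordinate system
  let C : CSpace N → CSpace N := fun Z => T (cc Z)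
  have hCa : AnalyticAt ℂ C 0 := (T.analyticAt _).comp hcc
  have hC0 : C 0 = 0 := by
    have : cc 0 = 0 := funext hc0
    simp [C, this]
  have hCd : fderiv ℂ C 0 = (ContinuousLinearEquiv.refl ℂ (CSpace N) : _ →L[ℂ] _) := by
    refine (T.hasFDerivAt.comp (0 : CSpace N) hccd).fderiv.trans ?_
    ext v : 1
    exact LinearMap.congr_fun hT₀ v
  have hstrict : HasStrictFDerivAt C
      (ContinuousLinearEquiv.refl ℂ (CSpace N) : CSpace N →L[ℂ] CSpace N) 0 := by
    rw [← hCd]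
    exact hCa.hasStrictFDerivAt
  let ψ := hstrict.localInverse C _ 0
  have hψa : AnalyticAt ℂ ψ (C 0) :=
    (hstrict.toOpenPartialHomeomorph C).analyticAt_symm'
      hstrict.mem_toOpenPartialHomeomorph_source hCa hCd
  have hψ0 : ψ (C 0) = 0 := hstrict.localInverse_apply_image
  rw [hC0] at hψa hψ0
  have hmax : ∀ f (hf : AnalyticAt ℂ f 0), f 0 = 0 → germOf f hf ∈ I := by
    intro f hf hf0
    obtain ⟨G, hG, hGe⟩ := exists_eq_add_apply (F := fun y => f (ψ y))
      (AnalyticAt.fun_comp (by rwa [hψ0]) hψa)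
    have hGi : ∀ i, AnalyticAt ℂ (fun Z => G (C Z) (T (Pi.single i 1))) 0 := fun i =>
      analyticAt_clm_apply (AnalyticAt.fun_comp (by rwa [hC0]) hCa) analyticAt_const
    have hsum : germOf f hf = ∑ i, germOf _ (hGi i) * germOf (c i) (hc i) := by
      apply Subtype.ext
      rw [AddSubmonoidClass.coe_finsetSum]
      have hcoe : ∑ i, ((germOf _ (hGi i) * germOf (c i) (hc i) : HolGerm N) :
          Germ (𝓝 (0 : CSpace N)) ℂ) =
          ((∑ i, (fun Z => G (C Z) (T (Pi.single i 1))) * c i : CSpace N → ℂ) :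
            Germ (𝓝 (0 : CSpace N)) ℂ) :=
        (map_sum (Germ.coeAddHom (𝓝 (0 : CSpace N)) : (CSpace N → ℂ) →+ _) _ _).symm
      rw [hcoe]
      refine Germ.coe_eq.2 ?_
      have hCt : Tendsto C (𝓝 0) (𝓝 0) := by
        have := hCa.continuousAt.tendsto
        rwa [hC0] at this
      filter_upwards [hstrict.eventually_left_inverse, hCt.eventually hGe] with Z h1 h2
      have h3 : f Z = G (C Z) (C Z) := by
        have h1' : ψ (C Z) = Z := h1
        rw [h1', hψ0, hf0, zero_add] at h2
        exact h2
      have h4 : C Z = ∑ i, cc Z i • T (Pi.single i 1) := by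
        change T (cc Z) = _
        conv_lhs => rw [pi_eq_sum_univ' (cc Z)]
        rw [map_sum]
        refine Finset.sum_congr rfl fun i _ => ?_
        rw [map_smul]
      refine (h3.trans (congrArg (G (C Z)) h4)).trans ?_
      rw [map_sum, Finset.sum_apply]
      refine Finset.sum_congr rfl fun i _ => ?_
      rw [map_smul, smul_eq_mul, Pi.mul_apply, mul_comm]
    rw [hsum]
    exact I.sum_mem fun i _ => I.mul_mem_left _ (hI i)
  refine Module.Finite.of_surjective (Algebra.linearMap ℂ (HolGerm N ⧸ I)) fun x => ?_
  obtain ⟨y, rfl⟩ := Ideal.Quotient.mk_surjective x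
  obtain ⟨f, hf, rfl⟩ := exists_eq_germOf y
  refine ⟨f 0, ?_⟩
  change Ideal.Quotient.mk I (algebraMap ℂ (HolGerm N) (f 0)) = _
  rw [Ideal.Quotient.mk_eq_mk_iff_sub_mem, algebraMap_eq_germOf]
  exact hmax (fun Z => f 0 - f Z) (analyticAt_const.sub hf) (sub_self _)

lemma aeval_germ (φ : CSpace N → ℂ) (P : Polynomial ℂ) :
    Polynomial.aeval (φ : Germ (𝓝 (0 : CSpace N)) ℂ) P =
      ((fun Z => P.eval (φ Z) : CSpace N → ℂ) : Germ (𝓝 (0 : CSpace N)) ℂ) := by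
  have hC : ∀ c : ℂ, algebraMap ℂ (Germ (𝓝 (0 : CSpace N)) ℂ) c =
      ((fun _ => c : CSpace N → ℂ) : Germ (𝓝 (0 : CSpace N)) ℂ) := fun c =>
    congrArg Subtype.val (algebraMap_eq_germOf (N := N) c)
  induction P using Polynomial.induction_on' with
  | add P Q hP hQ =>
    rw [map_add, hP, hQ]
    simp only [Polynomial.eval_add]
    rfl
  | monomial n c =>
    rw [Polynomial.aeval_monomial, hC]
    simp only [Polynomial.eval_monomial]
    rfl

/-- An ideal generated by germs that vanish along a regular curve through the origin is of
infinite codimension: no polynomial in a coordinate that is not constant along the curve belongs to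
the ideal. -/
lemma not_finiteCodim_of_curve {S : Set (HolGerm N)} {z : ℂ → CSpace N} {c : CSpace N}
    (hz0 : z 0 = 0) (hz : HasDerivAt z c 0) (hc : c ≠ 0)
    (hS : ∀ x ∈ S, ∃ f : CSpace N → ℂ, (x : Germ (𝓝 (0 : CSpace N)) ℂ) = f ∧
      ∀ᶠ s in 𝓝 0, f (z s) = 0) : ¬ FiniteCodim (Ideal.span S) := by
  intro hfin
  have hzt : Tendsto z (𝓝 0) (𝓝 0) := by
    have := hz.continuousAt.tendsto
    rwa [hz0] at this
  have hspan : ∀ x ∈ Ideal.span S, ∃ f : CSpace N → ℂ,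
      (x : Germ (𝓝 (0 : CSpace N)) ℂ) = f ∧ ∀ᶠ s in 𝓝 0, f (z s) = 0 := by
    intro x hx
    refine Submodule.span_induction hS ⟨0, rfl, Eventually.of_forall fun _ => rfl⟩ ?_ ?_ hx
    · rintro x y - - ⟨f, hf, hf0⟩ ⟨g, hg, hg0⟩
      refine ⟨f + g, ?_, ?_⟩
      · rw [Germ.coe_add, ← hf, ← hg]; rfl
      · filter_upwards [hf0, hg0] with s h1 h2
        simp [h1, h2]
    · rintro a x - ⟨f, hf, hf0⟩
      obtain ⟨a', ha', rfl⟩ := exists_eq_germOf a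
      refine ⟨a' * f, ?_, ?_⟩
      · rw [Germ.coe_mul, ← hf]; rfl
      · filter_upwards [hf0] with s h1
        simp [h1]
  -- the coordinate `Z i` would be a root modulo the ideal of a monic polynomial `P`, but `P (Z i)`
  -- has only isolated zeros on the curve
  obtain ⟨i, hi⟩ : ∃ i, c i ≠ 0 := by
    by_contra! h
    exact hc (funext h)
  have hcoord : AnalyticAt ℂ (fun Z : CSpace N => Z i) 0 :=
    (ContinuousLinearMap.proj (R := ℂ) (φ := fun _ : Fin N => ℂ) i).analyticAt 0
  let X : HolGerm N := germOf (fun Z => Z i) hcoord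
  have : Module.Finite ℂ (HolGerm N ⧸ Ideal.span S) := hfin
  obtain ⟨P, hP, hPX⟩ := IsIntegral.of_finite ℂ (Ideal.Quotient.mkₐ ℂ (Ideal.span S) X)
  have hmem : Polynomial.aeval X P ∈ Ideal.span S := by
    rw [← Ideal.Quotient.eq_zero_iff_mem, ← Ideal.Quotient.mkₐ_eq_mk ℂ,
      ← Polynomial.aeval_algHom_apply]
    exact hPX
  obtain ⟨f, hf, hf0⟩ := hspan _ hmem
  rw [Polynomial.aeval_subalgebra_coe] at hf
  have hf' : (fun Z : CSpace N => P.eval (Z i)) =ᶠ[𝓝 0] f :=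
    Germ.coe_eq.1 ((aeval_germ _ P).symm.trans hf)
  have hroot : ∀ᶠ s in 𝓝 (0 : ℂ), P.eval (z s i) = 0 := by
    filter_upwards [hzt.eventually hf', hf0] with s h1 h2
    rw [h1, h2]
  have hzi : HasDerivAt (fun s => z s i) (c i) 0 := hasDerivAt_pi.1 hz i
  have hne : ∀ᶠ s in 𝓝[≠] (0 : ℂ), ∀ w ∈ P.roots.toFinset, z s i ≠ w :=
    (Finset.eventually_all _).2 fun w _ => hzi.eventually_ne hi
  obtain ⟨s, h1, h2⟩ := ((hroot.filter_mono nhdsWithin_le_nhds).and hne).exists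
  refine h2 (z s i) ?_ rfl
  rw [Multiset.mem_toFinset, Polynomial.mem_roots hP.ne_zero]
  exact h1

variable {M : Set (CSpace N)} {p : CSpace N} {m : Fin N} {g R : CSpace N × CSpace N → ℂ}
  {A : Fin (N - 1) → Fin N → CSpace N × CSpace N → ℂ}

lemma IsAdapted.finiteCodim (hA : IsAdapted M p m g R A) {k : ℕ} (hk : kerDim k g p = 0) :
    FiniteCodim (cIdeal R A p k) := by
  let ι : Type := {α : Fin (N - 1) → ℕ // ∑ j, α j ≤ k}
  have hfin : Finite ι := by
    refine ((Set.finite_Icc (0 : Fin (N - 1) → ℕ) fun _ => k).subset ?_).to_subtype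
    intro α hα
    refine ⟨fun j => Nat.zero_le _, fun j => ?_⟩
    exact (Finset.single_le_sum (fun _ _ => Nat.zero_le _) (Finset.mem_univ j)).trans hα
  refine finiteCodim_of_fderiv (ι := ι) (c := fun α => cFun R A p α.1)
    (fun α => hA.analyticAt_cFun α.1) (fun α => hA.cFun_zero α.1) (fun α => ?_) fun v hv => ?_
  · exact Ideal.subset_span ⟨α.1, by exact_mod_cast α.2, rfl⟩
  · refine (kerDim_eq_zero_iff k p).1 hk v ?_
    rw [jetDeriv_eq_zero_iff hA.segre.analytic, ← hA.fderiv_cFun_eq_zero_iff]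
    exact fun α hα => hv ⟨α, hα⟩

/-- If the dimension of the kernel is constant and positive along `M` near `p`, the `c_α` with
`|α| ≤ k` vanish along a holomorphic curve on which the jet of `g` is constant. -/
lemma IsAdapted.not_finiteCodim (hA : IsAdapted M p m g R A) {k : ℕ}
    (hk : ∀ᶠ q in 𝓝 p, q ∈ M → kerDim k g q = kerDim k g p) (hpos : kerDim k g p ≠ 0) :
    ¬ FiniteCodim (cIdeal R A p k) := by
  have hg := hA.segre
  obtain ⟨c, hc, hc0⟩ : ∃ c, jetDeriv k g (p, bar p) c = 0 ∧ c ≠ 0 := by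
    by_contra! h
    exact hpos ((kerDim_eq_zero_iff k p).2 h)
  obtain ⟨z, hz0, hz, hjet⟩ := hg.exists_curve hk hc
  have hzt : Tendsto z (𝓝 0) (𝓝 p) := by
    have := hz.continuousAt.tendsto
    rwa [hz0] at this
  have hin : Tendsto (fun Z : CSpace N => (Z, bar p)) (𝓝 p) (𝓝 (p, bar p)) :=
    (Continuous.prodMk_left (bar p)).tendsto _
  refine not_finiteCodim_of_curve (z := fun s => z s - p) (by simp [hz0])
    (hz.sub_const p) hc0 ?_
  rintro x ⟨α, hα, hx⟩
  refine ⟨_, hx, ?_⟩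
  filter_upwards [hjet, hzt.eventually (hA.cFun_eq_zero k),
    (hin.comp hzt).eventually hg.analytic.eventually_analyticAt] with s h1 h2 h3
  exact h2 (vanishesToOrder_sub_of_jet_eq h3 hg.analytic h1) α (by exact_mod_cast hα)

end

section

variable {N : ℕ} {M : Set (CSpace N)} {p : CSpace N}

/-! ### The Levi form -/

lemma fderiv_apply_inl {F : CSpace N × CSpace N → ℂ} {P : CSpace N × CSpace N} (v : CSpace N) :
    fderiv ℂ F P (v, 0) = ∑ k, v k * fderiv ℂ F P (e k, 0) := by
  change fderiv ℂ F P (ContinuousLinearMap.inl ℂ (CSpace N) (CSpace N) v) = _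
  conv_lhs => rw [eq_sum_smul_e v, map_sum, map_sum]
  exact Finset.sum_congr rfl fun k _ => by rw [map_smul, map_smul]; rfl

lemma fderiv_apply_inr {F : CSpace N × CSpace N → ℂ} {P : CSpace N × CSpace N} (v : CSpace N) :
    fderiv ℂ F P (0, v) = ∑ k, v k * fderiv ℂ F P (zetaDir k) := by
  change fderiv ℂ F P (ContinuousLinearMap.inr ℂ (CSpace N) (CSpace N) v) = _
  conv_lhs => rw [eq_sum_smul_e v, map_sum, map_sum]
  exact Finset.sum_congr rfl fun k _ => by rw [map_smul, map_smul]; rfl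

/-- The reality of `ρ` in terms of its complexification. -/
lemma IsComplexification.fderiv_conj {ρ : CSpace N → ℝ} {R : CSpace N × CSpace N → ℂ}
    (hρ : AnalyticAt ℝ ρ p) (hR : IsComplexification p (toC ρ) R) (w : CSpace N) :
    fderiv ℂ R (p, bar p) (0, bar w) = starRingEnd ℂ (fderiv ℂ R (p, bar p) (w, 0)) := by
  have h1 := hR.fderiv_diag hρ w
  have h2 := hR.fderiv_diag hρ (Complex.I • w)
  have h3 : ((w, 0) : CSpace N × CSpace N) = (1 / 2 : ℂ) • ((w, bar w) -
      Complex.I • (Complex.I • w, bar (Complex.I • w))) := by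
    ext <;> (simp [smul_smul]; try ring)
  have h4 : ((0, bar w) : CSpace N × CSpace N) = (1 / 2 : ℂ) • ((w, bar w) +
      Complex.I • (Complex.I • w, bar (Complex.I • w))) := by
    ext <;> (simp [smul_smul]; try ring)
  rw [h3, h4, map_smul, map_smul, map_add, map_sub, map_smul, h1, h2]
  simp [sub_eq_add_neg, (map_ofNat (starRingEnd ℂ) 2 : starRingEnd ℂ 2 = 2)]

lemma IsComplexification.isTangent10_iff {ρ : CSpace N → ℝ} {R : CSpace N × CSpace N → ℂ}
    (hR : IsComplexification p (toC ρ) R) (v : CSpace N) :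
    IsTangent10 ρ p v ↔ fderiv ℂ R (p, bar p) (v, 0) = 0 := by
  rw [IsTangent10, fderiv_apply_inl]
  simp only [hR.dZ_eq.self_of_nhds]

lemma IsComplexification.leviForm_eq {ρ : CSpace N → ℝ} {R : CSpace N × CSpace N → ℂ}
    (hR : IsComplexification p (toC ρ) R) (v w : CSpace N) :
    leviForm ρ p v w = fderiv ℂ (fun x => fderiv ℂ R x (v, 0)) (p, bar p) (0, bar w) := by
  have hd := hR.1.fderiv.differentiableAt
  have hsnd : ∀ u u' : CSpace N × CSpace N,
      fderiv ℂ (fun x => fderiv ℂ R x u) (p, bar p) u' =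
        fderiv ℂ (fderiv ℂ R) (p, bar p) u' u := by
    intro u u'
    rw [fderiv_clm_apply hd (by fun_prop)]
    simp
  have hsymm := (hR.1.contDiffAt (n := 2)).isSymmSndFDerivAt (by simp)
  have hC : ∀ k, IsComplexification p (dZbar k (toC ρ)) (fun x => fderiv ℂ R x (zetaDir k)) := by
    intro k
    refine ⟨analyticAt_vfd (analyticAt_const (v := zetaDir k)) hR.1, ?_⟩
    filter_upwards [hR.dZbar_eq] with Z hZ using (hZ k).symm
  rw [fderiv_apply_inr]
  simp only [hsnd, hsymm (zetaDir _) (v, 0)]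
  have h1 : ∀ k, fderiv ℂ (fderiv ℂ R) (p, bar p) (v, 0) (zetaDir k) =
      ∑ j, v j * dZ j (dZbar k (toC ρ)) p := by
    intro k
    rw [← hsnd, fderiv_apply_inl]
    simp only [(hC k).dZ_eq.self_of_nhds]
  simp only [h1, leviForm, Finset.mul_sum]
  rw [Finset.sum_comm]
  refine Finset.sum_congr rfl fun k _ => Finset.sum_congr rfl fun j _ => ?_
  simp only [bar]
  ring

lemma vanishesToOrder_two_iff {V : Type*} [NormedAddCommGroup V] [NormedSpace ℂ V] {h : V → ℂ}
    {x : V} (ha : AnalyticAt ℂ h x) :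
    VanishesToOrder h x 2 ↔ h x = 0 ∧ fderiv ℂ h x = 0 := by
  constructor
  · intro H
    refine ⟨VanishesToOrder.apply_eq_zero (k := 1) H, ?_⟩
    obtain ⟨C, hC⟩ := (VanishesToOrder.fderiv_isBigO (k := 1) ha H).bound
    simpa using hC.self_of_nhds
  · rintro ⟨h0, h1⟩
    refine vanishesToOrder_succ_of_fderiv ha h0 ?_
    have := ha.fderiv.differentiableAt.isBigO_sub
    simpa [h1] using this.norm_right

/-- The Levi form at `p` is nondegenerate if and only if `M` is `1`-nondegenerate at `p`. -/
lemma IsSegreFunction.leviNondegenerate_iff {m : Fin N} {g : CSpace N × CSpace N → ℂ}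
    (hg : IsSegreFunction M p m g) {ρ : CSpace N → ℝ} (hρ : IsDefiningFunction M p ρ) :
    (∀ v, IsTangent10 ρ p v → (∀ w, IsTangent10 ρ p w → leviForm ρ p v w = 0) → v = 0) ↔
      kerDim 1 g p = 0 := by
  obtain ⟨R, hR⟩ := exists_isComplexification
    (f := toC ρ) (p := p) (Complex.ofRealCLM.analyticAt _ |>.comp hρ.analytic)
  have hmem : ∀ᶠ Z in 𝓝 p, Z ∈ M → R (Z, bar Z) = 0 := by
    filter_upwards [hR.2, hρ.mem_iff] with Z h1 h2 h3
    rw [h1, toC, h2.1 h3, Complex.ofReal_zero]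
  have hm := hg.fderiv_zetaDir_ne_zero hρ hR
  rw [kerDim_eq_zero_iff]
  refine forall_congr' fun v => ?_
  rw [← and_imp]
  refine imp_congr_left ?_
  have hRv : AnalyticAt ℂ (fun x => fderiv ℂ R x (v, 0)) (p, bar p) :=
    analyticAt_vfd (analyticAt_const (v := (v, (0 : CSpace N)))) hR.1
  have hh := analyticAt_slice hRv
  rw [jetDeriv_eq_zero_iff hg.analytic,
    ← hg.vanishesToOrder_fderiv_iff hR.1 hmem hm,
    vanishesToOrder_two_iff (hg.analyticAt_comp_segreProjAt hh), hR.isTangent10_iff]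
  refine and_congr ?_ ?_
  · rw [Function.comp_apply, hg.segreProjAt_self]
  · have hD := (hg.fderiv_comp_segreProjAt hh).self_of_nhds
    rw [hg.segreProjAt_self] at hD
    -- the differentials of `R` and `g` at `(p, p̄)` are proportional
    have hRg : ∀ ξ, fderiv ℂ R (p, bar p) (0, ξ) = 0 ↔ fderiv ℂ g (p, bar p) (0, ξ) = 0 := by
      intro ξ
      have := (hg.fderiv_segreProj hR.1 hmem).self_of_nhds (0, ξ)
      rw [hg.segreProj_self] at this
      rw [this]
      simp [hm]
    have hgm := hg.fderiv_zetaDir.self_of_nhds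
    have hadd : ∀ η, fderiv ℂ g (p, bar p)
        (0, η + fderiv ℂ g (p, bar p) (0, η) • e m) = 0 := by
      intro η
      have : ((0, η + fderiv ℂ g (p, bar p) (0, η) • e m) : CSpace N × CSpace N) =
          (0, η) + fderiv ℂ g (p, bar p) (0, η) • zetaDir m := by simp [zetaDir]
      rw [this, map_add, map_smul, hgm]
      simp
    have hlevi : ∀ w, leviForm ρ p v w =
        fderiv ℂ (fun ζ => fderiv ℂ R (p, ζ) (v, 0)) (bar p) (bar w) := fun w => by
      rw [hR.leviForm_eq, fderiv_slice hRv]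
    constructor
    · intro H
      ext η
      rw [hD]
      set ξ := η + fderiv ℂ g (p, bar p) (0, η) • (e m : CSpace N)
      have h1 : IsTangent10 ρ p (bar ξ) := by
        rw [hR.isTangent10_iff, ← starRingEnd_self_apply (fderiv ℂ R (p, bar p) (bar ξ, 0)),
          ← hR.fderiv_conj hρ.analytic, bar_bar, (hRg ξ).2 (hadd η), map_zero]
      have h2 := H _ h1
      rw [hlevi, bar_bar] at h2
      exact h2
    · intro H w hw
      have h1 : fderiv ℂ g (p, bar p) (0, bar w) = 0 := by
        rw [← hRg, hR.fderiv_conj hρ.analytic, (hR.isTangent10_iff w).1 hw, map_zero]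
      have h2 := hD (bar w)
      rw [H, h1] at h2
      rw [hlevi]
      simpa using h2.symm

/-! ### Generic nondegeneracy -/

/-- `M` is `k`-nondegenerate at `p`: the derivative in `Z` of the jet of order `k` in `ζ` of a
normalized equation has trivial kernel. Any other normalized equation then has this property too
(`NondegenerateAt.kerDim_eq_zero`). -/
def NondegenerateAt (M : Set (CSpace N)) (k : ℕ) (p : CSpace N) : Prop :=
  ∃ m g, IsSegreFunction M p m g ∧ kerDim k g p = 0

/-- Independence of the normalized equation: both kernels are the common kernel of the `dc_α`. -/
lemma NondegenerateAt.kerDim_eq_zero {k : ℕ} {m : Fin N} {g : CSpace N × CSpace N → ℂ}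
    (hM : IsRealAnalyticHypersurface M) (hp : p ∈ M) (h : NondegenerateAt M k p)
    (hg : IsSegreFunction M p m g) : kerDim k g p = 0 := by
  obtain ⟨m', g', hg', h0⟩ := h
  obtain ⟨R, A, hd⟩ := exists_isLocalData hM hp
  rw [kerDim_eq_zero_iff] at h0 ⊢
  intro v hv
  refine h0 v ?_
  rw [jetDeriv_eq_zero_iff hg.analytic, ← (hd.isAdapted hg).fderiv_cFun_eq_zero_iff] at hv
  rwa [jetDeriv_eq_zero_iff hg'.analytic, ← (hd.isAdapted hg').fderiv_cFun_eq_zero_iff]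

lemma exists_isSegreFunction_ball (hM : IsRealAnalyticHypersurface M) {q : CSpace N}
    (hq : q ∈ M) : ∃ m g, ∃ ε > 0, (∀ p ∈ Metric.ball q ε, p ∈ M → IsSegreFunction M p m g) ∧
      ∀ x ∈ Metric.ball (q, bar q) ε, AnalyticAt ℂ g x := by
  obtain ⟨m, g, h⟩ := exists_isSegreFunction hM hq
  obtain ⟨ε₁, hε₁, h1⟩ := Metric.eventually_nhds_iff_ball.1 h
  obtain ⟨ε₂, hε₂, h2⟩ := Metric.eventually_nhds_iff_ball.1
    (h.self_of_nhds hq).analytic.eventually_analyticAt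
  exact ⟨m, g, min ε₁ ε₂, lt_min hε₁ hε₂,
    fun p hp => h1 p (Metric.ball_subset_ball (min_le_left _ _) hp),
    fun x hx => h2 x (Metric.ball_subset_ball (min_le_right _ _) hx)⟩

lemma isOpen_nondegenerate (hM : IsRealAnalyticHypersurface M) (k : ℕ) :
    IsOpen {p : M | NondegenerateAt M k p} := by
  rw [isOpen_iff_mem_nhds]
  intro p hp
  obtain ⟨m, g, h⟩ := exists_isSegreFunction hM p.2
  have hg := h.self_of_nhds p.2
  have h0 := NondegenerateAt.kerDim_eq_zero hM p.2 hp hg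
  have hev : ∀ᶠ q in 𝓝 (p : CSpace N), q ∈ M → NondegenerateAt M k q := by
    filter_upwards [h, eventually_kerDim_le hg.analytic k] with q h1 h2 hq
    exact ⟨m, g, h1 hq, by omega⟩
  filter_upwards [continuous_subtype_val.continuousAt.eventually hev] with q hq using hq q.2

/-- By connectedness, the `k`-nondegenerate points are dense as soon as there is one. -/
lemma dense_nondegenerate (hM : IsRealAnalyticHypersurface M) (hconn : IsConnected M) {k : ℕ}
    (hne : {p : M | NondegenerateAt M k p}.Nonempty) :
    Dense {p : M | NondegenerateAt M k p} := by
  have : PreconnectedSpace M := Subtype.preconnectedSpace hconn.isPreconnected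
  rw [dense_iff_closure_eq]
  refine IsClopen.eq_univ ⟨isClosed_closure, ?_⟩ hne.closure
  rw [isOpen_iff_mem_nhds]
  intro q hq
  obtain ⟨m, g, ε, hε, hg, hga⟩ := exists_isSegreFunction_ball hM q.2
  have hball : {p : M | (p : CSpace N) ∈ Metric.ball (q : CSpace N) ε} ∈ 𝓝 q :=
    continuous_subtype_val.continuousAt.eventually (Metric.ball_mem_nhds _ hε)
  obtain ⟨p₁, hp₁, hnd₁⟩ := mem_closure_iff_nhds.1 hq _ hball
  filter_upwards [hball] with p₂ hp₂
  have hfr := frequently_kerDim_eq_zero hga hp₁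
    (NondegenerateAt.kerDim_eq_zero hM p₁.2 hnd₁ (hg _ hp₁ p₁.2)) hp₂ (hg _ hp₂ p₂.2)
  rw [mem_closure_iff_frequently, nhds_subtype_eq_comap, frequently_comap]
  refine (hfr.and_eventually (Metric.isOpen_ball.mem_nhds hp₂)).mono ?_
  rintro p ⟨⟨hpM, hp0⟩, hpb⟩
  exact ⟨⟨p, hpM⟩, rfl, m, g, hg p hpb hpM, hp0⟩

/-- Every relatively open subset of `M` contains a point near which the dimensions of finitely many
of the kernels are constant: a point where their sum is minimal. -/
lemma exists_kerDim_eventually_eq {m : Fin N} {g : CSpace N × CSpace N → ℂ} {O : Set (CSpace N)}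
    (hO : IsOpen O) (hg : ∀ p ∈ O, p ∈ M → IsSegreFunction M p m g) (hne : (O ∩ M).Nonempty)
    (K : ℕ) :
    ∃ p ∈ O ∩ M, ∀ k < K, ∀ᶠ q in 𝓝 p, q ∈ M → kerDim k g q = kerDim k g p := by
  let f : CSpace N → ℕ := fun p => ∑ k ∈ Finset.range K, kerDim k g p
  obtain ⟨p, hp, hmin⟩ := (InvImage.wf f Nat.lt_wfRel.wf).has_min (O ∩ M) hne
  refine ⟨p, hp, fun k hk => ?_⟩
  have hle : ∀ᶠ q in 𝓝 p, ∀ k, k ∈ Finset.range K → kerDim k g q ≤ kerDim k g p :=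
    (Finset.eventually_all _).2 fun k _ => eventually_kerDim_le (hg p hp.1 hp.2).analytic k
  filter_upwards [hle, hO.mem_nhds hp.1] with q h1 h2 hq
  have h3 : f q = f p :=
    le_antisymm (Finset.sum_le_sum h1) (not_lt.1 (hmin q ⟨h2, hq⟩))
  exact (Finset.sum_eq_sum_iff_of_le h1).1 h3 k (Finset.mem_range.2 hk)

/-- For `k = 0` the kernel is not the whole space, since `∂g/∂Z ≠ 0` by reality of `M`. -/
lemma kerDim_zero_le (hM : IsRealAnalyticHypersurface M) (hp : p ∈ M) {m : Fin N}
    {g : CSpace N × CSpace N → ℂ} (hg : IsSegreFunction M p m g) : kerDim 0 g p ≤ N - 1 := by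
  by_contra! hlt
  have hle : kerDim 0 g p ≤ N := (Submodule.finrank_le _).trans (by simp)
  have htop : LinearMap.ker (jetDeriv 0 g (p, bar p) : CSpace N →ₗ[ℂ] JetIndex N 0 → ℂ) = ⊤ :=
    Submodule.eq_top_of_finrank_eq (by simpa [kerDim] using (show kerDim 0 g p = N by omega))
  obtain ⟨ρ, hρ⟩ := hM p hp
  obtain ⟨R, hR⟩ := exists_isComplexification
    (f := toC ρ) (p := p) (Complex.ofRealCLM.analyticAt _ |>.comp hρ.analytic)
  have hmem : ∀ᶠ Z in 𝓝 p, Z ∈ M → R (Z, bar Z) = 0 := by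
    filter_upwards [hR.2, hρ.mem_iff] with Z h1 h2 h3
    rw [h1, toC, h2.1 h3, Complex.ofReal_zero]
  refine hg.fderiv_zetaDir_ne_zero hρ hR ?_
  have h1 : jetDeriv 0 g (p, bar p) (e m) = 0 := by
    have : (e m : CSpace N) ∈
        LinearMap.ker (jetDeriv 0 g (p, bar p) : CSpace N →ₗ[ℂ] JetIndex N 0 → ℂ) := by
      rw [htop]; trivial
    exact this
  have h2 : fderiv ℂ g (p, bar p) (e m, 0) = 0 := congrFun h1 ⟨[], by simp⟩
  have h3 := (hg.fderiv_segreProj hR.1 hmem).self_of_nhds (e m, 0)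
  rw [hg.segreProj_self, h2, mul_zero, neg_zero] at h3
  have h4 := hR.fderiv_conj hρ.analytic (e m)
  rw [h3, map_zero, bar_e] at h4
  exact h4

/-- For `k = 0` the kernel is that of a single linear functional on `ℂ^N`, with `N ≥ 2`. -/
lemma kerDim_zero_ne_zero (hN : 2 ≤ N) (g : CSpace N × CSpace N → ℂ) : kerDim 0 g p ≠ 0 := by
  intro h
  have h1 := LinearMap.finrank_le_finrank_of_injective
    (LinearMap.ker_eq_bot.1 (Submodule.finrank_eq_zero.1 h))
  have h2 : Fintype.card (JetIndex N 0) ≤ 1 := by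
    rw [Fintype.card_le_one_iff_subsingleton]
    refine ⟨fun a b => Subtype.ext ?_⟩
    rw [List.length_eq_zero_iff.1 (Nat.le_zero.1 a.2), List.length_eq_zero_iff.1
      (Nat.le_zero.1 b.2)]
  simp at h1
  omega

/-- A holomorphically nondegenerate hypersurface is `(N - 1)`-nondegenerate somewhere: the
dimensions of the kernels, which start at `N - 1`, cannot be stationary on an open set before they
reach zero. -/
lemma exists_nondegenerate (hM : IsRealAnalyticHypersurface M) (hne : M.Nonempty)
    (hnd : HolomorphicallyNondegenerate M) :
    {p : M | NondegenerateAt M (N - 1) p}.Nonempty := by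
  obtain ⟨q, hq⟩ := hne
  obtain ⟨m, g, ε, hε, hg, -⟩ := exists_isSegreFunction_ball hM hq
  obtain ⟨p, ⟨hpb, hpM⟩, hp⟩ := exists_kerDim_eventually_eq Metric.isOpen_ball hg
    ⟨q, Metric.mem_ball_self hε, hq⟩ (N - 1 + 1)
  have hgp := hg p hpb hpM
  refine ⟨⟨p, hpM⟩, m, g, hgp, ?_⟩
  change kerDim (N - 1) g p = 0
  by_contra hpos
  have hstrict : ∀ k < N - 1, kerDim (k + 1) g p < kerDim k g p := by
    intro k hk
    refine lt_of_le_of_ne (kerDim_succ_le k p) fun heq => hnd p hpM ?_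
    have hk0 : kerDim k g p ≠ 0 := by
      have hanti : Antitone fun k => kerDim k g p := antitone_nat_of_succ_le fun k =>
        kerDim_succ_le k p
      have : kerDim (N - 1) g p ≤ kerDim k g p := hanti hk.le
      omega
    refine hgp.holomorphicallyDegenerateAt hpM hM (hp k (by omega)) ?_ hk0
    filter_upwards [hp k (by omega), hp (k + 1) (by omega)] with q h1 h2 hqM
    rw [h1 hqM, h2 hqM, heq]
  have hle : ∀ k ≤ N - 1, kerDim k g p ≤ N - 1 - k := by
    intro k
    induction k with
    | zero => intro _; exact kerDim_zero_le hM hpM hgp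
    | succ k ih =>
      intro hk
      have h1 := ih (by omega)
      have h2 := hstrict k (by omega)
      omega
  have := hle (N - 1) le_rfl
  omega

/-- If `M` is nowhere `k`-nondegenerate for `k < l`, then near generic points of `M` the ideals
generated by the `c_α` with `|α| ≤ k`, `k < l`, are of infinite codimension. -/
lemma dense_not_finiteCodim (hM : IsRealAnalyticHypersurface M) {l : ℕ}
    (hl : ∀ k < l, ∀ p ∈ M, ¬ NondegenerateAt M k p) :
    Dense {p : M | ∀ᶠ q : M in 𝓝 p, ∀ k < l, ∀ R A, IsLocalData M (q : CSpace N) R A →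
      ¬ FiniteCodim (cIdeal R A (q : CSpace N) k)} := by
  rw [dense_iff_inter_open]
  rintro U hU ⟨q, hqU⟩
  obtain ⟨O, hO, rfl⟩ := isOpen_induced_iff.1 hU
  obtain ⟨m, g, ε, hε, hg, -⟩ := exists_isSegreFunction_ball hM q.2
  obtain ⟨p, ⟨hpO, hpM⟩, hp⟩ := exists_kerDim_eventually_eq (O := O ∩ Metric.ball (q : CSpace N) ε)
    (hO.inter Metric.isOpen_ball) (fun p hp => hg p hp.2)
    ⟨q, ⟨hqU, Metric.mem_ball_self hε⟩, q.2⟩ l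
  refine ⟨⟨p, hpM⟩, hpO.1, ?_⟩
  have hev : ∀ᶠ q' in 𝓝 p, q' ∈ M → ∀ k < l, ∀ R A, IsLocalData M q' R A →
      ¬ FiniteCodim (cIdeal R A q' k) := by
    have hall : ∀ᶠ q' in 𝓝 p, ∀ k, k ∈ Finset.range l → ∀ᶠ q'' in 𝓝 q', q'' ∈ M →
        kerDim k g q'' = kerDim k g p :=
      (Finset.eventually_all _).2 fun k hk => (hp k (Finset.mem_range.1 hk)).eventually_nhds
    filter_upwards [hall, Metric.isOpen_ball.mem_nhds hpO.2] with q' h1 h2 hq' k hk R A hd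
    have hgq := hg q' h2 hq'
    have h3 := h1 k (Finset.mem_range.2 hk)
    refine (hd.isAdapted hgq).not_finiteCodim ?_ fun h0 => hl k hk q' hq' ⟨m, g, hgq, h0⟩
    filter_upwards [h3] with q'' h4 h5
    rw [h4 h5, h3.self_of_nhds hq']
  exact ((continuous_subtype_val.tendsto (⟨p, hpM⟩ : M)).eventually hev).mono fun q' h => h q'.2

lemma finiteCodim_of_le {I J : Ideal (HolGerm N)} (hIJ : I ≤ J) (hI : FiniteCodim I) :
    FiniteCodim J := by
  have : Module.Finite ℂ (HolGerm N ⧸ I) := hI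
  exact Module.Finite.of_surjective (Ideal.Quotient.factorₐ ℂ hIJ).toLinearMap
    (Ideal.Quotient.factor_surjective hIJ)

end

end CSpace

end

/-! ### The essential finiteness index -/

theorem proposition1p2 (N : ℕ) (hN : 2 ≤ N) (M : Set (CSpace N))
    (hM : CSpace.IsRealAnalyticHypersurface M) (hconn : IsConnected M)
    (hnd : CSpace.HolomorphicallyNondegenerate M) :
    ∃ l : ℕ, (1 ≤ l ∧ l ≤ N - 1) ∧
      CSpace.Generically M (fun p => CSpace.HasEssentialIndex M p l) ∧
      (l = 1 ↔ CSpace.Generically M (CSpace.LeviNondegenerateAt M)) := by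
  classical
  have hex : ∃ k, {p : M | CSpace.NondegenerateAt M k p}.Nonempty :=
    ⟨N - 1, CSpace.exists_nondegenerate hM hconn.nonempty hnd⟩
  have hlevi : ∀ p ∈ M, CSpace.LeviNondegenerateAt M p ↔ CSpace.NondegenerateAt M 1 p := by
    intro p hp
    constructor
    · rintro ⟨ρ, hρ, h⟩
      obtain ⟨m, g, hg⟩ := CSpace.exists_isSegreFunction hM hp
      exact ⟨m, g, hg.self_of_nhds hp, ((hg.self_of_nhds hp).leviNondegenerate_iff hρ).1 h⟩
    · rintro ⟨m, g, hg, h⟩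
      obtain ⟨ρ, hρ⟩ := hM p hp
      exact ⟨ρ, hρ, (hg.leviNondegenerate_iff hρ).2 h⟩
  -- `l` is the least order of nondegeneracy that occurs on `M`
  set l := Nat.find hex
  have hlne : {p : M | CSpace.NondegenerateAt M l p}.Nonempty := Nat.find_spec hex
  have hopen := CSpace.isOpen_nondegenerate hM l
  have hdense := CSpace.dense_nondegenerate hM hconn hlne
  have hl1 : 1 ≤ l := by
    obtain ⟨p, m, g, -, h⟩ := hlne
    rcases Nat.eq_zero_or_pos l with h0 | h0
    · rw [h0] at h
      exact absurd h (CSpace.kerDim_zero_ne_zero hN g)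
    · exact h0
  refine ⟨l, ⟨hl1, Nat.find_min' hex (CSpace.exists_nondegenerate hM hconn.nonempty hnd)⟩,
    ?_, ?_⟩
  · refine ⟨_, hopen.inter isOpen_setOfPred_eventually_nhds,
      hdense.inter_of_isOpen_left (CSpace.dense_not_finiteCodim hM (l := l) ?_) hopen, ?_⟩
    · exact fun k hk p hp h => Nat.find_min hex hk ⟨⟨p, hp⟩, h⟩
    · rintro p ⟨⟨m, g, hg, h0⟩, hinf⟩
      have hfin : ∀ R A, CSpace.IsLocalData M (p : CSpace N) R A →
          CSpace.FiniteCodim (CSpace.cIdeal R A (p : CSpace N) l) := fun R A hd =>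
        (hd.isAdapted hg).finiteCodim h0
      refine ⟨⟨CSpace.exists_isLocalData hM p.2, fun R A hd =>
        CSpace.finiteCodim_of_le ?_ (hfin R A hd)⟩, fun R A hd => ⟨⟨hl1, hfin R A hd⟩, ?_⟩⟩
      · refine Ideal.span_mono ?_
        rintro x ⟨α, -, hx⟩
        exact ⟨α, le_top, hx⟩
      · rintro k ⟨-, hk⟩
        by_contra! hlt
        exact hinf.self_of_nhds k hlt R A hd hk
  · constructor
    · intro h1
      rw [h1] at hopen hdense
      exact ⟨_, hopen, hdense, fun p hp => (hlevi p p.2).2 hp⟩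
    · rintro ⟨U, -, hU, h⟩
      have : Nonempty M := hconn.nonempty.to_subtype
      obtain ⟨p, hp⟩ := hU.nonempty
      exact le_antisymm (Nat.find_min' hex ⟨p, (hlevi p p.2).1 (h p hp)⟩) hl1
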